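/- Throughout, $i\neq 0$ is a real constant, $D=\partial_x+p\,\partial_y+Q\,\partial_p$, and for an equation $y''=Q(x,y,y')$, with $p=y'$, the relative invariants $w_1,w_2$ are $$w_1=D^2Q_{pp}-4DQ_{py}-Q_pDQ_{pp}+4Q_pQ_{py}-3Q_{pp}Q_y+6Q_{yy},\qquad w_2=Q_{pppp}.$$ The Fefferman metrics of the equation are the metrics, in the coordinates $(x,y,p,\phi)$, $$g_F=2\rho^2\Big[(dp-Q\,dx)\,dx-(dy-p\,dx)\Big(\tfrac23 i\,d\phi+\tfrac23Q_p\,dx+\tfrac16Q_{pp}(dy-p\,dx)\Big)\Big],$$ where $\rho$ is a smooth nowhere vanishing function of $(x,y,p,\phi)$. A four-dimensional metric of signature $(++--)$ is of type $N\times N'$ at a point if there both the self-dual part and the anti-self-dual part of its Weyl tensor, regarded as endomorphisms of the two-forms, are nonzero with square zero. A metric $g$ on $U$ is conformal to an Einstein metric on $U$ if some $g'=\rho^2g$, with $\rho$ smooth and nowhere zero on $U$, satisfies $\mathrm{Ric}(g')=\Lambda g'$ with a constant $\Lambda$. Let $I\subseteq\mathbb R$ be open, let $h\in C^4(I)$ be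 real, and consider $y''=h(y')$, that is, $Q(x,y,p)=h(p)$. (1) For $p\in I$ one has $w_1=h^2h''''$ and $w_2=h''''$. (2) If moreover $h\in C^6(I)$, then the Fefferman metrics are conformal to an Einstein metric on some nonempty open set of points $(x,y,p,\phi)$ with $p\in I$ if and only if $h''''$ vanishes identically on some nonempty open subset of $I$. (3) Let $(a,b)\in\mathbb R^2\setminus\{(0,0)\}$ and suppose that $h(p)^2h''''(p)=ap+b$ for all $p\in I$. Then on every open set $U$ of points $(x,y,p,\phi)$ with $p\in I$, and for every smooth nowhere vanishing $\rho$ on $U$, the metric $g_F$ has signature $(++--)$, is Bach-flat, is of type $N\times N'$ at each point with $ap+b\neq0$, and, if $U\neq\emptyset$, is not conformal to an Einstein metric on $U$. (4) The CR structure $\lambda=du+y^{-3}dx$, $\mu=dx+\sqrt{-1}\,dy$ on $\{(u,x,y):y\neq0\}$ has three infinitesimal symmetries, linearly independent at each point, that span a Lie algebra of Bianchi type $VI_k$ for some $k<0$ (where $VI_k$, $k=-\alpha^2$, is the Lie algebra $[e_1,e_2]=-\alpha e_2-e_3$, $[e_3,e_1]=e_2+\alpha e_3$, $[e_2,e_3]=0$).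 (5) For every real $i\ne0$ the realified forms $\lambda=du+y^{-3}dx$, $\mu=dx+i\,dy$, $\bar\mu=dx-i\,dy$ on $\{y\neq0\}$ are equivalent, through a diffeomorphism onto $\{(X,Y,P):P\neq0\}$ and up to $\lambda\mapsto a\lambda$, $\mu\mapsto b\mu+c\lambda$, $\bar\mu\mapsto \bar b\bar\mu+\bar c\lambda$ with real functions, $ab\bar b\ne0$, to the forms $-i(dY-P\,dX)$, $dP-h(P)\,dX$, $dX$ of the equation $Y''=h(Y')$ with $$h(P)=-\frac{3}{2i}(-P)^{4/3}=-\frac{3}{2i}|P|^{4/3}.$$ This $h$ satisfies $h(-f(y))=\frac1{2i}f'(y)$ for $f(y)=y^{-3}$, $y\ne0$; it is smooth for $P\neq0$, where $h^2h''''=-\dfrac{5}{3i^3}$. The metric $$g=2\big(iP^{2/3}dP+\tfrac32P^2dX\big)dX-2\,(dY-P\,dX)\big(\tfrac23i^2P^{2/3}d\Phi-\tfrac19dY-\tfrac{11}9P\,dX\big),$$ with $P^{2/3}=|P|^{2/3}$, is $i|P|^{2/3}$ times the Fefferman metric of this equation with $\rho=1$. On every open subset $U$ of $\{P\neq0\}$,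 each metric $\rho^2g$ with $\rho$ smooth and nowhere zero on $U$ has signature $(++--)$, is Bach-flat, is of type $N\times N'$ at every point, and, if $U\neq\emptyset$, is not conformal to an Einstein metric on $U$. -/

import Mathlib

open scoped ContDiff

noncomputable section

namespace FeffermanODE

/-! ### Coordinate calculus on `ℝⁿ` -/

/-- The partial derivative `∂f/∂x^k`. -/
def pd {n : ℕ} {F : Type*} [NormedAddCommGroup F] [NormedSpace ℝ F]
    (k : Fin n) (f : (Fin n → ℝ) → F) (x : Fin n → ℝ) : F :=
  fderiv ℝ f x (Pi.single k 1)

/-- The coordinate one-form `dx^k`, as its tuple of components. -/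
def coordForm {n : ℕ} (k : Fin n) : Fin n → ℝ := Pi.single k 1

/-! ### Curvature of a pseudo-Riemannian metric on (an open part of) `ℝ⁴` -/

/-- A field of bilinear forms on `ℝ⁴`, given by its components `g_ab`. -/
abbrev MetricField := (Fin 4 → ℝ) → Matrix (Fin 4) (Fin 4) ℝ

/-- Christoffel symbols `Γ^a_{bc}` of the Levi-Civita connection. -/
def christoffel (g : MetricField) (a b c : Fin 4) (x : Fin 4 → ℝ) : ℝ :=
  (1 / 2) * ∑ d, (g x)⁻¹ a d *
    (pd b (fun z => g z d c) x + pd c (fun z => g z d b) x - pd d (fun z => g z b c) x)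

/-- The Riemann tensor
`R^a_{bcd} = ∂_c Γ^a_{db} - ∂_d Γ^a_{cb} + Γ^a_{ce} Γ^e_{db} - Γ^a_{de} Γ^e_{cb}`. -/
def riemannUp (g : MetricField) (a b c d : Fin 4) (x : Fin 4 → ℝ) : ℝ :=
  pd c (christoffel g a d b) x - pd d (christoffel g a c b) x
    + ∑ e, (christoffel g a c e x * christoffel g e d b x
        - christoffel g a d e x * christoffel g e c b x)

/-- The Riemann tensor `R_{abcd}` with all indices down. -/
def riemann (g : MetricField) (a b c d : Fin 4) (x : Fin 4 → ℝ) : ℝ :=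
  ∑ e, g x a e * riemannUp g e b c d x

/-- The Ricci tensor `R_{bd} = R^a_{bad}`. -/
def ricci (g : MetricField) (b d : Fin 4) (x : Fin 4 → ℝ) : ℝ :=
  ∑ a, riemannUp g a b a d x

/-- The scalar curvature. -/
def scalarCurv (g : MetricField) (x : Fin 4 → ℝ) : ℝ :=
  ∑ a, ∑ b, (g x)⁻¹ a b * ricci g a b x

/-- The Schouten tensor `P_{ab} = (1/2) (R_{ab} - (R/6) g_{ab})` in dimension four. -/
def schouten (g : MetricField) (a b : Fin 4) (x : Fin 4 → ℝ) : ℝ :=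
  (1 / 2) * (ricci g a b x - scalarCurv g x / 6 * g x a b)

/-- The Weyl tensor `C_{abcd}`. -/
def weyl (g : MetricField) (a b c d : Fin 4) (x : Fin 4 → ℝ) : ℝ :=
  riemann g a b c d x
    - (g x a c * schouten g b d x - g x a d * schouten g b c x
        + g x b d * schouten g a c x - g x b c * schouten g a d x)

/-- The divergence `∇^d C_{abcd}` of the Weyl tensor, where
`∇_e C_{abcd} = ∂_e C_{abcd} - Γ^m_{ea} C_{mbcd} - ... - Γ^m_{ed} C_{abcm}`. -/
def divWeyl (g : MetricField) (a b c : Fin 4) (x : Fin 4 → ℝ) : ℝ :=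
  ∑ e, ∑ d, (g x)⁻¹ e d *
    (pd e (weyl g a b c d) x
      - ∑ m, (christoffel g m e a x * weyl g m b c d x
          + christoffel g m e b x * weyl g a m c d x
          + christoffel g m e c x * weyl g a b m d x
          + christoffel g m e d x * weyl g a b c m x))

/-- The Bach tensor `B_{ab} = ∇^c ∇^d C_{acbd} + (1/2) R^{cd} C_{acbd}`. -/
def bach (g : MetricField) (a b : Fin 4) (x : Fin 4 → ℝ) : ℝ :=
  (∑ e, ∑ c, (g x)⁻¹ e c *
    (pd e (divWeyl g a c b) x
      - ∑ m, (christoffel g m e a x * divWeyl g m c b x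
          + christoffel g m e c x * divWeyl g a m b x
          + christoffel g m e b x * divWeyl g a c m x)))
    + (1 / 2) * ∑ c, ∑ d, (∑ r, ∑ s, (g x)⁻¹ c r * (g x)⁻¹ d s * ricci g r s x) *
        weyl g a c b d x

/-- The metric satisfies the Bach equations on `U`. -/
def IsBachFlatOn (g : MetricField) (U : Set (Fin 4 → ℝ)) : Prop :=
  ∀ x ∈ U, ∀ a b, bach g a b x = 0

/-- The metric is Einstein on `U`: `Ric = Λ g` with a constant `Λ`. -/
def IsEinsteinOn (g : MetricField) (U : Set (Fin 4 → ℝ)) : Prop :=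
  ∃ Λ : ℝ, ∀ x ∈ U, ∀ a b, ricci g a b x = Λ * g x a b

/-- On `U` the metric `g'` is `ρ² g` for a smooth nowhere vanishing function `ρ`. -/
def IsConformalOn (g g' : MetricField) (U : Set (Fin 4 → ℝ)) : Prop :=
  ∃ ρ : (Fin 4 → ℝ) → ℝ, ContDiffOn ℝ ∞ ρ U ∧ (∀ x ∈ U, ρ x ≠ 0) ∧
    ∀ x ∈ U, g' x = (ρ x) ^ 2 • g x

/-- The symmetric bilinear form with matrix `M` has signature `(+ + - -)`. -/
def HasSplitSignature (M : Matrix (Fin 4) (Fin 4) ℝ) : Prop :=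
  ∃ A : Matrix (Fin 4) (Fin 4) ℝ, IsUnit A.det ∧
    A.transpose * M * A = Matrix.diagonal ![1, 1, -1, -1]

/-- The Levi-Civita symbol: the sign of `(a b c d)` as a permutation of `(0 1 2 3)`, and `0` if it
is not a permutation. -/
def leviCivita (a b c d : Fin 4) : ℝ :=
  Matrix.det (Matrix.of fun r s : Fin 4 => if ![a, b, c, d] r = s then (1 : ℝ) else 0)

/-- The part `C^± = (1/2) (C ± *C)` of the Weyl tensor, for the sign `s = ±1`, where
`(*C)_{abcd} = (1/2) ε_{ab}^{ef} C_{efcd}` and `ε` is the volume form of `g`.  For `s = 1` this is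
the self-dual part, for `s = -1` the anti-self-dual part. -/
def weylDual (g : MetricField) (s : ℝ) (a b c d : Fin 4) (x : Fin 4 → ℝ) : ℝ :=
  (1 / 2) * (weyl g a b c d x
    + s * ((1 / 2) * ∑ e, ∑ f, ∑ e', ∑ f',
        Real.sqrt |(g x).det| * leviCivita a b e' f' * (g x)⁻¹ e' e * (g x)⁻¹ f' f *
          weyl g e f c d x))

/-- The part `C^±` of the Weyl tensor is of Petrov type N at `x`: the endomorphism of the two-forms
which it defines is nonzero and has square zero. -/
def HasPetrovTypeN (g : MetricField) (s : ℝ) (x : Fin 4 → ℝ) : Prop :=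
  (∃ a b c d, weylDual g s a b c d x ≠ 0) ∧
    ∀ a b c d, ∑ e, ∑ f, ∑ e', ∑ f',
      weylDual g s a b e f x * (g x)⁻¹ e e' * (g x)⁻¹ f f' * weylDual g s e' f' c d x = 0

/-- The metric is of algebraic type `N × N'` at `x`: both the self-dual and the anti-self-dual part
of its Weyl tensor are of Petrov type N. -/
def HasTypeNN (g : MetricField) (x : Fin 4 → ℝ) : Prop :=
  HasPetrovTypeN g 1 x ∧ HasPetrovTypeN g (-1) x

/-! ### Second order ODEs `y'' = Q(x, y, y')`; the coordinates on `J¹` are `(x, y, p)` -/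

/-- The total derivative `D = ∂_x + p ∂_y + Q ∂_p`. -/
def totalD (Q f : (Fin 3 → ℝ) → ℝ) (z : Fin 3 → ℝ) : ℝ :=
  pd 0 f z + z 2 * pd 1 f z + Q z * pd 2 f z

/-- The relative invariant
`w₁ = D²Q_pp - 4 DQ_py - Q_p DQ_pp + 4 Q_p Q_py - 3 Q_pp Q_y + 6 Q_yy`. -/
def w1 (Q : (Fin 3 → ℝ) → ℝ) (z : Fin 3 → ℝ) : ℝ :=
  totalD Q (totalD Q (pd 2 (pd 2 Q))) z - 4 * totalD Q (pd 1 (pd 2 Q)) z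
    - totalD Q (pd 2 (pd 2 Q)) z * pd 2 Q z + 4 * pd 2 Q z * pd 1 (pd 2 Q) z
    - 3 * pd 2 (pd 2 Q) z * pd 1 Q z + 6 * pd 1 (pd 1 Q) z

/-- The relative invariant `w₂ = Q_pppp`. -/
def w2 (Q : (Fin 3 → ℝ) → ℝ) (z : Fin 3 → ℝ) : ℝ :=
  pd 2 (pd 2 (pd 2 (pd 2 Q))) z

/-- The right-hand side `Q(x, y, p) = h(p)` of the equation `y'' = h(y')`. -/
def autonomousRHS (h : ℝ → ℝ) : (Fin 3 → ℝ) → ℝ := fun z => h (z 2)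

/-- The symmetric product `α β = (1/2) (α ⊗ β + β ⊗ α)` of two covectors. -/
def symProd (α β : Fin 4 → ℝ) : Matrix (Fin 4) (Fin 4) ℝ :=
  fun a b => (1 / 2) * (α a * β b + α b * β a)

/-- The Fefferman metric of `y'' = Q(x, y, y')`, with the real constant `i` and the scale `ρ`, in
the coordinates `(x, y, p, φ)`:
`2ρ² [(dp - Q dx) dx - (dy - p dx) ((2/3) i dφ + (2/3) Q_p dx + (1/6) Q_pp (dy - p dx))]`. -/
def feffermanMetric (i : ℝ) (Q : (Fin 3 → ℝ) → ℝ) (ρ : (Fin 4 → ℝ) → ℝ) : MetricField := fun x =>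
  let z : Fin 3 → ℝ := ![x 0, x 1, x 2]
  let dx : Fin 4 → ℝ := coordForm 0
  let dy : Fin 4 → ℝ := coordForm 1
  let dp : Fin 4 → ℝ := coordForm 2
  let dφ : Fin 4 → ℝ := coordForm 3
  (2 * (ρ x) ^ 2) •
    (symProd (dp - Q z • dx) dx
      - symProd (dy - x 2 • dx)
          ((2 / 3 * i) • dφ + (2 / 3 * pd 2 Q z) • dx
            + (1 / 6 * pd 2 (pd 2 Q) z) • (dy - x 2 • dx)))

/-- The points `(x, y, p, φ)` with `p ∈ I`. -/
def overSet (I : Set ℝ) : Set (Fin 4 → ℝ) := {x | x 2 ∈ I}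

/-- The real forms `(λ, μ, μ̄) = (-i (dy - p dx), dp - Q dx, dx)` on `J¹` that represent the
equation `y'' = Q(x, y, y')`. -/
def odeForms (i : ℝ) (Q : (Fin 3 → ℝ) → ℝ) : Fin 3 → (Fin 3 → ℝ) → (Fin 3 → ℝ) :=
  ![fun z => (-i) • (coordForm 1 - z 2 • coordForm 0),
    fun z => coordForm 2 - Q z • coordForm 0,
    fun _ => coordForm 0]

/-- Pull-back of a one-form on `ℝ³`. -/
def pullback (Φ : (Fin 3 → ℝ) → (Fin 3 → ℝ)) (θ : (Fin 3 → ℝ) → (Fin 3 → ℝ)) :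
    (Fin 3 → ℝ) → (Fin 3 → ℝ) :=
  fun z j => ∑ k, θ (Φ z) k * pd j Φ z k

/-- Equivalence of two triples `(λ, μ, μ̄)` on `N` and `(λ', μ', μ̄')` on `N'`: a diffeomorphism
`Φ : N → N'` such that `Φ^*λ' = a λ`, `Φ^*μ' = b μ + c λ`, `Φ^*μ̄' = b' μ̄ + c' λ`, with smooth
real functions `a, b, b', c, c'` and with `a, b, b'` nowhere zero. -/
def PointEquivalent (θ : Fin 3 → (Fin 3 → ℝ) → (Fin 3 → ℝ)) (N : Set (Fin 3 → ℝ))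
    (θ' : Fin 3 → (Fin 3 → ℝ) → (Fin 3 → ℝ)) (N' : Set (Fin 3 → ℝ)) : Prop :=
  ∃ Φ Ψ : (Fin 3 → ℝ) → (Fin 3 → ℝ),
    ContDiffOn ℝ ∞ Φ N ∧ ContDiffOn ℝ ∞ Ψ N' ∧ Set.MapsTo Φ N N' ∧ Set.MapsTo Ψ N' N ∧
    Set.InvOn Ψ Φ N N' ∧
    ∃ a b b' c c' : (Fin 3 → ℝ) → ℝ,
      ContDiffOn ℝ ∞ a N ∧ ContDiffOn ℝ ∞ b N ∧ ContDiffOn ℝ ∞ b' N ∧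
      ContDiffOn ℝ ∞ c N ∧ ContDiffOn ℝ ∞ c' N ∧
      ∀ z ∈ N, a z ≠ 0 ∧ b z ≠ 0 ∧ b' z ≠ 0 ∧
        pullback Φ (θ' 0) z = a z • θ 0 z ∧
        pullback Φ (θ' 1) z = b z • θ 1 z + c z • θ 0 z ∧
        pullback Φ (θ' 2) z = b' z • θ 2 z + c' z • θ 0 z

/-! ### CR structures `λ = du + f(y) dx`, `μ = dx + i dy` in the coordinates `(u, x, y)` -/

/-- The real form `λ = du + f(y) dx`. -/
def crLambda (f : ℝ → ℝ) : (Fin 3 → ℝ) → (Fin 3 → ℝ) :=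
  fun z => coordForm 0 + f (z 2) • coordForm 1

/-- The complex form `μ = dx + i dy` with the imaginary unit `i`. -/
def crMu : (Fin 3 → ℝ) → (Fin 3 → ℂ) :=
  fun _ j => (coordForm 1 j : ℂ) + Complex.I * (coordForm 2 j : ℂ)

/-- The realification of the triple `(λ, μ, μ̄)`: the symbol `i` is now a real constant. -/
def realifiedForms (i : ℝ) (f : ℝ → ℝ) : Fin 3 → (Fin 3 → ℝ) → (Fin 3 → ℝ) :=
  ![crLambda f,
    fun _ => coordForm 1 + i • coordForm 2,
    fun _ => coordForm 1 - i • coordForm 2]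

/-- The Lie derivative `(L_X θ)_j = X^k ∂_k θ_j + θ_k ∂_j X^k` of a real or complex one-form. -/
def lieForm {F : Type*} [NormedAddCommGroup F] [NormedSpace ℝ F]
    (X : (Fin 3 → ℝ) → (Fin 3 → ℝ)) (θ : (Fin 3 → ℝ) → (Fin 3 → F)) (z : Fin 3 → ℝ) (j : Fin 3) :
    F :=
  ∑ k, (X z k • pd k θ z j + pd j X z k • θ z k)

/-- `X` is an infinitesimal symmetry on `N` of the CR structure given by `(λ, μ)` up to
`λ ↦ a λ`, `μ ↦ b μ + c λ`. -/
def IsCRSymmetryOn (X : (Fin 3 → ℝ) → (Fin 3 → ℝ)) (lam : (Fin 3 → ℝ) → (Fin 3 → ℝ))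
    (mu : (Fin 3 → ℝ) → (Fin 3 → ℂ)) (N : Set (Fin 3 → ℝ)) : Prop :=
  ContDiffOn ℝ ∞ X N ∧
  ∀ z ∈ N, ∃ (α : ℝ) (β γ : ℂ), ∀ j,
    lieForm X lam z j = α * lam z j ∧
    lieForm X mu z j = β * mu z j + γ * (lam z j : ℂ)

/-- The CR structure has three infinitesimal symmetries, linearly independent at each point, which
span a Lie algebra of Bianchi type `VI_k`, `k = -a² < 0`:
`[e₁, e₂] = -a e₂ - e₃`, `[e₃, e₁] = e₂ + a e₃`, `[e₂, e₃] = 0`. -/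
def HasBianchiVISymmetry (k : ℝ) (lam : (Fin 3 → ℝ) → (Fin 3 → ℝ))
    (mu : (Fin 3 → ℝ) → (Fin 3 → ℂ)) (N : Set (Fin 3 → ℝ)) : Prop :=
  ∃ (a : ℝ) (e₁ e₂ e₃ : (Fin 3 → ℝ) → (Fin 3 → ℝ)),
    a ≠ 0 ∧ k = -a ^ 2 ∧
    IsCRSymmetryOn e₁ lam mu N ∧ IsCRSymmetryOn e₂ lam mu N ∧ IsCRSymmetryOn e₃ lam mu N ∧
    ∀ z ∈ N, LinearIndependent ℝ ![e₁ z, e₂ z, e₃ z] ∧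
      VectorField.lieBracket ℝ e₁ e₂ z = -(a • e₂ z) - e₃ z ∧
      VectorField.lieBracket ℝ e₃ e₁ z = e₂ z + a • e₃ z ∧
      VectorField.lieBracket ℝ e₂ e₃ z = 0

/-- The function `f(y) = y^{-3}`. -/
def crProfile (y : ℝ) : ℝ := y ^ (-3 : ℤ)

/-- `h(p) = (n / (2i)) (-p)^{1 - 1/n}` for `n = -3`, with the real cube root:
`(-p)^{4/3} = |p|^{4/3}`. -/
def exampleRHS (i : ℝ) (p : ℝ) : ℝ := -3 / (2 * i) * |p| ^ (4 / 3 : ℝ)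

/-- In the coordinates `(X, Y, P, Φ)`, with `P^{2/3} = |P|^{2/3}`, the metric
`2 (i P^{2/3} dP + (3/2) P² dX) dX
  - 2 (dY - P dX) ((2/3) i² P^{2/3} dΦ - (1/9) dY - (11/9) P dX)`. -/
def exampleMetric (i : ℝ) : MetricField := fun x =>
  let P : ℝ := x 2
  let dX : Fin 4 → ℝ := coordForm 0
  let dY : Fin 4 → ℝ := coordForm 1
  let dP : Fin 4 → ℝ := coordForm 2
  let dΦ : Fin 4 → ℝ := coordForm 3
  (2 : ℝ) • symProd ((i * |P| ^ (2 / 3 : ℝ)) • dP + (3 / 2 * P ^ 2) • dX) dX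
    - (2 : ℝ) • symProd (dY - P • dX)
        ((2 / 3 * i ^ 2 * |P| ^ (2 / 3 : ℝ)) • dΦ - (1 / 9 : ℝ) • dY - (11 / 9 * P) • dX)

end FeffermanODE

end

open scoped ContDiff
open FeffermanODE

noncomputable section

namespace FeffermanODE
/-! ### Gradients -/

/-! All curvature is made explicit. For $Q=h(p)$ the metric with $\rho=1$ depends only on $p$ and
the jet of $h$. Hence for any multiple $\Omega g$, with $\Omega$ nowhere zero and of either sign
(`IsMultiple`), each curvature quantity is a polynomial in $p$, the jet, $i^{\pm1}$,
$u=d\Omega/(2\Omega)$ and $\partial u$, times a power of $\Omega$. The Christoffel symbols use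
$h,\dots,h'''$, the Weyl tensor $h''''$, the Bach tensor derivatives up to order six.

With $F=dx\wedge dy$ and $G=(dy-p\,dx)\wedge(dp-h\,dx)$, the Weyl tensor of $\Omega g$ is
$\Omega\,\frac{h''''}6(h^2F\otimes F+G\otimes G)$ (`IsMultiple.weyl_eq`). $F$ and $G$ are null and
lie in opposite eigenspaces of the Hodge star, so the type is $N\times N'$ exactly where
$hh''''\ne0$. The Bach tensor is $\frac1{3\Omega}(h^2h'''')''(dy-p\,dx)^2$ (`IsMultiple.bach_eq`),
so it vanishes when $h^2h''''$ is affine in $p$.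

An Einstein metric in the class is a nowhere zero $\sigma$ for which $\nabla^2\sigma+\sigma P$ is a
multiple of $g$, $P$ being the Schouten tensor. Where $hh''''\ne0$, prolonging this overdetermined
system gives $h'''=0$, a contradiction (`IsMultiple.false_of_hessian_eq`); where $h$ vanishes on an
open set, so does $h''''$. Conversely $h''''=0$ makes $h$ locally a cubic, and $\sigma=e^{\alpha
x+\beta y-i\phi/3}$ with suitable $\alpha,\beta$ gives a Ricci-flat metric (`exists_scale`,
`exists_isEinsteinOn`).

If $h^2h''''=ap+b$ is not identically zero then $h$ has no zeros, hence gains the derivatives needed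
for the Bach tensor (`contDiffOn_six_of_sq_mul_eq`). The example is the case $a=0$, and its
equivalence with the CR structure is an explicit change of coordinates. The CR symmetries are two
translations and a dilation. -/

/-- `f` is differentiable at `x` with partial derivatives `G k`. -/
structure HasGrad {n : ℕ} (f : (Fin n → ℝ) → ℝ) (G : Fin n → ℝ) (x : Fin n → ℝ) : Prop where
  diff : DifferentiableAt ℝ f x
  pd_eq : ∀ k, pd k f x = G k

namespace HasGrad

variable {n : ℕ} {f g : (Fin n → ℝ) → ℝ} {F G : Fin n → ℝ} {x : Fin n → ℝ}

theorem congr_grad (hf : HasGrad f F x) (h : ∀ k, F k = G k) : HasGrad f G x :=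
  ⟨hf.diff, fun k => (hf.pd_eq k).trans (h k)⟩

theorem congr_of_eventuallyEq (hf : HasGrad f F x) (h : g =ᶠ[nhds x] f) : HasGrad g F x :=
  ⟨hf.diff.congr_of_eventuallyEq h, fun k => by
    rw [← hf.pd_eq k, pd, pd, h.fderiv_eq]⟩

theorem const (c : ℝ) : HasGrad (fun _ => c) (fun _ => 0) x :=
  ⟨differentiableAt_const c, fun k => by simp [pd]⟩

theorem add (hf : HasGrad f F x) (hg : HasGrad g G x) :
    HasGrad (fun z => f z + g z) (fun k => F k + G k) x :=
  ⟨hf.diff.fun_add hg.diff, fun k => by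
    rw [← hf.pd_eq, ← hg.pd_eq, pd, fderiv_fun_add hf.diff hg.diff]; rfl⟩

theorem sub (hf : HasGrad f F x) (hg : HasGrad g G x) :
    HasGrad (fun z => f z - g z) (fun k => F k - G k) x :=
  ⟨hf.diff.fun_sub hg.diff, fun k => by
    rw [← hf.pd_eq, ← hg.pd_eq, pd, fderiv_fun_sub hf.diff hg.diff]; rfl⟩

theorem mul (hf : HasGrad f F x) (hg : HasGrad g G x) :
    HasGrad (fun z => f z * g z) (fun k => F k * g x + f x * G k) x :=
  ⟨hf.diff.fun_mul hg.diff, fun k => by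
    rw [← hf.pd_eq, ← hg.pd_eq, pd, fderiv_fun_mul hf.diff hg.diff]
    simp only [pd, FunLike.coe_add, FunLike.coe_smul, Pi.add_apply, Pi.smul_apply, smul_eq_mul]
    ring⟩

theorem neg (hf : HasGrad f F x) : HasGrad (fun z => -f z) (fun k => -F k) x :=
  (((const 0).sub hf).congr_grad fun k => by ring).congr_of_eventuallyEq
    (Filter.Eventually.of_forall fun z => by simp)

theorem div_const (hf : HasGrad f F x) (c : ℝ) : HasGrad (fun z => f z / c) (fun k => F k / c) x :=
  ((hf.mul (const c⁻¹)).congr_grad fun k => by ring).congr_of_eventuallyEq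
    (Filter.Eventually.of_forall fun z => by simp [div_eq_mul_inv])

theorem const_mul (c : ℝ) (hf : HasGrad f F x) :
    HasGrad (fun z => c * f z) (fun k => c * F k) x :=
  ((const c).mul hf).congr_grad fun k => by ring

theorem sum {ι : Type*} (s : Finset ι) {f : ι → (Fin n → ℝ) → ℝ} {F : ι → Fin n → ℝ}
    (h : ∀ m ∈ s, HasGrad (f m) (F m) x) :
    HasGrad (fun z => ∑ m ∈ s, f m z) (fun k => ∑ m ∈ s, F m k) x :=
  ⟨DifferentiableAt.fun_sum fun m hm => (h m hm).diff, fun k => by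
    rw [pd, fderiv_fun_sum fun m hm => (h m hm).diff, sum_apply]
    exact Finset.sum_congr rfl fun m hm => (h m hm).pd_eq k⟩

/-- The gradient of a function of one coordinate. -/
theorem comp_coord {φ : ℝ → ℝ} {φ' : ℝ} {m : Fin n} (hφ : HasDerivAt φ φ' (x m)) :
    HasGrad (fun z => φ (z m)) (fun k => if k = m then φ' else 0) x := by
  have h1 : HasFDerivAt (fun z : Fin n → ℝ => z m)
      (ContinuousLinearMap.proj (R := ℝ) (φ := fun _ => ℝ) m) x := hasFDerivAt_apply m x
  have h2 := hφ.comp_hasFDerivAt x h1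
  refine ⟨h2.differentiableAt, fun k => ?_⟩
  have h3 : fderiv ℝ (fun z : Fin n → ℝ => φ (z m)) x = _ := h2.fderiv
  rw [pd, h3]
  by_cases hk : k = m
  · subst hk; simp
  · simp [hk, Ne.symm hk]

theorem unique (hf : HasGrad f F x) (hf' : HasGrad f G x) (k : Fin n) : F k = G k := by
  rw [← hf.pd_eq, hf'.pd_eq]

end HasGrad

theorem forall_fin_four {P : Fin 4 → Prop} (h0 : P 0) (h1 : P 1) (h2 : P 2) (h3 : P 3) (a : Fin 4) :
    P a := by
  fin_cases a
  exacts [h0, h1, h2, h3]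

theorem pd_comm {n : ℕ} {f : (Fin n → ℝ) → ℝ} {x : Fin n → ℝ} (hf : ContDiffAt ℝ 2 f x)
    (a b : Fin n) : pd a (pd b f) x = pd b (pd a f) x := by
  have hd : DifferentiableAt ℝ (fderiv ℝ f) x :=
    (hf.fderiv_right (m := 1) (by norm_num)).differentiableAt (by norm_num)
  have hs := hf.isSymmSndFDerivAt (by simp)
  have key : ∀ c d : Fin n, pd c (pd d f) x
      = fderiv ℝ (fderiv ℝ f) x (Pi.single c 1) (Pi.single d 1) := by
    intro c d
    have : pd d f = fun z => fderiv ℝ f z (Pi.single d 1) := rfl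
    rw [this, pd, fderiv_clm_apply hd (differentiableAt_const _)]
    simp
  rw [key, key, hs.eq]

theorem contDiffOn_pd {n : ℕ} {f : (Fin n → ℝ) → ℝ} {U : Set (Fin n → ℝ)} (hU : IsOpen U)
    (hf : ContDiffOn ℝ ∞ f U) (k : Fin n) : ContDiffOn ℝ ∞ (pd k f) U :=
  (hf.fderiv_of_isOpen hU (m := ∞) (by simp)).clm_apply contDiffOn_const

/-- The tuple with the entries `a, b, c, d`. -/
def vec4 {α : Type*} (a b c d : α) (k : Fin 4) : α :=
  if k = 0 then a else if k = 1 then b else if k = 2 then c else d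

@[simp] theorem vec4_zero {α : Type*} (a b c d : α) : vec4 a b c d 0 = a := rfl

@[simp] theorem vec4_one {α : Type*} (a b c d : α) : vec4 a b c d 1 = b := rfl

@[simp] theorem vec4_two {α : Type*} (a b c d : α) : vec4 a b c d 2 = c := rfl

@[simp] theorem vec4_three {α : Type*} (a b c d : α) : vec4 a b c d 3 = d := rfl

/-! ### The Fefferman metric with `ρ = 1` as a function of `p` and of the jet of `h` -/

/-- The jet `(h, h', h'', …)` of `h` at `p`. -/
def jet (h : ℝ → ℝ) (p : ℝ) (n : ℕ) : ℝ := iteratedDeriv n h p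

/-- The matrix of the metric. -/
def fefMatrix (i p : ℝ) (j : ℕ → ℝ) : Fin 4 → Fin 4 → ℝ :=
  (vec4 (vec4 (-2 * j 0 + 4 / 3 * j 1 * p - 1 / 3 * j 2 * p ^ 2)
      (-2 / 3 * j 1 + 1 / 3 * j 2 * p) 1 (2 / 3 * i * p))
    (vec4 (-2 / 3 * j 1 + 1 / 3 * j 2 * p) (-1 / 3 * j 2) 0 (-2 / 3 * i))
    (vec4 1 0 0 0)
    (vec4 (2 / 3 * i * p) (-2 / 3 * i) 0 0))

/-- The derivative of `fefMatrix` along the jet. -/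
def fefMatrixDeriv (i p : ℝ) (j : ℕ → ℝ) : Fin 4 → Fin 4 → ℝ :=
  (vec4 (vec4 (-2 / 3 * j 1 + 2 / 3 * j 2 * p - 1 / 3 * j 3 * p ^ 2)
      (-1 / 3 * j 2 + 1 / 3 * j 3 * p) 0 (2 / 3 * i))
    (vec4 (-1 / 3 * j 2 + 1 / 3 * j 3 * p) (-1 / 3 * j 3) 0 0)
    (vec4 0 0 0 0)
    (vec4 (2 / 3 * i) 0 0 0))

/-- The inverse of the matrix of the metric. -/
def fefInverse (i p : ℝ) (j : ℕ → ℝ) : Fin 4 → Fin 4 → ℝ :=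
  (vec4 (vec4 0 0 1 0)
    (vec4 0 0 p (-3 / 2 * i⁻¹))
    (vec4 1 p (2 * j 0) (-j 1 * i⁻¹))
    (vec4 0 (-3 / 2 * i⁻¹) (-j 1 * i⁻¹) (3 / 4 * j 2 * i⁻¹ ^ 2)))

/-- The derivative of `fefInverse` along the jet. -/
def fefInverseDeriv (i _p : ℝ) (j : ℕ → ℝ) : Fin 4 → Fin 4 → ℝ :=
  (vec4 (vec4 0 0 0 0)
    (vec4 0 0 1 0)
    (vec4 0 1 (2 * j 1) (-j 2 * i⁻¹))
    (vec4 0 0 (-j 2 * i⁻¹) (3 / 4 * j 3 * i⁻¹ ^ 2)))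

/-- The Christoffel symbols. -/
def fefChristoffel (i p : ℝ) (j : ℕ → ℝ) (a b c : Fin 4) : ℝ :=
  vec4
    (vec4 (vec4 (1 / 3 * j 1 - 1 / 3 * j 2 * p + 1 / 6 * j 3 * p ^ 2)
      (1 / 6 * j 2 - 1 / 6 * j 3 * p) 0 (-1 / 3 * i))
    (vec4 (1 / 6 * j 2 - 1 / 6 * j 3 * p) (1 / 6 * j 3) 0 0)
    (vec4 0 0 0 0)
    (vec4 (-1 / 3 * i) 0 0 0))
    (vec4 (vec4 (1 / 3 * j 1 * p - 1 / 3 * j 2 * p ^ 2 + 1 / 6 * j 3 * p ^ 3)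
      (1 / 6 * j 2 * p - 1 / 6 * j 3 * p ^ 2) (-1 / 2) (-1 / 3 * i * p))
    (vec4 (1 / 6 * j 2 * p - 1 / 6 * j 3 * p ^ 2) (1 / 6 * j 3 * p) 0 0)
    (vec4 (-1 / 2) 0 0 0)
    (vec4 (-1 / 3 * i * p) 0 0 0))
    (vec4 (vec4 (2 / 3 * j 0 * j 1 - 2 / 3 * j 0 * j 2 * p + 1 / 3 * j 0 * j 3 * p ^ 2)
      (1 / 3 * j 0 * j 2 - 1 / 3 * j 0 * j 3 * p) (-2 / 3 * j 1 + 1 / 6 * j 2 * p)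
        (-2 / 3 * j 0 * i))
    (vec4 (1 / 3 * j 0 * j 2 - 1 / 3 * j 0 * j 3 * p) (1 / 3 * j 0 * j 3) (-1 / 6 * j 2) 0)
    (vec4 (-2 / 3 * j 1 + 1 / 6 * j 2 * p) (-1 / 6 * j 2) 0 (1 / 3 * i))
    (vec4 (-2 / 3 * j 0 * i) 0 (1 / 3 * i) 0))
    (vec4 (vec4
      (1 / 3 * j 1 * j 2 * i⁻¹ * p - 1 / 6 * j 1 * j 3 * i⁻¹ * p ^ 2 - 1 / 3 * j 1 ^ 2 * i⁻¹)
        (-1 / 6 * j 1 * j 2 * i⁻¹ + 1 / 6 * j 1 * j 3 * i⁻¹ * p)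
          (1 / 2 * j 2 * i⁻¹ - 1 / 4 * j 3 * i⁻¹ * p) (1 / 3 * j 1))
    (vec4 (-1 / 6 * j 1 * j 2 * i⁻¹ + 1 / 6 * j 1 * j 3 * i⁻¹ * p) (-1 / 6 * j 1 * j 3 * i⁻¹)
      (1 / 4 * j 3 * i⁻¹) 0)
    (vec4 (1 / 2 * j 2 * i⁻¹ - 1 / 4 * j 3 * i⁻¹ * p) (1 / 4 * j 3 * i⁻¹) 0 0)
    (vec4 (1 / 3 * j 1) 0 0 0)) a b c

/-- The derivative of `fefChristoffel` along the jet. -/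
def fefChristoffelDeriv (i p : ℝ) (j : ℕ → ℝ) (a b c : Fin 4) : ℝ :=
  vec4
    (vec4 (vec4 (1 / 6 * j 4 * p ^ 2) (-1 / 6 * j 4 * p) 0 0)
    (vec4 (-1 / 6 * j 4 * p) (1 / 6 * j 4) 0 0)
    (vec4 0 0 0 0)
    (vec4 0 0 0 0))
    (vec4 (vec4 (1 / 3 * j 1 - 1 / 3 * j 2 * p + 1 / 6 * j 3 * p ^ 2 + 1 / 6 * j 4 * p ^ 3)
      (1 / 6 * j 2 - 1 / 6 * j 3 * p - 1 / 6 * j 4 * p ^ 2) 0 (-1 / 3 * i))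
    (vec4 (1 / 6 * j 2 - 1 / 6 * j 3 * p - 1 / 6 * j 4 * p ^ 2)
      (1 / 6 * j 3 + 1 / 6 * j 4 * p) 0 0)
    (vec4 0 0 0 0)
    (vec4 (-1 / 3 * i) 0 0 0))
    (vec4 (vec4
      (1 / 3 * j 0 * j 4 * p ^ 2 - 2 / 3 * j 1 * j 2 * p + 1 / 3 * j 1 * j 3 * p ^ 2
        + 2 / 3 * j 1 ^ 2) (-1 / 3 * j 0 * j 4 * p + 1 / 3 * j 1 * j 2 - 1 / 3 * j 1 * j 3 * p)
          (-1 / 2 * j 2 + 1 / 6 * j 3 * p) (-2 / 3 * j 1 * i))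
    (vec4 (-1 / 3 * j 0 * j 4 * p + 1 / 3 * j 1 * j 2 - 1 / 3 * j 1 * j 3 * p)
      (1 / 3 * j 0 * j 4 + 1 / 3 * j 1 * j 3) (-1 / 6 * j 3) 0)
    (vec4 (-1 / 2 * j 2 + 1 / 6 * j 3 * p) (-1 / 6 * j 3) 0 0)
    (vec4 (-2 / 3 * j 1 * i) 0 0 0))
    (vec4 (vec4
      (-1 / 3 * j 1 * j 2 * i⁻¹ - 1 / 6 * j 1 * j 4 * i⁻¹ * p ^ 2
        - 1 / 6 * j 2 * j 3 * i⁻¹ * p ^ 2 + 1 / 3 * j 2 ^ 2 * i⁻¹ * p)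
          (1 / 6 * j 1 * j 4 * i⁻¹ * p + 1 / 6 * j 2 * j 3 * i⁻¹ * p - 1 / 6 * j 2 ^ 2 * i⁻¹)
            (1 / 4 * j 3 * i⁻¹ - 1 / 4 * j 4 * i⁻¹ * p) (1 / 3 * j 2))
    (vec4 (1 / 6 * j 1 * j 4 * i⁻¹ * p + 1 / 6 * j 2 * j 3 * i⁻¹ * p - 1 / 6 * j 2 ^ 2 * i⁻¹)
      (-1 / 6 * j 1 * j 4 * i⁻¹ - 1 / 6 * j 2 * j 3 * i⁻¹) (1 / 4 * j 4 * i⁻¹) 0)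
    (vec4 (1 / 4 * j 3 * i⁻¹ - 1 / 4 * j 4 * i⁻¹ * p) (1 / 4 * j 4 * i⁻¹) 0 0)
    (vec4 (1 / 3 * j 2) 0 0 0)) a b c

/-- The Schouten tensor. -/
def fefSchouten (i p : ℝ) (j : ℕ → ℝ) : Fin 4 → Fin 4 → ℝ :=
  (vec4 (vec4
      (1 / 4 * j 0 * j 2 - 1 / 3 * j 0 * j 3 * p + 1 / 6 * j 0 * j 4 * p ^ 2
        + 1 / 18 * j 1 * j 2 * p + 1 / 6 * j 1 * j 3 * p ^ 2 - 1 / 9 * j 1 ^ 2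
          - 5 / 72 * j 2 ^ 2 * p ^ 2)
            (1 / 6 * j 0 * j 3 - 1 / 6 * j 0 * j 4 * p - 1 / 36 * j 1 * j 2
              - 1 / 6 * j 1 * j 3 * p + 5 / 72 * j 2 ^ 2 * p) (-1 / 8 * j 2 + 1 / 12 * j 3 * p)
                (-1 / 9 * j 1 * i + 1 / 36 * j 2 * i * p))
    (vec4
      (1 / 6 * j 0 * j 3 - 1 / 6 * j 0 * j 4 * p - 1 / 36 * j 1 * j 2 - 1 / 6 * j 1 * j 3 * p
        + 5 / 72 * j 2 ^ 2 * p) (1 / 6 * j 0 * j 4 + 1 / 6 * j 1 * j 3 - 5 / 72 * j 2 ^ 2)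
          (-1 / 12 * j 3) (-1 / 36 * j 2 * i))
    (vec4 (-1 / 8 * j 2 + 1 / 12 * j 3 * p) (-1 / 12 * j 3) 0 0)
    (vec4 (-1 / 9 * j 1 * i + 1 / 36 * j 2 * i * p) (-1 / 36 * j 2 * i) 0 (-1 / 9 * i ^ 2)))

/-! ### Algebra of the curvature -/

/-- The contravariant components of the covector `u`. -/
def fefRaise (i p : ℝ) (j : ℕ → ℝ) (u : Fin 4 → ℝ) (a : Fin 4) : ℝ :=
  ∑ e, fefInverse i p j a e * u e

/-- The Schouten tensor of `Ω g`. -/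
def confSchouten (i p : ℝ) (j : ℕ → ℝ) (u : Fin 4 → ℝ) (w : Fin 4 → Fin 4 → ℝ) (b d : Fin 4) : ℝ :=
  fefSchouten i p j b d - w b d + (∑ c, fefChristoffel i p j c b d * u c) + u b * u d
    - (1 / 2) * (∑ e, u e * fefRaise i p j u e) * fefMatrix i p j b d

/-- The two-form `dx ∧ dy`. -/
def fefF : Fin 4 → Fin 4 → ℝ :=
  vec4 (vec4 0 1 0 0) (vec4 (-1) 0 0 0) (vec4 0 0 0 0) (vec4 0 0 0 0)

/-- The two-form `(dy - p dx) ∧ (dp - h dx)`. -/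
def fefG (p : ℝ) (j : ℕ → ℝ) : Fin 4 → Fin 4 → ℝ :=
  vec4 (vec4 0 (j 0) (-p) 0) (vec4 (-j 0) 0 1 0) (vec4 p (-1) 0 0) (vec4 0 0 0 0)

/-- The Weyl tensor. -/
def fefWeyl (p : ℝ) (j : ℕ → ℝ) (a b c d : Fin 4) : ℝ :=
  j 4 / 6 * (j 0 ^ 2 * (fefF a b * fefF c d) + fefG p j a b * fefG p j c d)

theorem sum_fefMatrix_mul_fefInverse {i : ℝ} (hi : i ≠ 0) (p : ℝ) (j : ℕ → ℝ) (a b : Fin 4) :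
    ∑ e, fefMatrix i p j a e * fefInverse i p j e b = if a = b then 1 else 0 := by
  rw [Fin.sum_univ_four]
  revert a b
  refine forall_fin_four ?_ ?_ ?_ ?_ <;> refine forall_fin_four ?_ ?_ ?_ ?_ <;>
    simp [fefMatrix, fefInverse] <;> field_simp <;> ring

theorem sum_fefInverse_mul_fefMatrix {i : ℝ} (hi : i ≠ 0) (p : ℝ) (j : ℕ → ℝ) (a b : Fin 4) :
    ∑ e, fefInverse i p j a e * fefMatrix i p j e b = if a = b then 1 else 0 := by
  rw [Fin.sum_univ_four]
  revert a b
  refine forall_fin_four ?_ ?_ ?_ ?_ <;> refine forall_fin_four ?_ ?_ ?_ ?_ <;>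
    simp [fefMatrix, fefInverse] <;> field_simp <;> ring

theorem fefMatrix_symm (i p : ℝ) (j : ℕ → ℝ) (a b : Fin 4) :
    fefMatrix i p j a b = fefMatrix i p j b a := by
  revert a b
  refine forall_fin_four ?_ ?_ ?_ ?_ <;> refine forall_fin_four ?_ ?_ ?_ ?_ <;> rfl

theorem fefInverse_symm (i p : ℝ) (j : ℕ → ℝ) (a b : Fin 4) :
    fefInverse i p j a b = fefInverse i p j b a := by
  revert a b
  refine forall_fin_four ?_ ?_ ?_ ?_ <;> refine forall_fin_four ?_ ?_ ?_ ?_ <;> rfl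

theorem fefSchouten_symm (i p : ℝ) (j : ℕ → ℝ) (a b : Fin 4) :
    fefSchouten i p j a b = fefSchouten i p j b a := by
  revert a b
  refine forall_fin_four ?_ ?_ ?_ ?_ <;> refine forall_fin_four ?_ ?_ ?_ ?_ <;> rfl

theorem fefChristoffel_symm (i p : ℝ) (j : ℕ → ℝ) (a b c : Fin 4) :
    fefChristoffel i p j a b c = fefChristoffel i p j a c b := by
  revert a b c
  refine forall_fin_four ?_ ?_ ?_ ?_ <;> refine forall_fin_four ?_ ?_ ?_ ?_ <;>
    refine forall_fin_four ?_ ?_ ?_ ?_ <;> rfl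

-- The entries depend on $p$ alone, so $\partial_c$ is the derivative along the jet for $c=2$ and
-- zero otherwise. This is the meaning of every `if c = 2` below.
set_option maxHeartbeats 1000000 in
theorem fefChristoffel_eq {i : ℝ} (hi : i ≠ 0) (p : ℝ) (j : ℕ → ℝ) (a b c : Fin 4) :
    (1 / 2) * ∑ d, fefInverse i p j a d *
      ((if b = 2 then fefMatrixDeriv i p j d c else 0)
        + (if c = 2 then fefMatrixDeriv i p j d b else 0)
        - (if d = 2 then fefMatrixDeriv i p j b c else 0)) = fefChristoffel i p j a b c := by
  revert a b c
  refine forall_fin_four ?_ ?_ ?_ ?_ <;> refine forall_fin_four ?_ ?_ ?_ ?_ <;>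
    refine forall_fin_four ?_ ?_ ?_ ?_ <;>
    simp only [fefMatrixDeriv, fefInverse, fefChristoffel, Fin.sum_univ_four, vec4_zero, vec4_one,
      vec4_two, vec4_three, Fin.reduceEq, ↓reduceIte, mul_zero, zero_mul, add_zero, zero_add,
      sub_zero, zero_sub, sub_self] <;> field_simp <;> ring

/-- The difference of the Christoffel symbols of `Ω g` and `g`, where `u = dΩ / (2Ω)` and `v` is the
vector which corresponds to `u`. -/
def confDiff (g : Fin 4 → Fin 4 → ℝ) (u v : Fin 4 → ℝ) (a b c : Fin 4) : ℝ :=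
  (if a = b then u c else 0) + (if a = c then u b else 0) - g b c * v a

/-- The conformal change of the Riemann tensor as pointwise algebra: derivatives enter only as
numbers. `hdg` says $\nabla g=0$, `hdv` is the derivative of $v^a=g^{ae}u_e$ that follows from
$\nabla g^{-1}=0$, and `w` stands for $\partial u$. Working with index sums avoids expanding the
components for arbitrary `u` and `w`. -/
theorem riemann_confDiff {g ginv : Fin 4 → Fin 4 → ℝ} {Γ : Fin 4 → Fin 4 → Fin 4 → ℝ}
    {dg : Fin 4 → Fin 4 → Fin 4 → ℝ} {dv : Fin 4 → Fin 4 → ℝ} {u v : Fin 4 → ℝ}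
    {w K : Fin 4 → Fin 4 → ℝ} (hg : ∀ a b, g a b = g b a) (hw : ∀ a b, w a b = w b a)
    (hΓ : ∀ a b c, Γ a b c = Γ a c b)
    (hdg : ∀ c a b, dg c a b = ∑ e, g a e * Γ e c b + ∑ e, g b e * Γ e c a)
    (hgi : ∀ a c, ∑ e, ginv a e * g e c = if a = c then 1 else 0)
    (hv : ∀ a, v a = ∑ e, ginv a e * u e)
    (hgv : ∀ c, ∑ e, g c e * v e = u c)
    (hdv : ∀ c a, dv c a = -∑ e, Γ a c e * v e + ∑ e, ginv a e * (w c e - ∑ m, Γ m c e * u m))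
    (hK : ∀ a b, K a b = -w a b + (∑ m, Γ m a b * u m) + u a * u b
      - (1 / 2) * (∑ e, u e * v e) * g a b) (a b c d : Fin 4) :
    ((if a = d then w c b else 0) + (if a = b then w c d else 0)
        - (dg c d b * v a + g d b * dv c a))
      - ((if a = c then w d b else 0) + (if a = b then w d c else 0)
        - (dg d c b * v a + g c b * dv d a))
      + ∑ e, ((Γ a c e + confDiff g u v a c e) * (Γ e d b + confDiff g u v e d b)
        - (Γ a d e + confDiff g u v a d e) * (Γ e c b + confDiff g u v e c b))
    = (∑ e, (Γ a c e * Γ e d b - Γ a d e * Γ e c b))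
      + (if a = c then K b d else 0) - (if a = d then K b c else 0)
      + g b d * (∑ e, ginv a e * K e c) - g b c * (∑ e, ginv a e * K e d) := by
  have h1 : ∀ c d, ∑ e, Γ a c e * confDiff g u v e d b
      = Γ a c d * u b + Γ a c b * u d - g d b * ∑ e, Γ a c e * v e := by
    intro c d
    simp only [confDiff, mul_sub, mul_add, Finset.sum_add_distrib, Finset.sum_sub_distrib,
      mul_ite, mul_zero, Finset.sum_ite_eq', Finset.mem_univ, if_true, Finset.mul_sum]
    refine congrArg _ (Finset.sum_congr rfl fun e _ => ?_)
    ring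
  have h2 : ∀ c d, ∑ e, confDiff g u v a c e * Γ e d b
      = (if a = c then ∑ e, Γ e d b * u e else 0) + u c * Γ a d b
        - v a * ∑ e, g c e * Γ e d b := by
    intro c d
    simp only [confDiff, sub_mul, add_mul, Finset.sum_add_distrib, Finset.sum_sub_distrib,
      ite_mul, zero_mul, Finset.sum_ite_eq, Finset.mem_univ, if_true, Finset.mul_sum]
    congr 1
    · congr 1
      split_ifs
      · exact Finset.sum_congr rfl fun e _ => mul_comm _ _
      · simp
    · exact Finset.sum_congr rfl fun e _ => by ring
  -- The terms quadratic in the difference tensor: $g_{ce}v^e=u_c$ removes the contractions with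
  -- $g$, and $u_ev^e$ is what remains for the last term of `K`.
  have h3 : ∀ c d, ∑ e, confDiff g u v a c e * confDiff g u v e d b
      = (if a = c then 2 * (u d * u b) - g d b * ∑ e, u e * v e else 0)
        + u c * ((if a = d then u b else 0) + (if a = b then u d else 0) - g d b * v a)
        - v a * (g c d * u b + g c b * u d - g d b * u c) := by
    intro c d
    have e1 : ∀ e, confDiff g u v a c e * confDiff g u v e d b
        = (if a = c then u e * confDiff g u v e d b else 0)
          + (if a = e then u c * confDiff g u v e d b else 0)
          - v a * (g c e * confDiff g u v e d b) := by
      intro e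
      rw [confDiff]
      split_ifs <;> ring
    have e2 : ∑ e, u e * confDiff g u v e d b = 2 * (u d * u b) - g d b * ∑ e, u e * v e := by
      simp only [confDiff, mul_sub, mul_add, Finset.sum_add_distrib, Finset.sum_sub_distrib,
        mul_ite, mul_zero, Finset.sum_ite_eq', Finset.mem_univ, if_true, Finset.mul_sum]
      rw [two_mul, mul_comm (u b)]
      refine congrArg _ (Finset.sum_congr rfl fun e _ => ?_)
      ring
    have e3 : ∑ e, g c e * confDiff g u v e d b = g c d * u b + g c b * u d - g d b * u c := by
      rw [← hgv c]
      simp only [confDiff, mul_sub, mul_add, Finset.sum_add_distrib, Finset.sum_sub_distrib,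
        mul_ite, mul_zero, Finset.sum_ite_eq', Finset.mem_univ, if_true, Finset.mul_sum]
      refine congrArg _ (Finset.sum_congr rfl fun e _ => ?_)
      ring
    rw [Finset.sum_congr rfl fun e _ => e1 e, Finset.sum_sub_distrib, Finset.sum_add_distrib,
      ← Finset.mul_sum, e3]
    congr 2
    · split_ifs
      · exact e2
      · simp
    · rw [Finset.sum_ite_eq]
      simp [confDiff]
  have h4 : ∀ c, ∑ e, ginv a e * K e c = -(∑ e, ginv a e * (w c e - ∑ m, Γ m c e * u m))
      + v a * u c - (1 / 2) * (∑ e, u e * v e) * (if a = c then 1 else 0) := by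
    intro c
    rw [← hgi a c, hv a, Finset.sum_mul, Finset.mul_sum, ← Finset.sum_neg_distrib,
      ← Finset.sum_add_distrib, ← Finset.sum_sub_distrib]
    refine Finset.sum_congr rfl fun e _ => ?_
    rw [hK, hw e c, Finset.sum_congr rfl fun m _ => by rw [hΓ m e c]]
    ring
  have h5 : ∑ e, ((Γ a c e + confDiff g u v a c e) * (Γ e d b + confDiff g u v e d b)
        - (Γ a d e + confDiff g u v a d e) * (Γ e c b + confDiff g u v e c b))
      = (∑ e, (Γ a c e * Γ e d b - Γ a d e * Γ e c b))
        + (∑ e, Γ a c e * confDiff g u v e d b) - (∑ e, Γ a d e * confDiff g u v e c b)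
        + (∑ e, confDiff g u v a c e * Γ e d b) - (∑ e, confDiff g u v a d e * Γ e c b)
        + (∑ e, confDiff g u v a c e * confDiff g u v e d b)
        - (∑ e, confDiff g u v a d e * confDiff g u v e c b) := by
    simp only [← Finset.sum_add_distrib, ← Finset.sum_sub_distrib]
    exact Finset.sum_congr rfl fun e _ => by ring
  have h6 : ∀ d, K b d = -w d b + (∑ m, Γ m d b * u m) + u b * u d
      - (1 / 2) * (∑ e, u e * v e) * g d b := by
    intro d
    rw [hK, hw b d, hg b d, Finset.sum_congr rfl fun m _ => by rw [hΓ m b d]]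
  have h7 : ∑ e, g b e * Γ e d c = ∑ e, g b e * Γ e c d :=
    Finset.sum_congr rfl fun e _ => by rw [hΓ e d c]
  rw [h5, h1, h1, h2, h2, h3, h3, h4, h4, hdg, hdg, hdv, hdv, h6, h6, hw d c, hg d c, hg b d,
    hg b c, hΓ a d c, h7]
  split_ifs <;> ring

-- Metric compatibility $\nabla g=0$, in the form of `hdg` in `riemann_confDiff`.
set_option maxHeartbeats 1000000 in
theorem fefMatrixDeriv_eq {i : ℝ} (hi : i ≠ 0) (p : ℝ) (j : ℕ → ℝ) (c a b : Fin 4) :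
    (if c = 2 then fefMatrixDeriv i p j a b else 0)
      = ∑ e, fefMatrix i p j a e * fefChristoffel i p j e c b
        + ∑ e, fefMatrix i p j b e * fefChristoffel i p j e c a := by
  revert c a b
  refine forall_fin_four ?_ ?_ ?_ ?_ <;> refine forall_fin_four ?_ ?_ ?_ ?_ <;>
    refine forall_fin_four ?_ ?_ ?_ ?_ <;>
    simp only [fefMatrixDeriv, fefMatrix, fefChristoffel, Fin.sum_univ_four, vec4_zero, vec4_one,
      vec4_two, vec4_three, Fin.reduceEq, ↓reduceIte, mul_zero, zero_mul, add_zero, zero_add] <;>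
    field_simp <;> ring

-- The companion identity $\nabla g^{-1}=0$.
set_option maxHeartbeats 1000000 in
theorem fefInverseDeriv_eq {i : ℝ} (hi : i ≠ 0) (p : ℝ) (j : ℕ → ℝ) (c a b : Fin 4) :
    (if c = 2 then fefInverseDeriv i p j a b else 0)
      = -∑ e, fefChristoffel i p j a c e * fefInverse i p j e b
        - ∑ e, fefInverse i p j a e * fefChristoffel i p j b c e := by
  revert c a b
  refine forall_fin_four ?_ ?_ ?_ ?_ <;> refine forall_fin_four ?_ ?_ ?_ ?_ <;>
    refine forall_fin_four ?_ ?_ ?_ ?_ <;>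
    simp only [fefInverseDeriv, fefInverse, fefChristoffel, Fin.sum_univ_four, vec4_zero, vec4_one,
      vec4_two, vec4_three, Fin.reduceEq, ↓reduceIte, mul_zero, zero_mul, add_zero, zero_add,
      neg_zero, sub_zero] <;>
    field_simp <;> ring

/-- The tensor with the components `C^a_{bcd} + δ^a_c K_{bd} - δ^a_d K_{bc} + g_{bd} K^a_c -
g_{bc} K^a_d`, where `C` is the Weyl tensor. -/
def curvatureUp (i p : ℝ) (j : ℕ → ℝ) (K : Fin 4 → Fin 4 → ℝ) (a b c d : Fin 4) : ℝ :=
  (∑ e, fefInverse i p j a e * fefWeyl p j e b c d)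
    + (if a = c then K b d else 0) - (if a = d then K b c else 0)
    + fefMatrix i p j b d * (∑ e, fefInverse i p j a e * K e c)
    - fefMatrix i p j b c * (∑ e, fefInverse i p j a e * K e d)

theorem fefWeyl_swap (p : ℝ) (j : ℕ → ℝ) (a b c d : Fin 4) :
    fefWeyl p j a b d c = -fefWeyl p j a b c d := by
  have h1 : ∀ c d, fefF d c = -fefF c d := by
    refine forall_fin_four ?_ ?_ ?_ ?_ <;> refine forall_fin_four ?_ ?_ ?_ ?_ <;> simp [fefF]
  have h2 : ∀ c d, fefG p j d c = -fefG p j c d := by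
    refine forall_fin_four ?_ ?_ ?_ ?_ <;> refine forall_fin_four ?_ ?_ ?_ ?_ <;> simp [fefG]
  simp only [fefWeyl, h1 c d, h2 c d]
  ring

theorem curvatureUp_swap (i p : ℝ) (j : ℕ → ℝ) (K : Fin 4 → Fin 4 → ℝ) (a b c d : Fin 4) :
    curvatureUp i p j K a b d c = -curvatureUp i p j K a b c d := by
  simp only [curvatureUp, fefWeyl_swap p j _ b c d, mul_neg, Finset.sum_neg_distrib]
  ring

-- The decomposition of the Riemann tensor for $\Omega=1$ into Weyl and Schouten parts, checked
-- componentwise. It is here that the closed forms of `fefWeyl` and `fefSchouten` are verified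
-- against the connection.
set_option maxHeartbeats 4000000 in
theorem fefChristoffel_curvature {i : ℝ} (hi : i ≠ 0) (p : ℝ) (j : ℕ → ℝ) (a b c d : Fin 4) :
    (if c = 2 then fefChristoffelDeriv i p j a d b else 0)
      - (if d = 2 then fefChristoffelDeriv i p j a c b else 0)
      + ∑ e, (fefChristoffel i p j a c e * fefChristoffel i p j e d b
        - fefChristoffel i p j a d e * fefChristoffel i p j e c b)
      = curvatureUp i p j (fefSchouten i p j) a b c d := by
  -- Both sides are antisymmetric in $c,d$, so six index pairs suffice.
  have key : ∀ c d : Fin 4, c < d → ∀ a b : Fin 4,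
      (if c = 2 then fefChristoffelDeriv i p j a d b else 0)
      - (if d = 2 then fefChristoffelDeriv i p j a c b else 0)
      + ∑ e, (fefChristoffel i p j a c e * fefChristoffel i p j e d b
        - fefChristoffel i p j a d e * fefChristoffel i p j e c b)
      = curvatureUp i p j (fefSchouten i p j) a b c d := by
    refine forall_fin_four ?_ ?_ ?_ ?_ <;> refine forall_fin_four ?_ ?_ ?_ ?_ <;> intro hcd <;>
      first
      | exact absurd hcd (by decide)
      | (refine forall_fin_four ?_ ?_ ?_ ?_ <;> refine forall_fin_four ?_ ?_ ?_ ?_ <;>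
          simp only [curvatureUp, fefWeyl, fefF, fefG, fefMatrix, fefInverse, fefChristoffel,
            fefChristoffelDeriv, fefSchouten, Fin.sum_univ_four, vec4_zero, vec4_one,
            vec4_two, vec4_three, Fin.reduceEq, ↓reduceIte, mul_zero, zero_mul, add_zero, zero_add,
            sub_zero, zero_sub, sub_self] <;> field_simp <;> ring)
  rcases lt_trichotomy c d with h | h | h
  · exact key c d h a b
  · subst h
    have := curvatureUp_swap i p j (fefSchouten i p j) a b c c
    have h0 : curvatureUp i p j (fefSchouten i p j) a b c c = 0 := by linarith
    rw [h0]
    simp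
  · rw [curvatureUp_swap, ← key d c h a b, Finset.sum_sub_distrib, Finset.sum_sub_distrib]
    ring

/-! ### Component identities for the divergence of the Weyl tensor and for the Bach tensor -/

/-- The Christoffel symbols of `Ω g`, where `u = dΩ / (2Ω)`. -/
def confChristoffel (i p : ℝ) (j : ℕ → ℝ) (u : Fin 4 → ℝ) (a b c : Fin 4) : ℝ :=
  fefChristoffel i p j a b c + confDiff (fefMatrix i p j) u (fefRaise i p j u) a b c

/-- The derivative of `fefG` along the jet. -/
def fefGDeriv (j : ℕ → ℝ) : Fin 4 → Fin 4 → ℝ :=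
  vec4 (vec4 0 (j 1) (-1) 0) (vec4 (-j 1) 0 0 0) (vec4 1 0 0 0) (vec4 0 0 0 0)

/-- The derivative of `fefWeyl` along the jet. -/
def fefWeylDeriv (p : ℝ) (j : ℕ → ℝ) (a b c d : Fin 4) : ℝ :=
  (2 * j 0 * j 1 * j 4 + j 0 ^ 2 * j 5) / 6 * (fefF a b * fefF c d)
    + j 5 / 6 * (fefG p j a b * fefG p j c d)
    + j 4 / 6 * (fefGDeriv j a b * fefG p j c d + fefG p j a b * fefGDeriv j c d)

/-- A component of `divWeylF`. -/
def divWeylCoeffF (j : ℕ → ℝ) (u : Fin 4 → ℝ) : ℝ :=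
  -(j 0 * (2 * j 1 * j 4 + j 0 * j 5 + j 0 * j 4 * u 2) / 6)

/-- The first covector in the divergence of the Weyl tensor of `Ω g`. -/
def divWeylF (i p : ℝ) (j : ℕ → ℝ) (u : Fin 4 → ℝ) : Fin 4 → ℝ :=
  vec4 (-(p * divWeylCoeffF j u) - j 0 ^ 2 * j 4 / 4 * (i⁻¹ * u 3 + 1 / 3)) (divWeylCoeffF j u) 0 0

/-- A component of `divWeylG`. -/
def divWeylCoeffG (i p : ℝ) (j : ℕ → ℝ) (u : Fin 4 → ℝ) : ℝ :=
  (j 0 * j 4 * u 2 + j 0 * j 5 + 2 * j 1 * j 4 - j 1 * j 4 * (i⁻¹ * u 3)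
    + j 4 * (p * u 1 + u 0)) / 6

/-- The second covector in the divergence of the Weyl tensor of `Ω g`. -/
def divWeylG (i p : ℝ) (j : ℕ → ℝ) (u : Fin 4 → ℝ) : Fin 4 → ℝ :=
  vec4 (-(p * divWeylCoeffG i p j u) - j 0 * j 4 / 4 * (i⁻¹ * u 3 - 1 / 3))
    (divWeylCoeffG i p j u) (j 4 / 4 * (i⁻¹ * u 3 - 1 / 3)) 0

/-- The divergence of the Weyl tensor of `Ω g`. -/
def confDivWeyl (i p : ℝ) (j : ℕ → ℝ) (u : Fin 4 → ℝ) (a b c : Fin 4) : ℝ :=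
  fefF a b * divWeylF i p j u c + fefG p j a b * divWeylG i p j u c

/-- The derivative of `divWeylCoeffF`; `s` is the derivative of `p` and `v` that of `u`. -/
def divWeylCoeffFDeriv (j : ℕ → ℝ) (u : Fin 4 → ℝ) (s : ℝ) (v : Fin 4 → ℝ) : ℝ :=
  -((s * j 1 * (2 * j 1 * j 4 + j 0 * j 5 + j 0 * j 4 * u 2)
    + j 0 * (s * (2 * j 2 * j 4 + 3 * j 1 * j 5 + j 0 * j 6 + (j 1 * j 4 + j 0 * j 5) * u 2)
      + j 0 * j 4 * v 2)) / 6)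

/-- The derivative of `divWeylF`. -/
def divWeylFDeriv (i p : ℝ) (j : ℕ → ℝ) (u : Fin 4 → ℝ) (s : ℝ) (v : Fin 4 → ℝ) : Fin 4 → ℝ :=
  vec4 (-(s * divWeylCoeffF j u + p * divWeylCoeffFDeriv j u s v)
      - (s * (2 * j 0 * j 1 * j 4 + j 0 ^ 2 * j 5) / 4 * (i⁻¹ * u 3 + 1 / 3)
        + j 0 ^ 2 * j 4 / 4 * (i⁻¹ * v 3)))
    (divWeylCoeffFDeriv j u s v) 0 0

/-- The derivative of `divWeylCoeffG`. -/
def divWeylCoeffGDeriv (i p : ℝ) (j : ℕ → ℝ) (u : Fin 4 → ℝ) (s : ℝ) (v : Fin 4 → ℝ) : ℝ :=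
  (s * ((j 1 * j 4 + j 0 * j 5) * u 2 + 3 * j 1 * j 5 + j 0 * j 6 + 2 * j 2 * j 4
      - (j 2 * j 4 + j 1 * j 5) * (i⁻¹ * u 3) + j 5 * (p * u 1 + u 0) + j 4 * u 1)
    + j 0 * j 4 * v 2 - j 1 * j 4 * (i⁻¹ * v 3) + j 4 * (p * v 1 + v 0)) / 6

/-- The derivative of `divWeylG`. -/
def divWeylGDeriv (i p : ℝ) (j : ℕ → ℝ) (u : Fin 4 → ℝ) (s : ℝ) (v : Fin 4 → ℝ) : Fin 4 → ℝ :=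
  vec4 (-(s * divWeylCoeffG i p j u + p * divWeylCoeffGDeriv i p j u s v)
      - (s * (j 1 * j 4 + j 0 * j 5) / 4 * (i⁻¹ * u 3 - 1 / 3)
        + j 0 * j 4 / 4 * (i⁻¹ * v 3)))
    (divWeylCoeffGDeriv i p j u s v)
    (s * j 5 / 4 * (i⁻¹ * u 3 - 1 / 3) + j 4 / 4 * (i⁻¹ * v 3)) 0

/-- The derivative of `confDivWeyl`. -/
def confDivWeylDeriv (i p : ℝ) (j : ℕ → ℝ) (u : Fin 4 → ℝ) (s : ℝ) (v : Fin 4 → ℝ)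
    (a b c : Fin 4) : ℝ :=
  fefF a b * divWeylFDeriv i p j u s v c
    + (s * fefGDeriv j a b * divWeylG i p j u c + fefG p j a b * divWeylGDeriv i p j u s v c)

theorem fefF_swap (a b : Fin 4) : fefF b a = -fefF a b := by
  revert a b
  refine forall_fin_four ?_ ?_ ?_ ?_ <;> refine forall_fin_four ?_ ?_ ?_ ?_ <;> simp [fefF]

theorem fefG_swap (p : ℝ) (j : ℕ → ℝ) (a b : Fin 4) : fefG p j b a = -fefG p j a b := by
  revert a b
  refine forall_fin_four ?_ ?_ ?_ ?_ <;> refine forall_fin_four ?_ ?_ ?_ ?_ <;> simp [fefG]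

theorem fefGDeriv_swap (j : ℕ → ℝ) (a b : Fin 4) : fefGDeriv j b a = -fefGDeriv j a b := by
  revert a b
  refine forall_fin_four ?_ ?_ ?_ ?_ <;> refine forall_fin_four ?_ ?_ ?_ ?_ <;> simp [fefGDeriv]

theorem fefWeyl_swap' (p : ℝ) (j : ℕ → ℝ) (a b c d : Fin 4) :
    fefWeyl p j b a c d = -fefWeyl p j a b c d := by
  simp only [fefWeyl, fefF_swap a b, fefG_swap p j a b]
  ring

theorem fefWeylDeriv_swap' (p : ℝ) (j : ℕ → ℝ) (a b c d : Fin 4) :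
    fefWeylDeriv p j b a c d = -fefWeylDeriv p j a b c d := by
  simp only [fefWeylDeriv, fefF_swap a b, fefG_swap p j a b, fefGDeriv_swap j a b]
  ring

theorem confDivWeyl_swap (i p : ℝ) (j : ℕ → ℝ) (u : Fin 4 → ℝ) (a b c : Fin 4) :
    confDivWeyl i p j u b a c = -confDivWeyl i p j u a b c := by
  simp only [confDivWeyl, fefF_swap a b, fefG_swap p j a b]
  ring

-- The term `2 * u e * fefWeyl` is the derivative of the factor $\Omega$ in the Weyl tensor of
-- $\Omega g$, after division by $\Omega$. The divergence keeps the shape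
-- $F\otimes\cdot+G\otimes\cdot$, which keeps the next differentiation manageable.
set_option maxHeartbeats 8000000 in
theorem sum_fefWeylDeriv {i : ℝ} (hi : i ≠ 0) (p : ℝ) (j : ℕ → ℝ) (u : Fin 4 → ℝ)
    (a b c : Fin 4) :
    ∑ e, ∑ d, fefInverse i p j e d * ((if e = 2 then fefWeylDeriv p j a b c d else 0)
      + 2 * u e * fefWeyl p j a b c d
      - ∑ m, (confChristoffel i p j u m e a * fefWeyl p j m b c d
          + confChristoffel i p j u m e b * fefWeyl p j a m c d
          + confChristoffel i p j u m e c * fefWeyl p j a b m d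
          + confChristoffel i p j u m e d * fefWeyl p j a b c m))
    = confDivWeyl i p j u a b c := by
  set L : Fin 4 → Fin 4 → Fin 4 → ℝ := fun a b c => ∑ e, ∑ d, fefInverse i p j e d *
      ((if e = 2 then fefWeylDeriv p j a b c d else 0) + 2 * u e * fefWeyl p j a b c d
      - ∑ m, (confChristoffel i p j u m e a * fefWeyl p j m b c d
          + confChristoffel i p j u m e b * fefWeyl p j a m c d
          + confChristoffel i p j u m e c * fefWeyl p j a b m d
          + confChristoffel i p j u m e d * fefWeyl p j a b c m)) with hL
  have swap : ∀ a b c, L b a c = -L a b c := by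
    intro a b c
    simp only [hL, ← Finset.sum_neg_distrib]
    refine Finset.sum_congr rfl fun e _ => Finset.sum_congr rfl fun d _ => ?_
    rw [fefWeylDeriv_swap' p j a b, fefWeyl_swap' p j a b, ← mul_neg, neg_sub,
      sub_eq_add_neg _ (∑ m, _), add_comm _ (-∑ m, _), sub_eq_add_neg, ← Finset.sum_neg_distrib]
    congr 2
    · refine Finset.sum_congr rfl fun m _ => ?_
      rw [fefWeyl_swap' p j a m, fefWeyl_swap' p j m b, fefWeyl_swap' p j a b,
        fefWeyl_swap' p j a b]
      ring
    · split_ifs <;> ring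
  have key : ∀ a b : Fin 4, a < b → ∀ c, L a b c = confDivWeyl i p j u a b c := by
    refine forall_fin_four ?_ ?_ ?_ ?_ <;> refine forall_fin_four ?_ ?_ ?_ ?_ <;> intro hab <;>
      first
      | exact absurd hab (by decide)
      | (refine forall_fin_four ?_ ?_ ?_ ?_ <;>
          simp only [hL, fefWeylDeriv, fefGDeriv, fefWeyl, fefF, fefG, fefMatrix, fefInverse,
            fefChristoffel, confChristoffel, confDiff, fefRaise, confDivWeyl, divWeylF, divWeylG,
            divWeylCoeffF, divWeylCoeffG, Fin.sum_univ_four, vec4_zero, vec4_one, vec4_two,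
            vec4_three, Fin.reduceEq, ↓reduceIte, mul_zero, zero_mul, add_zero, zero_add, sub_zero,
            zero_sub, sub_self] <;> field_simp <;> ring)
  change L a b c = _
  rcases lt_trichotomy a b with h | h | h
  · exact key a b h c
  · subst h
    linarith [swap a a c, confDivWeyl_swap i p j u a a c]
  · rw [swap b a c, key b a h c, confDivWeyl_swap]
    ring

-- Conformal covariance of the Bach tensor: every term in `u` and `w` cancels. The coefficient that
-- survives is $(h^2h'''')''/3$, on the square of $dy-p\,dx$.
set_option maxHeartbeats 20000000 in
theorem sum_confDivWeylDeriv {i : ℝ} (hi : i ≠ 0) (p : ℝ) (j : ℕ → ℝ) (u : Fin 4 → ℝ)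
    (w : Fin 4 → Fin 4 → ℝ) (hw : ∀ a b, w a b = w b a) (a b : Fin 4) :
    (∑ e, ∑ c, fefInverse i p j e c *
      (confDivWeylDeriv i p j u (if e = 2 then 1 else 0) (w e) a c b
      - ∑ m, (confChristoffel i p j u m e a * confDivWeyl i p j u m c b
          + confChristoffel i p j u m e c * confDivWeyl i p j u a m b
          + confChristoffel i p j u m e b * confDivWeyl i p j u a c m)))
    + ∑ c, ∑ d, (∑ r, ∑ s, fefInverse i p j c r * fefInverse i p j d s *
        confSchouten i p j u w r s) * fefWeyl p j a c b d
    = (2 * j 1 ^ 2 * j 4 + 2 * j 0 * j 2 * j 4 + 4 * j 0 * j 1 * j 5 + j 0 ^ 2 * j 6) / 3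
      * (vec4 (-p) 1 0 0 a * vec4 (-p) 1 0 0 b) := by
  have h10 := hw 1 0
  have h20 := hw 2 0
  have h30 := hw 3 0
  have h21 := hw 2 1
  have h31 := hw 3 1
  have h32 := hw 3 2
  revert a b
  refine forall_fin_four ?_ ?_ ?_ ?_ <;> refine forall_fin_four ?_ ?_ ?_ ?_ <;>
    simp only [fefGDeriv, fefWeyl, fefF, fefG, fefMatrix, fefInverse, fefChristoffel,
      confChristoffel, confDiff, fefRaise, confDivWeyl, divWeylF, divWeylG, divWeylCoeffF,
      divWeylCoeffG, divWeylFDeriv, divWeylGDeriv, divWeylCoeffFDeriv, divWeylCoeffGDeriv,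
      confDivWeylDeriv, confSchouten, fefSchouten, h10, h20, h30, h21, h31, h32,
      Fin.sum_univ_four, vec4_zero, vec4_one, vec4_two, vec4_three, Fin.reduceEq, ↓reduceIte,
      mul_zero, zero_mul, add_zero, zero_add, sub_zero, zero_sub, sub_self, neg_zero] <;>
    field_simp <;> ring

/-! ### The curvature of a multiple of the Fefferman metric -/

theorem hasDerivAt_fefMatrix (i : ℝ) {J : ℝ → ℕ → ℝ} {p : ℝ}
    (hJ : ∀ k < 3, HasDerivAt (fun q => J q k) (J p (k + 1)) p) (a b : Fin 4) :
    HasDerivAt (fun q => fefMatrix i q (J q) a b) (fefMatrixDeriv i p (J p) a b) p := by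
  have h0 := hJ 0 (by norm_num)
  have h1 := hJ 1 (by norm_num)
  have h2 := hJ 2 (by norm_num)
  clear hJ
  revert a b
  refine forall_fin_four ?_ ?_ ?_ ?_ <;> refine forall_fin_four ?_ ?_ ?_ ?_ <;>
    simp only [fefMatrix, fefMatrixDeriv, vec4_zero, vec4_one, vec4_two, vec4_three,
      pow_succ, pow_zero, one_mul] <;>
    refine HasDerivAt.congr_deriv (by
      apply_rules [hasDerivAt_const, HasDerivAt.fun_add, HasDerivAt.fun_sub, HasDerivAt.fun_mul,
        HasDerivAt.fun_neg, hasDerivAt_id', h0, h1, h2]) ?_ <;>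
    norm_num <;> ring

theorem hasDerivAt_fefInverse (i : ℝ) {J : ℝ → ℕ → ℝ} {p : ℝ}
    (hJ : ∀ k < 3, HasDerivAt (fun q => J q k) (J p (k + 1)) p) (a b : Fin 4) :
    HasDerivAt (fun q => fefInverse i q (J q) a b) (fefInverseDeriv i p (J p) a b) p := by
  have h0 := hJ 0 (by norm_num)
  have h1 := hJ 1 (by norm_num)
  have h2 := hJ 2 (by norm_num)
  clear hJ
  revert a b
  refine forall_fin_four ?_ ?_ ?_ ?_ <;> refine forall_fin_four ?_ ?_ ?_ ?_ <;>
    simp only [fefInverse, fefInverseDeriv, vec4_zero, vec4_one, vec4_two, vec4_three,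
      pow_succ, pow_zero, one_mul] <;>
    refine HasDerivAt.congr_deriv (by
      apply_rules [hasDerivAt_const, HasDerivAt.fun_add, HasDerivAt.fun_sub, HasDerivAt.fun_mul,
        HasDerivAt.fun_neg, hasDerivAt_id', h0, h1, h2]) ?_ <;>
    norm_num

set_option maxHeartbeats 1000000 in
theorem hasDerivAt_fefChristoffel (i : ℝ) {J : ℝ → ℕ → ℝ} {p : ℝ}
    (hJ : ∀ k < 4, HasDerivAt (fun q => J q k) (J p (k + 1)) p) (a b c : Fin 4) :
    HasDerivAt (fun q => fefChristoffel i q (J q) a b c) (fefChristoffelDeriv i p (J p) a b c) p := by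
  have h0 := hJ 0 (by norm_num)
  have h1 := hJ 1 (by norm_num)
  have h2 := hJ 2 (by norm_num)
  have h3 := hJ 3 (by norm_num)
  clear hJ
  revert a b c
  refine forall_fin_four ?_ ?_ ?_ ?_ <;> refine forall_fin_four ?_ ?_ ?_ ?_ <;>
    refine forall_fin_four ?_ ?_ ?_ ?_ <;>
    simp only [fefChristoffel, fefChristoffelDeriv, vec4_zero, vec4_one, vec4_two, vec4_three,
      pow_succ, pow_zero, one_mul] <;>
    refine HasDerivAt.congr_deriv (by
      apply_rules [hasDerivAt_const, HasDerivAt.fun_add, HasDerivAt.fun_sub, HasDerivAt.fun_mul,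
        HasDerivAt.fun_neg, hasDerivAt_id', h0, h1, h2, h3]) ?_ <;>
    norm_num <;> ring

/-- The components of `dΩ / (2Ω)`. -/
def logGrad (Ω : (Fin 4 → ℝ) → ℝ) (x : Fin 4 → ℝ) (a : Fin 4) : ℝ :=
  pd a (fun z => Real.log (Ω z) / 2) x

/-- The derivatives `∂_k u_a` of `u = dΩ / (2Ω)`. -/
def logHess (Ω : (Fin 4 → ℝ) → ℝ) (x : Fin 4 → ℝ) (k a : Fin 4) : ℝ :=
  pd k (fun z => logGrad Ω z a) x

/-- On `U` the metric `g` is `Ω` times the Fefferman metric of `y'' = h(y')` with `ρ = 1`, and `h`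
is `n` times differentiable. -/
structure IsMultiple (n : ℕ) (i : ℝ) (h : ℝ → ℝ) (Ω : (Fin 4 → ℝ) → ℝ) (g : MetricField)
    (U : Set (Fin 4 → ℝ)) : Prop where
  const_ne : i ≠ 0
  isOpen : IsOpen U
  smooth : ContDiffOn ℝ ∞ Ω U
  ne : ∀ x ∈ U, Ω x ≠ 0
  eq : ∀ x ∈ U, ∀ a b, g x a b = Ω x * fefMatrix i (x 2) (jet h (x 2)) a b
  jet : ∀ x ∈ U, ∀ k < n, HasDerivAt (fun q => jet h q k) (jet h (x 2) (k + 1)) (x 2)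

namespace IsMultiple

variable {n : ℕ} {i : ℝ} {h : ℝ → ℝ} {Ω : (Fin 4 → ℝ) → ℝ} {g : MetricField}
  {U : Set (Fin 4 → ℝ)} {x : Fin 4 → ℝ}

theorem mem_nhds (H : IsMultiple n i h Ω g U) (hx : x ∈ U) : U ∈ nhds x := H.isOpen.mem_nhds hx

theorem contDiffOn_log (H : IsMultiple n i h Ω g U) :
    ContDiffOn ℝ ∞ (fun z => Real.log (Ω z) / 2) U :=
  (H.smooth.log H.ne).div_const 2

/-- `Real.log` is $\log|\cdot|$ away from zero, so $d\Omega=2\Omega u$ holds for either sign of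
$\Omega$. Negative $\Omega$ does occur: the example has the factor $i|P|^{2/3}$. -/
theorem hasGrad_factor (H : IsMultiple n i h Ω g U) (hx : x ∈ U) :
    HasGrad Ω (fun k => Ω x * (2 * logGrad Ω x k)) x := by
  have hd : DifferentiableAt ℝ Ω x :=
    (H.smooth.contDiffAt (H.mem_nhds hx)).differentiableAt (by simp)
  refine ⟨hd, fun k => ?_⟩
  have h0 := H.ne x hx
  have h1 : HasFDerivAt (fun z => Real.log (Ω z) / 2) ((2 : ℝ)⁻¹ • ((Ω x)⁻¹ • fderiv ℝ Ω x)) x := by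
    have := (hd.hasFDerivAt.log h0).const_smul (2 : ℝ)⁻¹
    refine this.congr_of_eventuallyEq (Filter.Eventually.of_forall fun z => ?_)
    simp [div_eq_inv_mul]
  rw [logGrad, pd, pd, h1.fderiv]
  simp only [FunLike.coe_smul, Pi.smul_apply, smul_eq_mul]
  field_simp

theorem contDiffOn_logGrad (H : IsMultiple n i h Ω g U) (a : Fin 4) :
    ContDiffOn ℝ ∞ (fun z => logGrad Ω z a) U :=
  contDiffOn_pd H.isOpen H.contDiffOn_log a

theorem hasGrad_logGrad (H : IsMultiple n i h Ω g U) (hx : x ∈ U) (a : Fin 4) :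
    HasGrad (fun z => logGrad Ω z a) (fun k => logHess Ω x k a) x :=
  ⟨((H.contDiffOn_logGrad a).contDiffAt (H.mem_nhds hx)).differentiableAt (by simp), fun _ => rfl⟩

theorem logHess_symm (H : IsMultiple n i h Ω g U) (hx : x ∈ U) (a b : Fin 4) :
    logHess Ω x a b = logHess Ω x b a :=
  pd_comm (contDiffAt_infty.1 (H.contDiffOn_log.contDiffAt (H.mem_nhds hx)) 2) a b

theorem hasGrad_jet (H : IsMultiple n i h Ω g U) (hx : x ∈ U) {k : ℕ} (hk : k < n) :
    HasGrad (fun z => FeffermanODE.jet h (z 2) k)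
      (fun e => if e = 2 then FeffermanODE.jet h (x 2) (k + 1) else 0) x :=
  HasGrad.comp_coord (φ := fun q => FeffermanODE.jet h q k) (H.jet x hx k hk)

theorem hasGrad_fefMatrix (H : IsMultiple n i h Ω g U) (hn : 3 ≤ n) (hx : x ∈ U) (a b : Fin 4) :
    HasGrad (fun z => fefMatrix i (z 2) (FeffermanODE.jet h (z 2)) a b)
      (fun k => if k = 2 then fefMatrixDeriv i (x 2) (FeffermanODE.jet h (x 2)) a b else 0) x :=
  HasGrad.comp_coord (φ := fun q => fefMatrix i q (FeffermanODE.jet h q) a b)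
    (hasDerivAt_fefMatrix i (fun k hk => H.jet x hx k (hk.trans_le hn)) a b)

theorem hasGrad_fefInverse (H : IsMultiple n i h Ω g U) (hn : 3 ≤ n) (hx : x ∈ U) (a b : Fin 4) :
    HasGrad (fun z => fefInverse i (z 2) (FeffermanODE.jet h (z 2)) a b)
      (fun k => if k = 2 then fefInverseDeriv i (x 2) (FeffermanODE.jet h (x 2)) a b else 0) x :=
  HasGrad.comp_coord (φ := fun q => fefInverse i q (FeffermanODE.jet h q) a b)
    (hasDerivAt_fefInverse i (fun k hk => H.jet x hx k (hk.trans_le hn)) a b)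

theorem hasGrad_fefChristoffel (H : IsMultiple n i h Ω g U) (hn : 4 ≤ n) (hx : x ∈ U)
    (a b c : Fin 4) :
    HasGrad (fun z => fefChristoffel i (z 2) (FeffermanODE.jet h (z 2)) a b c)
      (fun k => if k = 2 then fefChristoffelDeriv i (x 2) (FeffermanODE.jet h (x 2)) a b c else 0)
      x :=
  HasGrad.comp_coord (φ := fun q => fefChristoffel i q (FeffermanODE.jet h q) a b c)
    (hasDerivAt_fefChristoffel i (fun k hk => H.jet x hx k (hk.trans_le hn)) a b c)

theorem inv_apply (H : IsMultiple n i h Ω g U) (hx : x ∈ U) (a b : Fin 4) :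
    (g x)⁻¹ a b = (Ω x)⁻¹ * fefInverse i (x 2) (FeffermanODE.jet h (x 2)) a b := by
  have : (g x)⁻¹ = Matrix.of fun a b =>
      (Ω x)⁻¹ * fefInverse i (x 2) (FeffermanODE.jet h (x 2)) a b := by
    refine Matrix.inv_eq_left_inv ?_
    ext a b
    rw [Matrix.mul_apply, Matrix.one_apply,
      ← sum_fefInverse_mul_fefMatrix H.const_ne (x 2) (FeffermanODE.jet h (x 2)) a b]
    refine Finset.sum_congr rfl fun e _ => ?_
    rw [H.eq x hx, Matrix.of_apply]
    have := H.ne x hx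
    field_simp
  rw [this, Matrix.of_apply]

theorem hasGrad_metric (H : IsMultiple n i h Ω g U) (hn : 3 ≤ n) (hx : x ∈ U) (a b : Fin 4) :
    HasGrad (fun z => g z a b) (fun k => Ω x *
      (2 * logGrad Ω x k * fefMatrix i (x 2) (FeffermanODE.jet h (x 2)) a b
        + (if k = 2 then fefMatrixDeriv i (x 2) (FeffermanODE.jet h (x 2)) a b else 0))) x := by
  refine (((H.hasGrad_factor hx).mul (H.hasGrad_fefMatrix hn hx a b)).congr_grad
    fun k => by ring).congr_of_eventuallyEq ?_
  filter_upwards [H.mem_nhds hx] with z hz using H.eq z hz a b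

theorem christoffel_eq (H : IsMultiple n i h Ω g U) (hn : 3 ≤ n) (hx : x ∈ U) (a b c : Fin 4) :
    christoffel g a b c x
      = confChristoffel i (x 2) (FeffermanODE.jet h (x 2)) (logGrad Ω x) a b c := by
  have h0 := H.ne x hx
  have h1 : ∀ d, (g x)⁻¹ a d * (pd b (fun z => g z d c) x + pd c (fun z => g z d b) x
        - pd d (fun z => g z b c) x)
      = 2 * logGrad Ω x b * (fefInverse i (x 2) (FeffermanODE.jet h (x 2)) a d
          * fefMatrix i (x 2) (FeffermanODE.jet h (x 2)) d c)
        + 2 * logGrad Ω x c * (fefInverse i (x 2) (FeffermanODE.jet h (x 2)) a d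
          * fefMatrix i (x 2) (FeffermanODE.jet h (x 2)) d b)
        - 2 * fefMatrix i (x 2) (FeffermanODE.jet h (x 2)) b c
          * (fefInverse i (x 2) (FeffermanODE.jet h (x 2)) a d * logGrad Ω x d)
        + fefInverse i (x 2) (FeffermanODE.jet h (x 2)) a d *
          ((if b = 2 then fefMatrixDeriv i (x 2) (FeffermanODE.jet h (x 2)) d c else 0)
          + (if c = 2 then fefMatrixDeriv i (x 2) (FeffermanODE.jet h (x 2)) d b else 0)
          - (if d = 2 then fefMatrixDeriv i (x 2) (FeffermanODE.jet h (x 2)) b c else 0)) := by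
    intro d
    rw [H.inv_apply hx, (H.hasGrad_metric hn hx d c).pd_eq, (H.hasGrad_metric hn hx d b).pd_eq,
      (H.hasGrad_metric hn hx b c).pd_eq]
    field_simp
    ring
  rw [christoffel, Finset.sum_congr rfl fun d _ => h1 d, Finset.sum_add_distrib,
    Finset.sum_sub_distrib, Finset.sum_add_distrib, ← Finset.mul_sum, ← Finset.mul_sum,
    ← Finset.mul_sum, sum_fefInverse_mul_fefMatrix H.const_ne,
    sum_fefInverse_mul_fefMatrix H.const_ne, mul_add, fefChristoffel_eq H.const_ne, confChristoffel,
    confDiff, fefRaise]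
  split_ifs <;> ring

/-- The gradient of a Christoffel symbol. -/
theorem hasGrad_christoffel (H : IsMultiple n i h Ω g U) (hn : 4 ≤ n) (hx : x ∈ U)
    (a b c : Fin 4) :
    HasGrad (christoffel g a b c) (fun k =>
      (if k = 2 then fefChristoffelDeriv i (x 2) (FeffermanODE.jet h (x 2)) a b c else 0)
      + ((if a = b then logHess Ω x k c else 0) + (if a = c then logHess Ω x k b else 0)
        - ((if k = 2 then fefMatrixDeriv i (x 2) (FeffermanODE.jet h (x 2)) b c else 0)
            * fefRaise i (x 2) (FeffermanODE.jet h (x 2)) (logGrad Ω x) a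
          + fefMatrix i (x 2) (FeffermanODE.jet h (x 2)) b c *
            ∑ e, ((if k = 2 then fefInverseDeriv i (x 2) (FeffermanODE.jet h (x 2)) a e else 0)
                * logGrad Ω x e
              + fefInverse i (x 2) (FeffermanODE.jet h (x 2)) a e * logHess Ω x k e)))) x := by
  have hn' : 3 ≤ n := by omega
  have hite : ∀ (P : Prop) [Decidable P] (m : Fin 4),
      HasGrad (fun z => if P then logGrad Ω z m else 0)
        (fun k => if P then logHess Ω x k m else 0) x := by
    intro P _ m
    by_cases hP : P
    · simpa only [hP, if_true] using H.hasGrad_logGrad hx m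
    · simpa only [hP, if_false] using HasGrad.const 0
  have hr : HasGrad (fun z => fefRaise i (z 2) (FeffermanODE.jet h (z 2)) (logGrad Ω z) a)
      (fun k => ∑ e, ((if k = 2 then fefInverseDeriv i (x 2) (FeffermanODE.jet h (x 2)) a e else 0)
                * logGrad Ω x e
              + fefInverse i (x 2) (FeffermanODE.jet h (x 2)) a e * logHess Ω x k e)) x :=
    HasGrad.sum _ fun e _ => (H.hasGrad_fefInverse hn' hx a e).mul (H.hasGrad_logGrad hx e)
  refine HasGrad.congr_of_eventuallyEq ((H.hasGrad_fefChristoffel hn hx a b c).add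
    (((hite (a = b) c).add (hite (a = c) b)).sub ((H.hasGrad_fefMatrix hn' hx b c).mul hr))) ?_
  filter_upwards [H.mem_nhds hx] with z hz using H.christoffel_eq hn' hz a b c

end IsMultiple

/-! ### Riemann, Ricci, Schouten and Weyl tensors of $\Omega g$ -/

theorem confSchouten_symm (i p : ℝ) (j : ℕ → ℝ) (u : Fin 4 → ℝ) {w : Fin 4 → Fin 4 → ℝ}
    (hw : ∀ a b, w a b = w b a) (a b : Fin 4) :
    confSchouten i p j u w a b = confSchouten i p j u w b a := by
  rw [confSchouten, confSchouten, fefSchouten_symm i p j a b, hw a b, fefMatrix_symm i p j a b,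
    Finset.sum_congr rfl fun c _ => by rw [fefChristoffel_symm i p j c a b]]
  ring

theorem sum_fefMatrix_mul_fefRaise {i : ℝ} (hi : i ≠ 0) (p : ℝ) (j : ℕ → ℝ) (u : Fin 4 → ℝ)
    (c : Fin 4) : ∑ e, fefMatrix i p j c e * fefRaise i p j u e = u c := by
  simp only [fefRaise, Finset.mul_sum]
  rw [Finset.sum_comm]
  simp only [← mul_assoc, ← Finset.sum_mul, sum_fefMatrix_mul_fefInverse hi, ite_mul, one_mul,
    zero_mul, Finset.sum_ite_eq, Finset.mem_univ, if_true]

/-- The product rule for $g^{ae}u_e$ with $\partial g^{-1}$ replaced through $\nabla g^{-1}=0$; it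
supplies `hdv` of `riemann_confDiff`. -/
theorem fefRaise_deriv {i : ℝ} (hi : i ≠ 0) (p : ℝ) (j : ℕ → ℝ) (u : Fin 4 → ℝ)
    (w : Fin 4 → Fin 4 → ℝ) (c a : Fin 4) :
    ∑ e, ((if c = 2 then fefInverseDeriv i p j a e else 0) * u e + fefInverse i p j a e * w c e)
      = -∑ e, fefChristoffel i p j a c e * fefRaise i p j u e
        + ∑ e, fefInverse i p j a e * (w c e - ∑ m, fefChristoffel i p j m c e * u m) := by
  have h1 : ∑ e, (∑ m, fefChristoffel i p j a c m * fefInverse i p j m e) * u e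
      = ∑ m, fefChristoffel i p j a c m * fefRaise i p j u m := by
    simp only [fefRaise, Finset.mul_sum, Finset.sum_mul]
    rw [Finset.sum_comm]
    simp only [mul_assoc]
  have h2 : ∑ e, (∑ m, fefInverse i p j a m * fefChristoffel i p j e c m) * u e
      = ∑ m, fefInverse i p j a m * ∑ e, fefChristoffel i p j e c m * u e := by
    simp only [Finset.mul_sum, Finset.sum_mul]
    rw [Finset.sum_comm]
    simp only [mul_assoc]
  simp only [fefInverseDeriv_eq hi, sub_mul, neg_mul, mul_sub, Finset.sum_add_distrib,
    Finset.sum_sub_distrib, Finset.sum_neg_distrib, h1, h2]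
  ring

/-- The Schouten part is linear in `K`, so the curvature for $\Omega=1$ and the conformal correction
can be added. -/
theorem curvatureUp_add (i p : ℝ) (j : ℕ → ℝ) (K L : Fin 4 → Fin 4 → ℝ) (a b c d : Fin 4) :
    curvatureUp i p j (fun a b => K a b + L a b) a b c d = curvatureUp i p j K a b c d
      + ((if a = c then L b d else 0) - (if a = d then L b c else 0)
      + fefMatrix i p j b d * (∑ e, fefInverse i p j a e * L e c)
      - fefMatrix i p j b c * (∑ e, fefInverse i p j a e * L e d)) := by
  simp only [curvatureUp, mul_add, Finset.sum_add_distrib]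
  split_ifs <;> ring

namespace IsMultiple

variable {n : ℕ} {i : ℝ} {h : ℝ → ℝ} {Ω : (Fin 4 → ℝ) → ℝ} {g : MetricField}
  {U : Set (Fin 4 → ℝ)} {x : Fin 4 → ℝ}

theorem riemannUp_eq (H : IsMultiple n i h Ω g U) (hn : 4 ≤ n) (hx : x ∈ U) (a b c d : Fin 4) :
    riemannUp g a b c d x = curvatureUp i (x 2) (FeffermanODE.jet h (x 2))
      (confSchouten i (x 2) (FeffermanODE.jet h (x 2)) (logGrad Ω x) (logHess Ω x)) a b c d := by
  have hn' : 3 ≤ n := by omega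
  have hw := fun a b => H.logHess_symm hx a b
  set p := x 2
  set j := FeffermanODE.jet h p with hj
  set u := logGrad Ω x
  set w := logHess Ω x
  -- This `K` is only the conformal correction to the Schouten tensor; `hK` adds `fefSchouten`.
  have key := riemann_confDiff (g := fefMatrix i p j) (ginv := fefInverse i p j)
    (Γ := fefChristoffel i p j) (u := u) (v := fefRaise i p j u) (w := w)
    (K := fun a b => -w a b + (∑ m, fefChristoffel i p j m a b * u m) + u a * u b
      - (1 / 2) * (∑ e, u e * fefRaise i p j u e) * fefMatrix i p j a b)
    (fefMatrix_symm i p j) hw (fefChristoffel_symm i p j) (fefMatrixDeriv_eq H.const_ne p j)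
    (sum_fefInverse_mul_fefMatrix H.const_ne p j) (fun a => rfl)
    (sum_fefMatrix_mul_fefRaise H.const_ne p j u) (fefRaise_deriv H.const_ne p j u w)
    (fun a b => rfl) a b c d
  have hK : confSchouten i p j u w = fun a b => fefSchouten i p j a b + (-w a b
      + (∑ m, fefChristoffel i p j m a b * u m) + u a * u b
      - (1 / 2) * (∑ e, u e * fefRaise i p j u e) * fefMatrix i p j a b) := by
    funext a b
    rw [confSchouten]
    ring
  rw [riemannUp, (H.hasGrad_christoffel hn hx a d b).pd_eq,
    (H.hasGrad_christoffel hn hx a c b).pd_eq]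
  simp only [H.christoffel_eq hn' hx]
  rw [hK, curvatureUp_add, ← fefChristoffel_curvature H.const_ne]
  simp only [confChristoffel]
  linear_combination key

end IsMultiple

-- The Weyl part is trace-free, so the Ricci tensor comes from the Schouten part alone.
set_option maxHeartbeats 1000000 in
theorem sum_fefInverse_mul_fefWeyl (i p : ℝ) (j : ℕ → ℝ) (b d : Fin 4) :
    ∑ a, ∑ e, fefInverse i p j a e * fefWeyl p j e b a d = 0 := by
  revert b d
  refine forall_fin_four ?_ ?_ ?_ ?_ <;> refine forall_fin_four ?_ ?_ ?_ ?_ <;>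
    simp only [fefInverse, fefWeyl, fefF, fefG, Fin.sum_univ_four, vec4_zero, vec4_one, vec4_two,
      vec4_three, mul_zero, zero_mul, add_zero, zero_add] <;> field_simp <;> ring

theorem sum_curvatureUp {i : ℝ} (hi : i ≠ 0) (p : ℝ) (j : ℕ → ℝ) (K : Fin 4 → Fin 4 → ℝ)
    (b d : Fin 4) :
    ∑ a, curvatureUp i p j K a b a d
      = 2 * K b d + fefMatrix i p j b d * ∑ a, ∑ e, fefInverse i p j a e * K e a := by
  have h1 : ∑ a, fefMatrix i p j b a * ∑ e, fefInverse i p j a e * K e d = K b d := by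
    simp only [Finset.mul_sum]
    rw [Finset.sum_comm]
    simp only [← mul_assoc, ← Finset.sum_mul, sum_fefMatrix_mul_fefInverse hi, ite_mul, one_mul,
      zero_mul, Finset.sum_ite_eq, Finset.mem_univ, if_true]
  simp only [curvatureUp, Finset.sum_add_distrib, Finset.sum_sub_distrib, ← Finset.mul_sum, h1,
    sum_fefInverse_mul_fefWeyl, Finset.sum_ite_eq', Finset.mem_univ, if_true,
    Finset.sum_const, Finset.card_univ, Fintype.card_fin]
  ring

theorem sum_fefMatrix_mul_curvatureUp {i : ℝ} (hi : i ≠ 0) (p : ℝ) (j : ℕ → ℝ)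
    (K : Fin 4 → Fin 4 → ℝ) (a b c d : Fin 4) :
    ∑ e, fefMatrix i p j a e * curvatureUp i p j K e b c d
      = fefWeyl p j a b c d + (fefMatrix i p j a c * K b d - fefMatrix i p j a d * K b c
        + fefMatrix i p j b d * K a c - fefMatrix i p j b c * K a d) := by
  have h1 : ∀ f : Fin 4 → ℝ,
      ∑ e, fefMatrix i p j a e * ∑ m, fefInverse i p j e m * f m = f a := by
    intro f
    simp only [Finset.mul_sum]
    rw [Finset.sum_comm]
    simp only [← mul_assoc, ← Finset.sum_mul, sum_fefMatrix_mul_fefInverse hi, ite_mul, one_mul,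
      zero_mul, Finset.sum_ite_eq, Finset.mem_univ, if_true]
  have h2 : ∀ e, fefMatrix i p j a e * curvatureUp i p j K e b c d
      = fefMatrix i p j a e * (∑ m, fefInverse i p j e m * fefWeyl p j m b c d)
        + (if e = c then fefMatrix i p j a e * K b d else 0)
        - (if e = d then fefMatrix i p j a e * K b c else 0)
        + fefMatrix i p j b d * (fefMatrix i p j a e * ∑ m, fefInverse i p j e m * K m c)
        - fefMatrix i p j b c * (fefMatrix i p j a e * ∑ m, fefInverse i p j e m * K m d) := by
    intro e
    rw [curvatureUp]
    split_ifs <;> ring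
  simp only [h2, Finset.sum_add_distrib, Finset.sum_sub_distrib, ← Finset.mul_sum, h1,
    Finset.sum_ite_eq', Finset.mem_univ, if_true]
  ring

namespace IsMultiple

variable {n : ℕ} {i : ℝ} {h : ℝ → ℝ} {Ω : (Fin 4 → ℝ) → ℝ} {g : MetricField}
  {U : Set (Fin 4 → ℝ)} {x : Fin 4 → ℝ}

theorem ricci_eq (H : IsMultiple n i h Ω g U) (hn : 4 ≤ n) (hx : x ∈ U) (b d : Fin 4) :
    ricci g b d x
      = 2 * confSchouten i (x 2) (FeffermanODE.jet h (x 2)) (logGrad Ω x) (logHess Ω x) b d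
        + fefMatrix i (x 2) (FeffermanODE.jet h (x 2)) b d *
          ∑ a, ∑ e, fefInverse i (x 2) (FeffermanODE.jet h (x 2)) a e *
            confSchouten i (x 2) (FeffermanODE.jet h (x 2)) (logGrad Ω x) (logHess Ω x) e a := by
  rw [ricci, ← sum_curvatureUp H.const_ne]
  exact Finset.sum_congr rfl fun a _ => H.riemannUp_eq hn hx a b a d

theorem schouten_eq (H : IsMultiple n i h Ω g U) (hn : 4 ≤ n) (hx : x ∈ U) (a b : Fin 4) :
    schouten g a b x
      = confSchouten i (x 2) (FeffermanODE.jet h (x 2)) (logGrad Ω x) (logHess Ω x) a b := by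
  have h0 := H.ne x hx
  set p := x 2
  set j := FeffermanODE.jet h p
  set K := confSchouten i p j (logGrad Ω x) (logHess Ω x) with hK
  have h1 : ∑ a, ∑ b, fefInverse i p j a b * fefMatrix i p j a b = 4 := by
    have : ∀ a, ∑ b, fefInverse i p j a b * fefMatrix i p j a b = 1 := by
      intro a
      rw [Finset.sum_congr rfl fun b _ => by rw [fefMatrix_symm i p j a b],
        sum_fefInverse_mul_fefMatrix H.const_ne, if_pos rfl]
    simp [this]
  -- Tracing $\mathrm{Ric}=2K+(\operatorname{tr}K)g$ in dimension four gives $2+4=6$ times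
  -- $\operatorname{tr}K$.
  have h2 : scalarCurv g x = (Ω x)⁻¹ * (6 * ∑ a, ∑ e, fefInverse i p j a e * K e a) := by
    have : ∀ a b, (g x)⁻¹ a b * ricci g a b x = (Ω x)⁻¹ * (2 * (fefInverse i p j a b * K b a)
        + (∑ a, ∑ e, fefInverse i p j a e * K e a) *
          (fefInverse i p j a b * fefMatrix i p j a b)) := by
      intro a b
      rw [H.inv_apply hx, H.ricci_eq hn hx, ← hK, hK,
        confSchouten_symm i p j _ (H.logHess_symm hx) a b]
      ring
    simp only [scalarCurv, this, ← Finset.mul_sum, Finset.sum_add_distrib, h1]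
    ring
  rw [schouten, h2, H.ricci_eq hn hx, H.eq x hx]
  field_simp
  ring

theorem weyl_eq (H : IsMultiple n i h Ω g U) (hn : 4 ≤ n) (hx : x ∈ U) (a b c d : Fin 4) :
    weyl g a b c d x = Ω x * fefWeyl (x 2) (FeffermanODE.jet h (x 2)) a b c d := by
  have h1 : riemann g a b c d x = Ω x * ∑ e, fefMatrix i (x 2) (FeffermanODE.jet h (x 2)) a e *
      curvatureUp i (x 2) (FeffermanODE.jet h (x 2)) (confSchouten i (x 2)
        (FeffermanODE.jet h (x 2)) (logGrad Ω x) (logHess Ω x)) e b c d := by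
    rw [riemann, Finset.mul_sum]
    refine Finset.sum_congr rfl fun e _ => ?_
    rw [H.riemannUp_eq hn hx, H.eq x hx, mul_assoc]
  rw [weyl, h1, sum_fefMatrix_mul_curvatureUp H.const_ne]
  simp only [H.schouten_eq hn hx, H.eq x hx]
  ring

end IsMultiple

/-! ### Divergence of the Weyl tensor and Bach tensor of $\Omega g$ -/

theorem hasDerivAt_fefG {J : ℝ → ℕ → ℝ} {p : ℝ}
    (h0 : HasDerivAt (fun q => J q 0) (J p 1) p) (a b : Fin 4) :
    HasDerivAt (fun q => fefG q (J q) a b) (fefGDeriv (J p) a b) p := by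
  revert a b
  refine forall_fin_four ?_ ?_ ?_ ?_ <;> refine forall_fin_four ?_ ?_ ?_ ?_ <;>
    simp only [fefG, fefGDeriv, vec4_zero, vec4_one, vec4_two, vec4_three] <;>
    apply_rules [hasDerivAt_const, HasDerivAt.fun_neg, hasDerivAt_id']

theorem hasDerivAt_fefWeyl {J : ℝ → ℕ → ℝ} {p : ℝ}
    (h0 : HasDerivAt (fun q => J q 0) (J p 1) p) (h4 : HasDerivAt (fun q => J q 4) (J p 5) p)
    (a b c d : Fin 4) :
    HasDerivAt (fun q => fefWeyl q (J q) a b c d) (fefWeylDeriv p (J p) a b c d) p := by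
  have := (h4.div_const 6).fun_mul (((h0.fun_pow 2).mul_const (fefF a b * fefF c d)).fun_add
    ((hasDerivAt_fefG h0 a b).fun_mul (hasDerivAt_fefG h0 c d)))
  refine this.congr_deriv ?_
  simp only [fefWeylDeriv, Nat.cast_ofNat, Nat.add_one_sub_one, pow_one]
  ring

namespace IsMultiple

variable {n : ℕ} {i : ℝ} {h : ℝ → ℝ} {Ω : (Fin 4 → ℝ) → ℝ} {g : MetricField}
  {U : Set (Fin 4 → ℝ)} {x : Fin 4 → ℝ}

theorem hasGrad_weyl (H : IsMultiple n i h Ω g U) (hn : 5 ≤ n) (hx : x ∈ U) (a b c d : Fin 4) :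
    HasGrad (weyl g a b c d) (fun e => Ω x *
      ((if e = 2 then fefWeylDeriv (x 2) (FeffermanODE.jet h (x 2)) a b c d else 0)
        + 2 * logGrad Ω x e * fefWeyl (x 2) (FeffermanODE.jet h (x 2)) a b c d)) x := by
  have h1 : HasGrad (fun z => fefWeyl (z 2) (FeffermanODE.jet h (z 2)) a b c d)
      (fun e => if e = 2 then fefWeylDeriv (x 2) (FeffermanODE.jet h (x 2)) a b c d else 0) x :=
    HasGrad.comp_coord (φ := fun q => fefWeyl q (FeffermanODE.jet h q) a b c d)
      (hasDerivAt_fefWeyl (H.jet x hx 0 (by omega)) (H.jet x hx 4 (by omega)) a b c d)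
  refine (((H.hasGrad_factor hx).mul h1).congr_grad fun k => by ring).congr_of_eventuallyEq ?_
  filter_upwards [H.mem_nhds hx] with z hz using H.weyl_eq (by omega) hz a b c d

theorem divWeyl_eq (H : IsMultiple n i h Ω g U) (hn : 5 ≤ n) (hx : x ∈ U) (a b c : Fin 4) :
    divWeyl g a b c x
      = confDivWeyl i (x 2) (FeffermanODE.jet h (x 2)) (logGrad Ω x) a b c := by
  have h0 := H.ne x hx
  rw [← sum_fefWeylDeriv H.const_ne, divWeyl]
  refine Finset.sum_congr rfl fun e _ => Finset.sum_congr rfl fun d _ => ?_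
  rw [(H.hasGrad_weyl hn hx a b c d).pd_eq, H.inv_apply hx]
  simp only [H.weyl_eq (by omega : 4 ≤ n) hx, H.christoffel_eq (by omega : 3 ≤ n) hx]
  -- The inverse metric carries $\Omega^{-1}$ and the Weyl tensor $\Omega$, so the divergence sees
  -- $\Omega$ only through $u$.
  have h1 : ∀ s t : ℝ, (Ω x)⁻¹ * s * (Ω x * t) = s * t := by
    intro s t
    field_simp
  refine Eq.trans ?_ (h1 _ _)
  rw [mul_sub (Ω x), Finset.mul_sum]
  congr 2
  exact Finset.sum_congr rfl fun m _ => by ring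

theorem hasGrad_coord (k : Fin 4) (x : Fin 4 → ℝ) :
    HasGrad (fun z => z k) (fun e => if e = k then 1 else 0) x :=
  HasGrad.comp_coord (φ := fun q => q) (hasDerivAt_id' _)

theorem hasGrad_divWeylF (H : IsMultiple n i h Ω g U) (hn : 6 ≤ n) (hx : x ∈ U) (c : Fin 4) :
    HasGrad (fun z => divWeylF i (z 2) (FeffermanODE.jet h (z 2)) (logGrad Ω z) c)
      (fun e => divWeylFDeriv i (x 2) (FeffermanODE.jet h (x 2)) (logGrad Ω x)
        (if e = 2 then 1 else 0) (logHess Ω x e) c) x := by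
  have hp := hasGrad_coord 2 x
  have j0 := H.hasGrad_jet hx (by omega : 0 < n)
  have j1 := H.hasGrad_jet hx (by omega : 1 < n)
  have j4 := H.hasGrad_jet hx (by omega : 4 < n)
  have j5 := H.hasGrad_jet hx (by omega : 5 < n)
  have u2 := H.hasGrad_logGrad hx 2
  have u3 := H.hasGrad_logGrad hx 3
  clear H
  revert c
  refine forall_fin_four ?_ ?_ ?_ ?_ <;>
    simp only [divWeylF, divWeylFDeriv, divWeylCoeffF, divWeylCoeffFDeriv, vec4_zero, vec4_one,
      vec4_two, vec4_three, pow_succ, pow_zero, one_mul] <;>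
    refine HasGrad.congr_grad (by
      apply_rules [HasGrad.const, HasGrad.add, HasGrad.sub, HasGrad.neg, HasGrad.div_const,
        HasGrad.mul]) ?_ <;>
    intro k <;> (try split_ifs) <;> ring

theorem hasGrad_divWeylG (H : IsMultiple n i h Ω g U) (hn : 6 ≤ n) (hx : x ∈ U) (c : Fin 4) :
    HasGrad (fun z => divWeylG i (z 2) (FeffermanODE.jet h (z 2)) (logGrad Ω z) c)
      (fun e => divWeylGDeriv i (x 2) (FeffermanODE.jet h (x 2)) (logGrad Ω x)
        (if e = 2 then 1 else 0) (logHess Ω x e) c) x := by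
  have hp := hasGrad_coord 2 x
  have j0 := H.hasGrad_jet hx (by omega : 0 < n)
  have j1 := H.hasGrad_jet hx (by omega : 1 < n)
  have j4 := H.hasGrad_jet hx (by omega : 4 < n)
  have j5 := H.hasGrad_jet hx (by omega : 5 < n)
  have u0 := H.hasGrad_logGrad hx 0
  have u1 := H.hasGrad_logGrad hx 1
  have u2 := H.hasGrad_logGrad hx 2
  have u3 := H.hasGrad_logGrad hx 3
  clear H
  revert c
  refine forall_fin_four ?_ ?_ ?_ ?_ <;>
    simp only [divWeylG, divWeylGDeriv, divWeylCoeffG, divWeylCoeffGDeriv, vec4_zero, vec4_one,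
      vec4_two, vec4_three] <;>
    refine HasGrad.congr_grad (by
      apply_rules [HasGrad.const, HasGrad.add, HasGrad.sub, HasGrad.neg, HasGrad.div_const,
        HasGrad.mul]) ?_ <;>
    intro k <;> (try split_ifs) <;> ring

theorem hasGrad_divWeyl (H : IsMultiple n i h Ω g U) (hn : 6 ≤ n) (hx : x ∈ U) (a b c : Fin 4) :
    HasGrad (divWeyl g a b c) (fun e => confDivWeylDeriv i (x 2) (FeffermanODE.jet h (x 2))
      (logGrad Ω x) (if e = 2 then 1 else 0) (logHess Ω x e) a b c) x := by
  have h1 : HasGrad (fun z => fefG (z 2) (FeffermanODE.jet h (z 2)) a b)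
      (fun e => if e = 2 then fefGDeriv (FeffermanODE.jet h (x 2)) a b else 0) x :=
    HasGrad.comp_coord (φ := fun q => fefG q (FeffermanODE.jet h q) a b)
      (hasDerivAt_fefG (H.jet x hx 0 (by omega)) a b)
  refine ((((H.hasGrad_divWeylF hn hx c).const_mul (fefF a b)).add
    (h1.mul (H.hasGrad_divWeylG hn hx c))).congr_grad fun k => ?_).congr_of_eventuallyEq ?_
  · rw [confDivWeylDeriv]
    split_ifs <;> ring
  · filter_upwards [H.mem_nhds hx] with z hz using H.divWeyl_eq (by omega) hz a b c

theorem bach_eq (H : IsMultiple n i h Ω g U) (hn : 6 ≤ n) (hx : x ∈ U) (a b : Fin 4) :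
    bach g a b x = (Ω x)⁻¹ * ((2 * FeffermanODE.jet h (x 2) 1 ^ 2 * FeffermanODE.jet h (x 2) 4
      + 2 * FeffermanODE.jet h (x 2) 0 * FeffermanODE.jet h (x 2) 2 * FeffermanODE.jet h (x 2) 4
      + 4 * FeffermanODE.jet h (x 2) 0 * FeffermanODE.jet h (x 2) 1 * FeffermanODE.jet h (x 2) 5
      + FeffermanODE.jet h (x 2) 0 ^ 2 * FeffermanODE.jet h (x 2) 6) / 3
      * (vec4 (-(x 2)) 1 0 0 a * vec4 (-(x 2)) 1 0 0 b)) := by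
  have h0 := H.ne x hx
  rw [← sum_confDivWeylDeriv H.const_ne _ _ (logGrad Ω x) (logHess Ω x) (H.logHess_symm hx), bach]
  set p := x 2
  set j := FeffermanODE.jet h p
  set K := confSchouten i p j (logGrad Ω x) (logHess Ω x) with hK
  have h1 : ∀ c d, ∑ r, ∑ s, fefInverse i p j c r * fefInverse i p j d s * fefMatrix i p j r s
      = fefInverse i p j c d := by
    intro c d
    simp only [mul_assoc, ← Finset.mul_sum]
    have : ∀ r, ∑ s, fefInverse i p j d s * fefMatrix i p j r s = if d = r then 1 else 0 := by
      intro r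
      rw [← sum_fefInverse_mul_fefMatrix H.const_ne]
      exact Finset.sum_congr rfl fun s _ => by rw [fefMatrix_symm]
    simp [this]
  have h2 : ∀ c d, ∑ r, ∑ s, (g x)⁻¹ c r * (g x)⁻¹ d s * ricci g r s x
      = (Ω x)⁻¹ ^ 2 * (2 * (∑ r, ∑ s, fefInverse i p j c r * fefInverse i p j d s * K r s)
        + (∑ a, ∑ e, fefInverse i p j a e * K e a) * fefInverse i p j c d) := by
    intro c d
    rw [← h1 c d]
    simp only [Finset.mul_sum, mul_add, ← Finset.sum_add_distrib]
    refine Finset.sum_congr rfl fun r _ => Finset.sum_congr rfl fun s _ => ?_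
    rw [H.inv_apply hx, H.inv_apply hx, H.ricci_eq (by omega) hx, ← hK]
    simp only [Finset.mul_sum, Finset.sum_mul, mul_add]
    congr 1
    · ring
    · exact Finset.sum_congr rfl fun r _ => Finset.sum_congr rfl fun s _ => by ring
  -- The part of the Ricci tensor proportional to $g$ contracts to zero with the Weyl tensor. The
  -- factor $2$ in $\mathrm{Ric}=2K+\cdots$ then cancels the $1/2$ in the Bach tensor.
  have h3 : ∑ c, ∑ d, fefInverse i p j c d * fefWeyl p j a c b d = 0 := by
    have := sum_fefInverse_mul_fefWeyl i p j a b
    rw [Finset.sum_comm] at this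
    rw [← this]
    refine Finset.sum_congr rfl fun c _ => Finset.sum_congr rfl fun d _ => ?_
    rw [fefInverse_symm i p j d c, fefWeyl_swap' p j a c, fefWeyl_swap p j _ _ b d]
    ring
  rw [mul_add]
  congr 1
  · simp only [Finset.mul_sum]
    refine Finset.sum_congr rfl fun e _ => Finset.sum_congr rfl fun c _ => ?_
    rw [H.inv_apply hx, (H.hasGrad_divWeyl hn hx a c b).pd_eq]
    simp only [H.divWeyl_eq (by omega : 5 ≤ n) hx, H.christoffel_eq (by omega : 3 ≤ n) hx]
    ring
  · have h4 : ∀ c d, (∑ r, ∑ s, (g x)⁻¹ c r * (g x)⁻¹ d s * ricci g r s x) * weyl g a c b d x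
        = 2 * (Ω x)⁻¹ * ((∑ r, ∑ s, fefInverse i p j c r * fefInverse i p j d s * K r s)
            * fefWeyl p j a c b d)
          + (Ω x)⁻¹ * (∑ a, ∑ e, fefInverse i p j a e * K e a)
            * (fefInverse i p j c d * fefWeyl p j a c b d) := by
      intro c d
      rw [h2, H.weyl_eq (by omega) hx]
      change _ * (Ω x * fefWeyl p j a c b d) = _
      field_simp
    simp only [h4, Finset.sum_add_distrib, ← Finset.mul_sum, h3]
    ring

end IsMultiple

/-! ### Algebraic type and signature -/

theorem leviCivita_swap (a b c d : Fin 4) : leviCivita a b d c = -leviCivita a b c d := by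
  have h1 : (Matrix.of fun r s : Fin 4 => if ![a, b, d, c] r = s then (1 : ℝ) else 0)
      = (Matrix.of fun r s : Fin 4 => if ![a, b, c, d] r = s then (1 : ℝ) else 0).submatrix
        (Equiv.swap 2 3) id := by
    ext r s
    have h2 : ![a, b, d, c] r = ![a, b, c, d] (Equiv.swap 2 3 r) := by
      fin_cases r <;> rfl
    simp only [Matrix.of_apply, Matrix.submatrix_apply, id, h2]
  rw [leviCivita, h1, Matrix.det_permute, Equiv.Perm.sign_swap (by decide), leviCivita]
  simp

/-- Both $F$ and $G$, with indices raised, are bivectors containing $\partial_\phi$. Hence the Hodge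
star needs the Levi-Civita symbol only with one of the last two indices equal to $3$. -/
theorem leviCivita_two_three (a b : Fin 4) : leviCivita a b 2 3
    = vec4 (vec4 0 1 0 0) (vec4 (-1) 0 0 0) (vec4 0 0 0 0) (vec4 0 0 0 0) a b := by
  revert a b
  refine forall_fin_four ?_ ?_ ?_ ?_ <;> refine forall_fin_four ?_ ?_ ?_ ?_ <;>
    (rw [leviCivita, Matrix.det_succ_row_zero, Fin.sum_univ_four]
     simp [Matrix.det_fin_three, Fin.succAbove])

theorem leviCivita_one_three (a b : Fin 4) : leviCivita a b 1 3
    = vec4 (vec4 0 0 (-1) 0) (vec4 0 0 0 0) (vec4 1 0 0 0) (vec4 0 0 0 0) a b := by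
  revert a b
  refine forall_fin_four ?_ ?_ ?_ ?_ <;> refine forall_fin_four ?_ ?_ ?_ ?_ <;>
    (rw [leviCivita, Matrix.det_succ_row_zero, Fin.sum_univ_four]
     simp [Matrix.det_fin_three, Fin.succAbove])

theorem leviCivita_zero_three (a b : Fin 4) : leviCivita a b 0 3
    = vec4 (vec4 0 0 0 0) (vec4 0 0 1 0) (vec4 0 (-1) 0 0) (vec4 0 0 0 0) a b := by
  revert a b
  refine forall_fin_four ?_ ?_ ?_ ?_ <;> refine forall_fin_four ?_ ?_ ?_ ?_ <;>
    (rw [leviCivita, Matrix.det_succ_row_zero, Fin.sum_univ_four]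
     simp [Matrix.det_fin_three, Fin.succAbove])

/-- The two-form `T` with both indices raised by the Fefferman metric. -/
def raiseTwo (i p : ℝ) (j : ℕ → ℝ) (T : Fin 4 → Fin 4 → ℝ) (a b : Fin 4) : ℝ :=
  ∑ e, ∑ f, fefInverse i p j a e * fefInverse i p j b f * T e f

/-- A multiple of $\partial_p\wedge\partial_\phi$, which $F=dx\wedge dy$ annihilates; so $F$ is
null. -/
theorem raiseTwo_fefF (i p : ℝ) (j : ℕ → ℝ) (a b : Fin 4) :
    raiseTwo i p j fefF a b = -3 / 2 * i⁻¹ *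
      vec4 (vec4 0 0 0 0) (vec4 0 0 0 0) (vec4 0 0 0 1) (vec4 0 0 (-1) 0) a b := by
  revert a b
  refine forall_fin_four ?_ ?_ ?_ ?_ <;> refine forall_fin_four ?_ ?_ ?_ ?_ <;>
    simp only [raiseTwo, fefInverse, fefF, Fin.sum_univ_four, vec4_zero, vec4_one, vec4_two,
      vec4_three] <;> ring

/-- A multiple of $D\wedge\partial_\phi$ with $D=\partial_x+p\,\partial_y+h\,\partial_p$. Both
factors of $G$ vanish on $D$, so $G$ is null. -/
theorem raiseTwo_fefG (i p : ℝ) (j : ℕ → ℝ) (a b : Fin 4) :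
    raiseTwo i p j (fefG p j) a b = 3 / 2 * i⁻¹ *
      vec4 (vec4 0 0 0 1) (vec4 0 0 0 p) (vec4 0 0 0 (j 0)) (vec4 (-1) (-p) (-j 0) 0) a b := by
  revert a b
  refine forall_fin_four ?_ ?_ ?_ ?_ <;> refine forall_fin_four ?_ ?_ ?_ ?_ <;>
    simp only [raiseTwo, fefInverse, fefG, Fin.sum_univ_four, vec4_zero, vec4_one, vec4_two,
      vec4_three] <;> ring

/-- The Hodge dual of a two-form for the Fefferman metric, without the factor `|i| / i`. -/
theorem sum_leviCivita_raiseTwo_fefF (i p : ℝ) (j : ℕ → ℝ) (a b : Fin 4) :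
    ∑ e, ∑ f, leviCivita a b e f * raiseTwo i p j fefF e f = -(3 * i⁻¹) * fefF a b := by
  simp only [raiseTwo_fefF, Fin.sum_univ_four, vec4_zero, vec4_one, vec4_two, vec4_three,
    mul_zero, add_zero, zero_add, leviCivita_swap a b 2 3, leviCivita_two_three]
  rw [fefF]
  ring

theorem sum_leviCivita_raiseTwo_fefG (i p : ℝ) (j : ℕ → ℝ) (a b : Fin 4) :
    ∑ e, ∑ f, leviCivita a b e f * raiseTwo i p j (fefG p j) e f = 3 * i⁻¹ * fefG p j a b := by
  simp only [raiseTwo_fefG, Fin.sum_univ_four, vec4_zero, vec4_one, vec4_two, vec4_three,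
    mul_zero, add_zero, zero_add, leviCivita_swap a b 2 3, leviCivita_swap a b 1 3,
    leviCivita_swap a b 0 3, leviCivita_two_three, leviCivita_one_three, leviCivita_zero_three]
  revert a b
  refine forall_fin_four ?_ ?_ ?_ ?_ <;> refine forall_fin_four ?_ ?_ ?_ ?_ <;>
    simp only [fefG, vec4_zero, vec4_one, vec4_two, vec4_three] <;> ring

theorem sum_fefF_mul_raiseTwo (i p : ℝ) (j : ℕ → ℝ) :
    ∑ e, ∑ f, fefF e f * raiseTwo i p j fefF e f = 0 := by
  simp only [raiseTwo_fefF]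
  simp [fefF, Fin.sum_univ_four]

theorem sum_fefG_mul_raiseTwo (i p : ℝ) (j : ℕ → ℝ) :
    ∑ e, ∑ f, fefG p j e f * raiseTwo i p j (fefG p j) e f = 0 := by
  simp only [raiseTwo_fefG]
  simp [fefG, Fin.sum_univ_four]

theorem det_fefMatrix (i p : ℝ) (j : ℕ → ℝ) :
    (Matrix.of (fefMatrix i p j)).det = (2 / 3 * i) ^ 2 := by
  rw [Matrix.det_succ_row_zero, Fin.sum_univ_four]
  simp [Matrix.det_fin_three, Fin.succAbove, fefMatrix]
  ring

/-- Reordering of a fourfold sum. -/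
theorem sum_sum_sum_sum_comm (X : Fin 4 → Fin 4 → Fin 4 → Fin 4 → ℝ) :
    ∑ e, ∑ f, ∑ e', ∑ f', X e f e' f' = ∑ e', ∑ f', ∑ e, ∑ f, X e f e' f' := by
  have h1 : ∀ e, ∑ f, ∑ e', ∑ f', X e f e' f' = ∑ e', ∑ f', ∑ f, X e f e' f' := fun e => by
    rw [Finset.sum_comm]
    exact Finset.sum_congr rfl fun e' _ => Finset.sum_comm
  simp only [h1]
  rw [Finset.sum_comm]
  exact Finset.sum_congr rfl fun e' _ => Finset.sum_comm

namespace IsMultiple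

variable {n : ℕ} {i : ℝ} {h : ℝ → ℝ} {Ω : (Fin 4 → ℝ) → ℝ} {g : MetricField}
  {U : Set (Fin 4 → ℝ)} {x : Fin 4 → ℝ}

theorem sqrt_abs_det (H : IsMultiple n i h Ω g U) (hx : x ∈ U) :
    Real.sqrt |(g x).det| = Ω x ^ 2 * (2 / 3 * |i|) := by
  have h1 : g x = Ω x • Matrix.of (fefMatrix i (x 2) (FeffermanODE.jet h (x 2))) := by
    ext a b
    rw [H.eq x hx, Matrix.smul_apply, Matrix.of_apply, smul_eq_mul]
  rw [h1, Matrix.det_smul, det_fefMatrix, Fintype.card_fin,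
    show Ω x ^ 4 * (2 / 3 * i) ^ 2 = (Ω x ^ 2 * (2 / 3 * i)) ^ 2 by ring, abs_of_nonneg (sq_nonneg _),
    Real.sqrt_sq_eq_abs, abs_mul, abs_mul, abs_of_nonneg (sq_nonneg (Ω x)),
    abs_of_pos (by norm_num : (0 : ℝ) < 2 / 3)]

/-- Since $\sqrt{|\det(\Omega g)|}=\frac23|i|\Omega^2$ and the two raised indices give
$\Omega^{-2}$, the Hodge star acts on $F$ as $-|i|/i$ and on $G$ as $+|i|/i$. Each duality
projection therefore keeps just one of the two terms. -/
theorem weylDual_eq (H : IsMultiple n i h Ω g U) (hn : 4 ≤ n) (hx : x ∈ U) (s : ℝ)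
    (a b c d : Fin 4) :
    weylDual g s a b c d x = Ω x * FeffermanODE.jet h (x 2) 4 / 12 *
      ((1 - s * (|i| / i)) * FeffermanODE.jet h (x 2) 0 ^ 2 * (fefF a b * fefF c d)
        + (1 + s * (|i| / i)) * (fefG (x 2) (FeffermanODE.jet h (x 2)) a b
          * fefG (x 2) (FeffermanODE.jet h (x 2)) c d)) := by
  have h0 := H.ne x hx
  have hi := H.const_ne
  have hw : ∀ e f, weyl g e f c d x = _ := fun e f => H.weyl_eq hn hx e f c d
  have h1 : ∑ e, ∑ f, ∑ e', ∑ f', Real.sqrt |(g x).det| * leviCivita a b e' f' * (g x)⁻¹ e' e *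
      (g x)⁻¹ f' f * weyl g e f c d x
      = Ω x * (2 / 3 * |i|) * (FeffermanODE.jet h (x 2) 4 / 6) * (FeffermanODE.jet h (x 2) 0 ^ 2 *
          fefF c d * (∑ e', ∑ f', leviCivita a b e' f' *
            raiseTwo i (x 2) (FeffermanODE.jet h (x 2)) fefF e' f')
        + fefG (x 2) (FeffermanODE.jet h (x 2)) c d * (∑ e', ∑ f', leviCivita a b e' f' *
            raiseTwo i (x 2) (FeffermanODE.jet h (x 2))
              (fefG (x 2) (FeffermanODE.jet h (x 2))) e' f')) := by
    rw [sum_sum_sum_sum_comm]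
    simp only [raiseTwo, Finset.mul_sum, ← Finset.sum_add_distrib]
    refine Finset.sum_congr rfl fun e' _ => Finset.sum_congr rfl fun f' _ =>
      Finset.sum_congr rfl fun e _ => Finset.sum_congr rfl fun f _ => ?_
    rw [H.sqrt_abs_det hx, H.inv_apply hx, H.inv_apply hx, hw, fefWeyl]
    field_simp
    try ring
  rw [weylDual, h1, sum_leviCivita_raiseTwo_fefF, sum_leviCivita_raiseTwo_fefG, hw, fefWeyl]
  field_simp
  ring

/-- The endomorphism $k\,T\otimes T$ squares to a multiple of $\langle T,T\rangle\,T\otimes T$,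
which vanishes for null $T$. -/
theorem hasPetrovTypeN_of_eq (H : IsMultiple n i h Ω g U) (hx : x ∈ U) {s k : ℝ} (hk : k ≠ 0)
    {T : Fin 4 → Fin 4 → ℝ} (hT : ∃ a b, T a b ≠ 0)
    (hnull : ∑ e, ∑ f, T e f * raiseTwo i (x 2) (FeffermanODE.jet h (x 2)) T e f = 0)
    (hw : ∀ a b c d, weylDual g s a b c d x = k * (T a b * T c d)) : HasPetrovTypeN g s x := by
  constructor
  · obtain ⟨a, b, hab⟩ := hT
    exact ⟨a, b, a, b, by rw [hw]; positivity⟩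
  · intro a b c d
    have h1 : ∑ e, ∑ f, ∑ e', ∑ f', weylDual g s a b e f x * (g x)⁻¹ e e' * (g x)⁻¹ f f' *
        weylDual g s e' f' c d x = k ^ 2 * (Ω x)⁻¹ ^ 2 * T a b * T c d *
          ∑ e, ∑ f, T e f * raiseTwo i (x 2) (FeffermanODE.jet h (x 2)) T e f := by
      simp only [raiseTwo, Finset.mul_sum]
      refine Finset.sum_congr rfl fun e _ => Finset.sum_congr rfl fun f _ =>
        Finset.sum_congr rfl fun e' _ => Finset.sum_congr rfl fun f' _ => ?_
      rw [hw, hw, H.inv_apply hx, H.inv_apply hx]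
      ring
    rw [h1, hnull, mul_zero]

theorem hasTypeNN (H : IsMultiple n i h Ω g U) (hn : 4 ≤ n) (hx : x ∈ U)
    (h0 : FeffermanODE.jet h (x 2) 0 ≠ 0) (h4 : FeffermanODE.jet h (x 2) 4 ≠ 0) :
    HasTypeNN g x := by
  have hi := H.const_ne
  have hF : ∀ s : ℝ, s * (|i| / i) = -1 → HasPetrovTypeN g s x := by
    intro s hs
    refine H.hasPetrovTypeN_of_eq hx (k := Ω x * FeffermanODE.jet h (x 2) 4 / 6 *
      FeffermanODE.jet h (x 2) 0 ^ 2) ?_ (T := fefF) ⟨0, 1, by simp [fefF]⟩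
      (sum_fefF_mul_raiseTwo _ _ _) fun a b c d => ?_
    · have := H.ne x hx
      positivity
    · rw [H.weylDual_eq hn hx, hs]
      ring
  have hG : ∀ s : ℝ, s * (|i| / i) = 1 → HasPetrovTypeN g s x := by
    intro s hs
    refine H.hasPetrovTypeN_of_eq hx (k := Ω x * FeffermanODE.jet h (x 2) 4 / 6) ?_
      (T := fefG (x 2) (FeffermanODE.jet h (x 2))) ⟨1, 2, by simp [fefG]⟩
      (sum_fefG_mul_raiseTwo _ _ _) fun a b c d => ?_
    · have := H.ne x hx
      positivity
    · rw [H.weylDual_eq hn hx, hs]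
      ring
  -- The sign of $i$ decides which of $F$ and $G$ is self-dual.
  rcases lt_or_gt_of_ne hi with h | h
  · have : |i| / i = -1 := by rw [abs_of_neg h]; field_simp
    exact ⟨hF 1 (by rw [this]; ring), hG (-1) (by rw [this]; ring)⟩
  · have : |i| / i = 1 := by rw [abs_of_pos h]; field_simp
    exact ⟨hG 1 (by rw [this]; ring), hF (-1) (by rw [this]; ring)⟩

theorem hasSplitSignature (H : IsMultiple n i h Ω g U) (hx : x ∈ U) :
    HasSplitSignature (g x) := by
  have h0 := H.ne x hx
  have hi := H.const_ne
  set p := x 2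
  set j := FeffermanODE.jet h p
  set r := Ω x
  have hg : ∀ a b, g x a b = r * fefMatrix i p j a b := H.eq x hx
  -- Invertibility of `A` is automatic, because the diagonal matrix has determinant $1$.
  have key : ∀ A : Matrix (Fin 4) (Fin 4) ℝ,
      A.transpose * g x * A = Matrix.diagonal ![1, 1, -1, -1] → HasSplitSignature (g x) := by
    intro A hA
    refine ⟨A, isUnit_iff_ne_zero.mpr fun h => ?_, hA⟩
    have := congrArg Matrix.det hA
    rw [Matrix.det_mul, Matrix.det_mul, Matrix.det_diagonal, Fin.prod_univ_four, h] at this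
    simp at this
  -- The columns are sums and differences in two hyperbolic planes. Columns 0 and 2 are
  -- $\partial_x+p\,\partial_y+h\,\partial_p-\frac{h'}i\partial_\phi\pm\frac1{2r}\partial_p$;
  -- columns 1 and 3 are $\partial_y-\frac{h''}{4i}\partial_\phi\mp\frac3{4ir}\partial_\phi$.
  refine key (Matrix.of (vec4 (vec4 1 0 1 0) (vec4 p 1 p 1)
    (vec4 (j 0 + 1 / (2 * r)) 0 (j 0 - 1 / (2 * r)) 0)
    (vec4 (-j 1 / i) (-j 2 / (4 * i) - 3 / (4 * i * r)) (-j 1 / i)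
      (-j 2 / (4 * i) + 3 / (4 * i * r))))) ?_
  ext a b
  simp only [Matrix.mul_apply, Matrix.transpose_apply, Matrix.of_apply, Fin.sum_univ_four, hg,
    Matrix.diagonal_apply]
  revert a b
  refine forall_fin_four ?_ ?_ ?_ ?_ <;> refine forall_fin_four ?_ ?_ ?_ ?_ <;>
    simp [fefMatrix] <;> field_simp <;> ring

end IsMultiple

/-! ### Conformal factors of Einstein metrics -/

namespace IsMultiple

variable {n : ℕ} {i : ℝ} {h : ℝ → ℝ} {Ω σ : (Fin 4 → ℝ) → ℝ} {ε : ℝ} {g : MetricField}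
  {U : Set (Fin 4 → ℝ)} {x : Fin 4 → ℝ}

theorem mono {V : Set (Fin 4 → ℝ)} (H : IsMultiple n i h Ω g U) (hV : IsOpen V) (hVU : V ⊆ U) :
    IsMultiple n i h Ω g V :=
  ⟨H.const_ne, hV, H.smooth.mono hVU, fun x hx => H.ne x (hVU hx), fun x hx => H.eq x (hVU hx),
    fun x hx => H.jet x (hVU hx)⟩

/-- Differentiate $\Omega\sigma^2=\varepsilon$. The constant $\varepsilon$ carries the sign of
$\Omega$, since $\sigma^{-2}$ is always positive. -/
theorem logGrad_eq (H : IsMultiple n i h Ω g U) (hσ : ContDiffOn ℝ ∞ σ U)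
    (hε : ε ≠ 0) (hΩ : ∀ x ∈ U, Ω x * σ x ^ 2 = ε) (hx : x ∈ U) (a : Fin 4) :
    logGrad Ω x a = -pd a σ x / σ x := by
  have hd : HasGrad σ (fun k => pd k σ x) x :=
    ⟨(hσ.contDiffAt (H.mem_nhds hx)).differentiableAt (by simp), fun _ => rfl⟩
  have h1 : HasGrad (fun z => Ω z * (σ z * σ z)) (fun _ => 0) x := by
    refine (HasGrad.const ε).congr_of_eventuallyEq ?_
    filter_upwards [H.mem_nhds hx] with z hz
    rw [← hΩ z hz]
    ring
  have h2 := h1.unique ((H.hasGrad_factor hx).mul (hd.mul hd)) a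
  have h3 : σ x ≠ 0 := fun h0 => hε (by
    rw [← hΩ x hx, h0]
    ring)
  have h4 := H.ne x hx
  field_simp
  have h5 : Ω x * σ x * 2 * (logGrad Ω x a * σ x + pd a σ x) = 0 := by
    linear_combination -h2
  have h6 : Ω x * σ x * 2 ≠ 0 := by positivity
  linear_combination (mul_eq_zero.mp h5).resolve_left h6

theorem logHess_eq (H : IsMultiple n i h Ω g U) (hσ : ContDiffOn ℝ ∞ σ U)
    (hε : ε ≠ 0) (hΩ : ∀ x ∈ U, Ω x * σ x ^ 2 = ε) (hx : x ∈ U) (k a : Fin 4) :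
    logHess Ω x k a = -pd k (pd a σ) x / σ x + pd k σ x * pd a σ x / σ x ^ 2 := by
  have hd : HasGrad σ (fun k => pd k σ x) x :=
    ⟨(hσ.contDiffAt (H.mem_nhds hx)).differentiableAt (by simp), fun _ => rfl⟩
  have hd' : HasGrad (pd a σ) (fun k => pd k (pd a σ) x) x :=
    ⟨((contDiffOn_pd H.isOpen hσ a).contDiffAt (H.mem_nhds hx)).differentiableAt (by simp),
      fun _ => rfl⟩
  have h1 : HasGrad (fun z => logGrad Ω z a * σ z) (fun k => -pd k (pd a σ) x) x := by
    refine hd'.neg.congr_of_eventuallyEq ?_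
    filter_upwards [H.mem_nhds hx] with z hz
    rw [H.logGrad_eq hσ hε hΩ hz]
    refine div_mul_cancel₀ _ fun h0 => hε ?_
    rw [← hΩ z hz, h0]
    ring
  have h2 := h1.unique ((H.hasGrad_logGrad hx a).mul hd) k
  have h3 : σ x ≠ 0 := fun h0 => hε (by
    rw [← hΩ x hx, h0]
    ring)
  rw [H.logGrad_eq hσ hε hΩ hx] at h2
  field_simp at h2 ⊢
  linear_combination -h2

/-- The equation for the scale `σ` of an Einstein metric `σ⁻² g`. -/
theorem exists_hessian_eq (H : IsMultiple n i h Ω g U) (hn : 4 ≤ n) (hσ : ContDiffOn ℝ ∞ σ U)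
    (hε : ε ≠ 0) (hΩ : ∀ x ∈ U, Ω x * σ x ^ 2 = ε) (hE : IsEinsteinOn g U) (hx : x ∈ U) :
    ∃ μ : ℝ, ∀ a b, pd a (pd b σ) x
      - ∑ c, fefChristoffel i (x 2) (FeffermanODE.jet h (x 2)) c a b * pd c σ x
      + fefSchouten i (x 2) (FeffermanODE.jet h (x 2)) a b * σ x
      = μ * fefMatrix i (x 2) (FeffermanODE.jet h (x 2)) a b := by
  obtain ⟨Λ, hΛ⟩ := hE
  have h3 : σ x ≠ 0 := fun h0 => hε (by
    rw [← hΩ x hx, h0]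
    ring)
  -- The Einstein equation says that `confSchouten` is $\frac12(\Lambda\Omega-\operatorname{tr})g$;
  -- the term $\frac12|u|^2g$ is moved to this side and everything is multiplied by $\sigma$.
  refine ⟨σ x * ((Λ * Ω x - ∑ a, ∑ e, fefInverse i (x 2) (FeffermanODE.jet h (x 2)) a e *
    confSchouten i (x 2) (FeffermanODE.jet h (x 2)) (logGrad Ω x) (logHess Ω x) e a) / 2
    + (1 / 2) * (∑ e, logGrad Ω x e *
      fefRaise i (x 2) (FeffermanODE.jet h (x 2)) (logGrad Ω x) e)), fun a b => ?_⟩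
  have h1 := hΛ x hx a b
  rw [H.ricci_eq hn hx, H.eq x hx] at h1
  have h2 : confSchouten i (x 2) (FeffermanODE.jet h (x 2)) (logGrad Ω x) (logHess Ω x) a b
      = fefSchouten i (x 2) (FeffermanODE.jet h (x 2)) a b + pd a (pd b σ) x / σ x
        - (∑ c, fefChristoffel i (x 2) (FeffermanODE.jet h (x 2)) c a b * pd c σ x) / σ x
        - (1 / 2) * (∑ e, logGrad Ω x e *
          fefRaise i (x 2) (FeffermanODE.jet h (x 2)) (logGrad Ω x) e)
          * fefMatrix i (x 2) (FeffermanODE.jet h (x 2)) a b := by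
    have h4 : ∑ c, fefChristoffel i (x 2) (FeffermanODE.jet h (x 2)) c a b * logGrad Ω x c
        = -(∑ c, fefChristoffel i (x 2) (FeffermanODE.jet h (x 2)) c a b * pd c σ x) / σ x := by
      rw [← Finset.sum_neg_distrib, Finset.sum_div]
      refine Finset.sum_congr rfl fun c _ => ?_
      rw [H.logGrad_eq hσ hε hΩ hx]
      ring
    rw [confSchouten, h4, H.logHess_eq hσ hε hΩ hx, H.logGrad_eq hσ hε hΩ hx a,
      H.logGrad_eq hσ hε hΩ hx b]
    field_simp
    ring
  set S := ∑ e, logGrad Ω x e * fefRaise i (x 2) (FeffermanODE.jet h (x 2)) (logGrad Ω x) e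
  set R := ∑ c, fefChristoffel i (x 2) (FeffermanODE.jet h (x 2)) c a b * pd c σ x
  set T := ∑ a, ∑ e, fefInverse i (x 2) (FeffermanODE.jet h (x 2)) a e *
    confSchouten i (x 2) (FeffermanODE.jet h (x 2)) (logGrad Ω x) (logHess Ω x) e a
  have h5 : confSchouten i (x 2) (FeffermanODE.jet h (x 2)) (logGrad Ω x) (logHess Ω x) a b
      = (Λ * Ω x - T) / 2 * fefMatrix i (x 2) (FeffermanODE.jet h (x 2)) a b := by
    linear_combination h1 / 2
  rw [h2] at h5
  field_simp at h5
  linear_combination h5 / 2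

/-- Prolongation: the components of the Hessian equation are differentiated until only conditions on
$h$ remain. The chain is $3\sigma_\phi+i\sigma=0$, $\sigma_p=0$,
$\sigma_x+p\sigma_y+\frac13h'\sigma=0$, $\sigma_y+\frac13h''\sigma=0$, $h'''=0$. -/
theorem false_of_hessian_eq (H : IsMultiple n i h Ω g U) (hn : 5 ≤ n) (hσ : ContDiffOn ℝ ∞ σ U)
    (hσ0 : ∀ x ∈ U, σ x ≠ 0)
    (hE : ∀ x ∈ U, ∃ μ : ℝ, ∀ a b, pd a (pd b σ) x
      - ∑ c, fefChristoffel i (x 2) (FeffermanODE.jet h (x 2)) c a b * pd c σ x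
      + fefSchouten i (x 2) (FeffermanODE.jet h (x 2)) a b * σ x
      = μ * fefMatrix i (x 2) (FeffermanODE.jet h (x 2)) a b)
    (h0 : ∀ x ∈ U, FeffermanODE.jet h (x 2) 0 ≠ 0) (h4 : ∀ x ∈ U, FeffermanODE.jet h (x 2) 4 ≠ 0)
    (hx : x ∈ U) : False := by
  have hi := H.const_ne
  have hs : ∀ f : (Fin 4 → ℝ) → ℝ, ContDiffOn ℝ ∞ f U → ∀ z ∈ U,
      HasGrad f (fun k => pd k f z) z := fun f hf z hz =>
    ⟨(hf.contDiffAt (H.mem_nhds hz)).differentiableAt (by simp), fun _ => rfl⟩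
  have hc : ∀ f : (Fin 4 → ℝ) → ℝ, ContDiffOn ℝ ∞ f U → ∀ z ∈ U, ∀ a b,
      pd a (pd b f) z = pd b (pd a f) z := fun f hf z hz a b =>
    pd_comm (contDiffAt_infty.1 (hf.contDiffAt (H.mem_nhds hz)) 2) a b
  have s1 := fun a => contDiffOn_pd H.isOpen hσ a
  have s2 := fun a b => contDiffOn_pd H.isOpen (s1 b) a
  have hz0 : ∀ {f : (Fin 4 → ℝ) → ℝ} {F : Fin 4 → ℝ} {z : Fin 4 → ℝ}, z ∈ U → HasGrad f F z →
      (∀ y ∈ U, f y = 0) → ∀ k, F k = 0 := by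
    intro f F z hz hf hf0 k
    refine hf.unique ((HasGrad.const 0).congr_of_eventuallyEq ?_) k
    filter_upwards [H.mem_nhds hz] with y hy using hf0 y hy
  have e22 : ∀ z ∈ U, pd 2 (pd 2 σ) z = 0 := by
    intro z hz
    obtain ⟨μ, hμ⟩ := hE z hz
    simpa [Fin.sum_univ_four, fefChristoffel, fefSchouten, fefMatrix] using hμ 2 2
  have e23 : ∀ z ∈ U, pd 2 (pd 3 σ) z = i / 3 * pd 2 σ z := by
    intro z hz
    obtain ⟨μ, hμ⟩ := hE z hz
    have := hμ 2 3
    simp only [Fin.sum_univ_four, fefChristoffel, fefSchouten, fefMatrix, vec4_zero, vec4_one,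
      vec4_two, vec4_three] at this
    linear_combination this
  have e12 : ∀ z ∈ U, i * pd 1 (pd 2 σ) z + i / 6 * (FeffermanODE.jet h (z 2) 2 * pd 2 σ z)
      - 1 / 4 * (FeffermanODE.jet h (z 2) 3 * pd 3 σ z)
      - i / 12 * (FeffermanODE.jet h (z 2) 3 * σ z) = 0 := by
    intro z hz
    obtain ⟨μ, hμ⟩ := hE z hz
    have := hμ 1 2
    simp only [Fin.sum_univ_four, fefChristoffel, fefSchouten, fefMatrix, vec4_zero, vec4_one,
      vec4_two, vec4_three] at this
    field_simp at this
    -- The large divisors here and below only undo the clearing of denominators by `field_simp`.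
    linear_combination this / 288
  have j1 := fun z hz => H.hasGrad_jet (x := z) hz (by omega : 1 < n)
  have j2 := fun z hz => H.hasGrad_jet (x := z) hz (by omega : 2 < n)
  have j3 := fun z hz => H.hasGrad_jet (x := z) hz (by omega : 3 < n)
  -- Differentiating `e12` in $p$, with `e22` and `e23`, cancels the terms in $h'''\sigma_p$ and
  -- leaves $h''''(3\sigma_\phi+i\sigma)=0$.
  have e3 : ∀ z ∈ U, 3 * pd 3 σ z + i * σ z = 0 := by
    intro z hz
    have t1 : pd 2 (pd 1 (pd 2 σ)) z = 0 := by
      rw [hc _ (s1 2) z hz]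
      exact hz0 hz (hs _ (s2 2 2) z hz) e22 1
    have t2 := hz0 hz (((((hs _ (s2 1 2) z hz).const_mul i).add
      (((j2 z hz).mul (hs _ (s1 2) z hz)).const_mul (i / 6))).sub
      (((j3 z hz).mul (hs _ (s1 3) z hz)).const_mul (1 / 4))).sub
      (((j3 z hz).mul (hs _ hσ z hz)).const_mul (i / 12))) e12 2
    simp only [if_true, t1, e22 z hz, e23 z hz] at t2
    have t3 : FeffermanODE.jet h (z 2) 4 * (3 * pd 3 σ z + i * σ z) = 0 := by
      linear_combination -12 * t2
    exact (mul_eq_zero.mp t3).resolve_left (h4 z hz)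
  -- The $p$-derivative of `e3` is $2i\sigma_p=0$ by `e23`.
  have e2 : ∀ z ∈ U, pd 2 σ z = 0 := by
    intro z hz
    have t1 := hz0 hz (((hs _ (s1 3) z hz).const_mul 3).add ((hs _ hσ z hz).const_mul i)) e3 2
    simp only [e23 z hz] at t1
    have t2 : i * pd 2 σ z = 0 := by linear_combination t1 / 2
    exact (mul_eq_zero.mp t2).resolve_left hi
  have e2' : ∀ z ∈ U, ∀ a, pd a (pd 2 σ) z = 0 := fun z hz => hz0 hz (hs _ (s1 2) z hz) e2
  -- The $(x,p)$ component determines the multiplier $\mu$, which can then be eliminated from the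
  -- remaining equations.
  have e02 : ∀ z ∈ U, ∀ μ : ℝ, (∀ a b, pd a (pd b σ) z
      - ∑ c, fefChristoffel i (z 2) (FeffermanODE.jet h (z 2)) c a b * pd c σ z
      + fefSchouten i (z 2) (FeffermanODE.jet h (z 2)) a b * σ z
      = μ * fefMatrix i (z 2) (FeffermanODE.jet h (z 2)) a b) →
      μ = 1 / 2 * pd 1 σ z + FeffermanODE.jet h (z 2) 2 / 24 * σ z := by
    intro z hz μ hμ
    have t1 := hμ 0 2
    have t2 : pd 3 σ z = -(i * σ z) / 3 := by linear_combination e3 z hz / 3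
    simp only [Fin.sum_univ_four, fefChristoffel, fefSchouten, fefMatrix, vec4_zero, vec4_one,
      vec4_two, vec4_three, e2' z hz, e2 z hz, t2] at t1
    field_simp at t1
    linear_combination -t1 / 13824
  have j0 := fun z hz => H.hasGrad_jet (x := z) hz (by omega : 0 < n)
  have j4 := fun z hz => H.hasGrad_jet (x := z) hz (by omega : 4 < n)
  have e33 : ∀ z ∈ U, pd 3 σ z = -(i * σ z) / 3 := fun z hz => by
    linear_combination e3 z hz / 3
  have e11 : ∀ z ∈ U, 1 / 6 * (FeffermanODE.jet h (z 2) 0 * (FeffermanODE.jet h (z 2) 4 * σ z))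
      + 1 / 9 * (FeffermanODE.jet h (z 2) 1 * (FeffermanODE.jet h (z 2) 3 * σ z))
      + 1 / 6 * (FeffermanODE.jet h (z 2) 2 * pd 1 σ z)
      - 1 / 18 * (FeffermanODE.jet h (z 2) 2 * (FeffermanODE.jet h (z 2) 2 * σ z))
      - 1 / 6 * (FeffermanODE.jet h (z 2) 3 * (pd 0 σ z + z 2 * pd 1 σ z))
      + pd 1 (pd 1 σ) z = 0 := by
    intro z hz
    obtain ⟨μ, hμ⟩ := hE z hz
    have t1 := hμ 1 1
    rw [e02 z hz μ hμ] at t1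
    simp only [Fin.sum_univ_four, fefChristoffel, fefSchouten, fefMatrix, vec4_zero, vec4_one,
      vec4_two, vec4_three, e2 z hz, e33 z hz] at t1
    field_simp at t1
    linear_combination t1 / 62208
  -- The Hessian equation on the pair $\partial_x+p\,\partial_y$, $\partial_y$; `e00` is its value
  -- on $\partial_x+p\,\partial_y$ twice. This frame removes most of the explicit $p$.
  have e01 : ∀ z ∈ U, pd 0 (pd 1 σ) z + z 2 * pd 1 (pd 1 σ) z
      + 1 / 6 * (FeffermanODE.jet h (z 2) 0 * (FeffermanODE.jet h (z 2) 3 * σ z))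
      - 1 / 18 * (FeffermanODE.jet h (z 2) 1 * (FeffermanODE.jet h (z 2) 2 * σ z))
      + 1 / 3 * (FeffermanODE.jet h (z 2) 1 * pd 1 σ z)
      - 1 / 6 * (FeffermanODE.jet h (z 2) 2 * (pd 0 σ z + z 2 * pd 1 σ z)) = 0 := by
    intro z hz
    obtain ⟨μ, hμ⟩ := hE z hz
    have t1 := hμ 0 1
    rw [e02 z hz μ hμ] at t1
    simp only [Fin.sum_univ_four, fefChristoffel, fefSchouten, fefMatrix, vec4_zero, vec4_one,
      vec4_two, vec4_three, e2 z hz, e33 z hz] at t1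
    field_simp at t1
    linear_combination t1 / 2239488 + z 2 * e11 z hz
  have e00 : ∀ z ∈ U, pd 0 (pd 0 σ) z + 2 * z 2 * pd 0 (pd 1 σ) z + z 2 ^ 2 * pd 1 (pd 1 σ) z
      + FeffermanODE.jet h (z 2) 0 * FeffermanODE.jet h (z 2) 2 * σ z / 3
      + FeffermanODE.jet h (z 2) 0 * pd 1 σ z
      - FeffermanODE.jet h (z 2) 1 * (pd 0 σ z + z 2 * pd 1 σ z) / 3
      - 2 / 9 * FeffermanODE.jet h (z 2) 1 ^ 2 * σ z = 0 := by
    intro z hz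
    obtain ⟨μ, hμ⟩ := hE z hz
    have t1 := hμ 0 0
    rw [e02 z hz μ hμ] at t1
    simp only [Fin.sum_univ_four, fefChristoffel, fefSchouten, fefMatrix, vec4_zero, vec4_one,
      vec4_two, vec4_three, e2 z hz, e33 z hz] at t1
    field_simp at t1
    linear_combination t1 / 120932352 + 2 * z 2 * e01 z hz - z 2 ^ 2 * e11 z hz
  have gA := fun z hz =>
    (hs _ (s1 0) z hz).add ((hasGrad_coord 2 z).mul (hs _ (s1 1) z hz))
  -- Integrability: $\partial_y$ of `e01` minus $(\partial_x+p\,\partial_y)$ of `e11` cancels the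
  -- third derivatives. Modulo the second-order equations the rest is $hh''''$ times this
  -- expression; here $h\ne0$ is needed.
  have eA : ∀ z ∈ U, pd 0 σ z + z 2 * pd 1 σ z + 1 / 3 * (FeffermanODE.jet h (z 2) 1 * σ z)
      = 0 := by
    intro z hz
    have d11 := hz0 hz ((((((((j0 z hz).mul ((j4 z hz).mul (hs _ hσ z hz))).const_mul (1 / 6)).add
      (((j1 z hz).mul ((j3 z hz).mul (hs _ hσ z hz))).const_mul (1 / 9))).add
      (((j2 z hz).mul (hs _ (s1 1) z hz)).const_mul (1 / 6))).sub
      (((j2 z hz).mul ((j2 z hz).mul (hs _ hσ z hz))).const_mul (1 / 18))).sub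
      (((j3 z hz).mul (gA z hz)).const_mul (1 / 6))).add (hs _ (s2 1 1) z hz)) e11
    have d01 := hz0 hz (((((((hs _ (s2 0 1) z hz).add
      ((hasGrad_coord 2 z).mul (hs _ (s2 1 1) z hz))).add
      (((j0 z hz).mul ((j3 z hz).mul (hs _ hσ z hz))).const_mul (1 / 6))).sub
      (((j1 z hz).mul ((j2 z hz).mul (hs _ hσ z hz))).const_mul (1 / 18))).add
      (((j1 z hz).mul (hs _ (s1 1) z hz)).const_mul (1 / 3))).sub
      (((j2 z hz).mul (gA z hz)).const_mul (1 / 6)))) e01 1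
    have d110 := d11 0
    have d111 := d11 1
    simp only [Fin.reduceEq, if_false, hc _ (s1 1) z hz 1 0, hc _ hσ z hz 1 0] at d01 d110 d111
    have t3 : FeffermanODE.jet h (z 2) 0 * FeffermanODE.jet h (z 2) 4 *
        (pd 0 σ z + z 2 * pd 1 σ z + 1 / 3 * (FeffermanODE.jet h (z 2) 1 * σ z)) = 0 := by
      linear_combination -6 * (d01 - d110 - z 2 * d111
        + FeffermanODE.jet h (z 2) 2 / 3 * e01 z hz - FeffermanODE.jet h (z 2) 1 / 3 * e11 z hz
        - FeffermanODE.jet h (z 2) 3 / 6 * e00 z hz)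
    exact (mul_eq_zero.mp t3).resolve_left (mul_ne_zero (h0 z hz) (h4 z hz))
  -- Since $\sigma_p=0$, each $p$-derivative acts only on the coefficients: `eA` gives `eB`, and
  -- `eB` gives $h'''\sigma=0$.
  have eB : ∀ z ∈ U, pd 1 σ z + 1 / 3 * (FeffermanODE.jet h (z 2) 2 * σ z) = 0 := by
    intro z hz
    have d := hz0 hz ((gA z hz).add (((j1 z hz).mul (hs _ hσ z hz)).const_mul (1 / 3))) eA 2
    simp only [if_true, hc _ hσ z hz 2 0, hc _ hσ z hz 2 1, e2' z hz, e2 z hz] at d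
    linear_combination d
  have eC : ∀ z ∈ U, FeffermanODE.jet h (z 2) 3 = 0 := by
    intro z hz
    have d := hz0 hz ((hs _ (s1 1) z hz).add
      (((j2 z hz).mul (hs _ hσ z hz)).const_mul (1 / 3))) eB 2
    simp only [if_true, hc _ hσ z hz 2 1, e2' z hz, e2 z hz] at d
    have t : FeffermanODE.jet h (z 2) 3 * σ z = 0 := by linear_combination 3 * d
    exact (mul_eq_zero.mp t).resolve_right (hσ0 z hz)
  exact h4 x hx (by simpa using hz0 hx (j3 x hx) eC 2)

end IsMultiple

namespace IsMultiple

variable {n : ℕ} {i : ℝ} {h : ℝ → ℝ} {Ω σ : (Fin 4 → ℝ) → ℝ} {ε : ℝ} {g : MetricField}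
  {U : Set (Fin 4 → ℝ)} {x : Fin 4 → ℝ}

theorem jet_succ_eq_zero (H : IsMultiple n i h Ω g U) {k : ℕ} (hk : k < n)
    (h0 : ∀ x ∈ U, FeffermanODE.jet h (x 2) k = 0) (hx : x ∈ U) :
    FeffermanODE.jet h (x 2) (k + 1) = 0 := by
  have := (H.hasGrad_jet hx hk).unique ((HasGrad.const 0).congr_of_eventuallyEq (by
    filter_upwards [H.mem_nhds hx] with y hy using h0 y hy)) 2
  simpa using this

theorem continuousOn_jet (H : IsMultiple n i h Ω g U) {k : ℕ} (hk : k < n) :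
    ContinuousOn (fun z => FeffermanODE.jet h (z 2) k) U :=
  fun _ hx => (H.hasGrad_jet hx hk).diff.continuousAt.continuousWithinAt

/-- An Einstein metric in the conformal class forces `h'''' = 0`. -/
theorem jet_four_eq_zero (H : IsMultiple n i h Ω g U) (hn : 5 ≤ n) (hσ : ContDiffOn ℝ ∞ σ U)
    (hε : ε ≠ 0) (hΩ : ∀ x ∈ U, Ω x * σ x ^ 2 = ε) (hE : IsEinsteinOn g U) (hx : x ∈ U) :
    FeffermanODE.jet h (x 2) 4 = 0 := by
  by_contra h4
  have hopen : ∀ {k : ℕ} {V : Set (Fin 4 → ℝ)}, IsOpen V → V ⊆ U → k < n →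
      IsOpen {z ∈ V | FeffermanODE.jet h (z 2) k ≠ 0} := fun hV hVU hk =>
    ((H.continuousOn_jet hk).mono hVU).isOpen_inter_preimage hV isOpen_ne
  have hV := hopen H.isOpen le_rfl (show 4 < n by omega)
  have hW := hopen hV (fun z hz => hz.1) (show 0 < n by omega)
  have HV := H.mono hV fun z hz => hz.1
  -- Either $h\ne0$ somewhere in the open set where $h''''\ne0$, and the prolongation applies there,
  -- or $h=0$ on that open set and differentiating four times gives $h''''=0$ on it.
  by_cases hne : ∃ y ∈ U, FeffermanODE.jet h (y 2) 4 ≠ 0 ∧ FeffermanODE.jet h (y 2) 0 ≠ 0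
  · obtain ⟨y, hy, hy4, hy0⟩ := hne
    refine (H.mono hW fun z hz => hz.1.1).false_of_hessian_eq hn (hσ.mono fun z hz => hz.1.1)
      (fun z hz h0 => hε ?_) (fun z hz => H.exists_hessian_eq (by omega) hσ hε hΩ hE hz.1.1)
      (fun z hz => hz.2) (fun z hz => hz.1.2) (x := y) ⟨⟨hy, hy4⟩, hy0⟩
    rw [← hΩ z hz.1.1, h0]
    ring
  · push Not at hne
    have t0 : ∀ z ∈ {z ∈ U | FeffermanODE.jet h (z 2) 4 ≠ 0}, FeffermanODE.jet h (z 2) 0 = 0 :=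
      fun z hz => hne z hz.1 hz.2
    have t1 := fun z hz => HV.jet_succ_eq_zero (x := z) (by omega) t0 hz
    have t2 := fun z hz => HV.jet_succ_eq_zero (x := z) (by omega) t1 hz
    have t3 := fun z hz => HV.jet_succ_eq_zero (x := z) (by omega) t2 hz
    exact h4 (HV.jet_succ_eq_zero (by omega) t3 ⟨hx, h4⟩)

end IsMultiple

/-! ### The jet of a differentiable function -/

theorem hasDerivAt_jet {n : ℕ} {h : ℝ → ℝ} {I : Set ℝ} (hI : IsOpen I) (hh : ContDiffOn ℝ n h I)
    {p : ℝ} (hp : p ∈ I) {k : ℕ} (hk : k < n) :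
    HasDerivAt (fun q => jet h q k) (jet h p (k + 1)) p := by
  have h1 : DifferentiableWithinAt ℝ (iteratedDerivWithin k h I) I p :=
    hh.differentiableOn_iteratedDerivWithin (by exact_mod_cast hk) hI.uniqueDiffOn p hp
  have h2 : DifferentiableAt ℝ (iteratedDeriv k h) p :=
    (h1.differentiableAt (hI.mem_nhds hp)).congr_of_eventuallyEq (by
      filter_upwards [hI.mem_nhds hp] with q hq
      exact (iteratedDerivWithin_of_isOpen hI hq).symm)
  have h3 := h2.hasDerivAt
  rwa [← iteratedDeriv_succ] at h3

theorem pd_coord {n : ℕ} {φ : ℝ → ℝ} {φ' : ℝ} {m : Fin n} {z : Fin n → ℝ}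
    (hφ : HasDerivAt φ φ' (z m)) (k : Fin n) :
    pd k (fun z => φ (z m)) z = if k = m then φ' else 0 :=
  (HasGrad.comp_coord hφ).pd_eq k

theorem pd_congr_of_eventuallyEq {n : ℕ} {f g : (Fin n → ℝ) → ℝ} {z : Fin n → ℝ}
    (h : f =ᶠ[nhds z] g) (k : Fin n) : pd k f z = pd k g z := by
  rw [pd, pd, h.fderiv_eq]

theorem eventually_coord_mem {n : ℕ} {I : Set ℝ} (hI : IsOpen I) {m : Fin n} {z : Fin n → ℝ}
    (hz : z m ∈ I) : ∀ᶠ y in nhds z, y m ∈ I :=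
  (continuous_apply m).continuousAt.eventually (hI.mem_nhds hz)

/-- The partial derivative of a function that is locally a function of one coordinate. -/
theorem pd_eq_of_eqOn {n : ℕ} {f : (Fin n → ℝ) → ℝ} {φ φ' : ℝ → ℝ} {I : Set ℝ} (hI : IsOpen I)
    {m : Fin n} (hf : ∀ z : Fin n → ℝ, z m ∈ I → f z = φ (z m))
    (hφ : ∀ p ∈ I, HasDerivAt φ (φ' p) p) (k : Fin n) {z : Fin n → ℝ} (hz : z m ∈ I) :
    pd k f z = if k = m then φ' (z m) else 0 := by
  rw [pd_congr_of_eventuallyEq (g := fun z => φ (z m)) _ k, pd_coord (hφ _ hz)]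
  filter_upwards [eventually_coord_mem hI hz] with y hy using hf y hy

theorem pd_autonomousRHS {h : ℝ → ℝ} {I : Set ℝ} (hI : IsOpen I) (hh : ContDiffOn ℝ 1 h I)
    {z : Fin 3 → ℝ} (hz : z 2 ∈ I) (k : Fin 3) :
    pd k (autonomousRHS h) z = if k = 2 then jet h (z 2) 1 else 0 :=
  pd_eq_of_eqOn (φ := fun q => jet h q 0) (φ' := fun q => jet h q 1) hI
    (fun z _ => by simp [autonomousRHS, jet])
    (fun p hp => hasDerivAt_jet (n := 1) hI (by simpa using hh) hp one_pos) k hz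

theorem pd_pd_autonomousRHS {h : ℝ → ℝ} {I : Set ℝ} (hI : IsOpen I) (hh : ContDiffOn ℝ 2 h I)
    {z : Fin 3 → ℝ} (hz : z 2 ∈ I) (k : Fin 3) :
    pd k (pd 2 (autonomousRHS h)) z = if k = 2 then jet h (z 2) 2 else 0 :=
  pd_eq_of_eqOn (φ := fun q => jet h q 1) (φ' := fun q => jet h q 2) hI
    (fun z hz => by simp [pd_autonomousRHS hI (hh.of_le (by norm_num)) hz])
    (fun p hp => hasDerivAt_jet (n := 2) hI (by simpa using hh) hp (by norm_num)) k hz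

theorem feffermanMetric_apply {h : ℝ → ℝ} {I : Set ℝ} (hI : IsOpen I) (hh : ContDiffOn ℝ 2 h I)
    (i : ℝ) (ρ : (Fin 4 → ℝ) → ℝ) {x : Fin 4 → ℝ} (hx : x 2 ∈ I) (a b : Fin 4) :
    feffermanMetric i (autonomousRHS h) ρ x a b
      = ρ x ^ 2 * fefMatrix i (x 2) (jet h (x 2)) a b := by
  have hz : (![x 0, x 1, x 2] : Fin 3 → ℝ) 2 = x 2 := rfl
  have hz' : (![x 0, x 1, x 2] : Fin 3 → ℝ) 2 ∈ I := by rw [hz]; exact hx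
  have h0 : autonomousRHS h ![x 0, x 1, x 2] = jet h (x 2) 0 := by
    simp [autonomousRHS, jet]
  rw [feffermanMetric]
  simp only [pd_pd_autonomousRHS hI hh hz', pd_autonomousRHS hI (hh.of_le (by norm_num)) hz', hz,
    if_true, h0]
  revert a b
  refine forall_fin_four ?_ ?_ ?_ ?_ <;> refine forall_fin_four ?_ ?_ ?_ ?_ <;>
    simp [symProd, coordForm, fefMatrix] <;> ring

theorem isMultiple {n : ℕ} {i : ℝ} (hi : i ≠ 0) {h : ℝ → ℝ} {I : Set ℝ} (hI : IsOpen I)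
    (hh : ContDiffOn ℝ n h I) {U : Set (Fin 4 → ℝ)} (hU : IsOpen U) (hUI : U ⊆ overSet I)
    {Ω : (Fin 4 → ℝ) → ℝ} (hΩ : ContDiffOn ℝ ∞ Ω U) (hne : ∀ x ∈ U, Ω x ≠ 0) {g : MetricField}
    (hg : ∀ x ∈ U, ∀ a b, g x a b = Ω x * fefMatrix i (x 2) (jet h (x 2)) a b) :
    IsMultiple n i h Ω g U :=
  ⟨hi, hU, hΩ, hne, hg, fun _ hx _ hk => hasDerivAt_jet hI hh (hUI hx) hk⟩

/-! ### Cubic right-hand sides -/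

theorem eqOn_of_hasDerivAt {f g f' : ℝ → ℝ} {c r : ℝ} (hr : 0 < r)
    (hf : ∀ p ∈ Metric.ball c r, HasDerivAt f (f' p) p)
    (hg : ∀ p ∈ Metric.ball c r, HasDerivAt g (f' p) p) (hc : f c = g c) :
    Set.EqOn f g (Metric.ball c r) :=
  Metric.isOpen_ball.eqOn_of_deriv_eq (convex_ball c r).isPreconnected
    (fun p hp => (hf p hp).differentiableAt.differentiableWithinAt)
    (fun p hp => (hg p hp).differentiableAt.differentiableWithinAt)
    (fun p hp => (hf p hp).deriv.trans (hg p hp).deriv.symm) (Metric.mem_ball_self hr) hc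

/-- Integration of $h''''=0$ on an interval, from the third derivative down. The lower derivatives
are recorded because `exists_scale` uses them. -/
theorem exists_cubic {h : ℝ → ℝ} {c r : ℝ} (hr : 0 < r)
    (hj : ∀ p ∈ Metric.ball c r, ∀ k < 4, HasDerivAt (fun q => jet h q k) (jet h p (k + 1)) p)
    (h4 : ∀ p ∈ Metric.ball c r, jet h p 4 = 0) :
    ∃ a₀ a₁ a₂ a₃ : ℝ, ∀ p ∈ Metric.ball c r,
      jet h p 0 = a₀ + a₁ * p + a₂ * p ^ 2 + a₃ * p ^ 3 ∧
      jet h p 1 = a₁ + 2 * a₂ * p + 3 * a₃ * p ^ 2 ∧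
      jet h p 2 = 2 * a₂ + 6 * a₃ * p ∧ jet h p 3 = 6 * a₃ := by
  -- The constants of integration, fixed by matching values at the centre `c`.
  obtain ⟨a₃, e₃⟩ : ∃ a₃, a₃ = jet h c 3 / 6 := ⟨_, rfl⟩
  obtain ⟨a₂, e₂⟩ : ∃ a₂, a₂ = (jet h c 2 - 6 * a₃ * c) / 2 := ⟨_, rfl⟩
  obtain ⟨a₁, e₁⟩ : ∃ a₁, a₁ = jet h c 1 - 2 * a₂ * c - 3 * a₃ * c ^ 2 := ⟨_, rfl⟩
  obtain ⟨a₀, e₀⟩ : ∃ a₀, a₀ = jet h c 0 - a₁ * c - a₂ * c ^ 2 - a₃ * c ^ 3 := ⟨_, rfl⟩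
  have hpow : ∀ (p : ℝ) (n : ℕ), HasDerivAt (fun q : ℝ => q ^ n) (n * p ^ (n - 1)) p :=
    fun p n => hasDerivAt_pow n p
  have t3 := eqOn_of_hasDerivAt (g := fun _ => 6 * a₃) hr (fun p hp => hj p hp 3 (by norm_num))
    (fun p hp => (hasDerivAt_const p (6 * a₃)).congr_deriv (h4 p hp).symm) (by rw [e₃]; ring)
  have t2 := eqOn_of_hasDerivAt (g := fun q => 2 * a₂ + 6 * a₃ * q ^ 1) hr
    (fun p hp => hj p hp 2 (by norm_num))
    (fun p hp => (((hpow p 1).const_mul (6 * a₃)).const_add (2 * a₂)).congr_deriv (by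
      rw [show jet h p (2 + 1) = _ from t3 hp]; simp)) (by rw [e₂]; ring)
  have t1 := eqOn_of_hasDerivAt (g := fun q => a₁ + (2 * a₂ * q ^ 1 + 3 * a₃ * q ^ 2)) hr
    (fun p hp => hj p hp 1 (by norm_num))
    (fun p hp => ((((hpow p 1).const_mul (2 * a₂)).fun_add
      ((hpow p 2).const_mul (3 * a₃))).const_add a₁).congr_deriv (by
      rw [show jet h p (1 + 1) = _ from t2 hp]; norm_num; ring)) (by rw [e₁]; ring)
  have t0 := eqOn_of_hasDerivAt (g := fun q => a₀ + (a₁ * q ^ 1 + (a₂ * q ^ 2 + a₃ * q ^ 3))) hr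
    (fun p hp => hj p hp 0 (by norm_num))
    (fun p hp => (((hpow p 1).const_mul a₁).fun_add (((hpow p 2).const_mul a₂).fun_add
      ((hpow p 3).const_mul a₃))).const_add a₀ |>.congr_deriv (by
      rw [show jet h p (0 + 1) = _ from t1 hp]; norm_num; ring)) (by rw [e₀]; ring)
  refine ⟨a₀, a₁, a₂, a₃, fun p hp => ⟨(t0 hp).trans ?_, (t1 hp).trans ?_, (t2 hp).trans ?_,
    t3 hp⟩⟩ <;> ring

theorem exists_root_cubic (a₀ a₁ a₂ a₃ : ℝ) (h3 : a₃ ≠ 0) :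
    ∃ r : ℝ, a₀ + a₁ * r + a₂ * r ^ 2 + a₃ * r ^ 3 = 0 := by
  -- A monic cubic is nonnegative at $M=1+|b|+|c|+|d|$. Applied to the reflected cubic, this gives
  -- the opposite sign at a negative point, and the intermediate value theorem yields a root.
  have hbd : ∀ b c d : ℝ, 0 ≤ d + c * (1 + |b| + |c| + |d|) + b * (1 + |b| + |c| + |d|) ^ 2
      + (1 + |b| + |c| + |d|) ^ 3 := fun b c d => by
    have hb := neg_abs_le b
    have hc := neg_abs_le c
    have hd := neg_abs_le d
    have hb' := abs_nonneg b
    have hc' := abs_nonneg c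
    have hd' := abs_nonneg d
    set M := 1 + |b| + |c| + |d| with hM
    have hM1 : 1 ≤ M := by linarith
    have hM2 : M ≤ M ^ 2 := by nlinarith
    have t1 : -|b| * M ^ 2 ≤ b * M ^ 2 := by gcongr
    have t2 : -|c| * M ≤ c * M := by gcongr
    have t3 : |c| * M ≤ |c| * M ^ 2 := by gcongr
    have t4 : |d| * 1 ≤ |d| * M ^ 2 := by gcongr; linarith
    have t5 : M ^ 3 = (1 + |b| + |c| + |d|) * M ^ 2 := by rw [← hM]; ring
    nlinarith [sq_nonneg M]
  have hf : Continuous fun r : ℝ => a₀ / a₃ + a₁ / a₃ * r + a₂ / a₃ * r ^ 2 + r ^ 3 := by fun_prop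
  obtain ⟨r, hr⟩ := mem_range_of_exists_le_of_exists_ge hf (c := 0)
    ⟨_, by
      have := hbd (-(a₂ / a₃)) (a₁ / a₃) (-(a₀ / a₃))
      have h2 : a₀ / a₃ + a₁ / a₃ * -(1 + |-(a₂ / a₃)| + |a₁ / a₃| + |-(a₀ / a₃)|)
        + a₂ / a₃ * (-(1 + |-(a₂ / a₃)| + |a₁ / a₃| + |-(a₀ / a₃)|)) ^ 2
        + (-(1 + |-(a₂ / a₃)| + |a₁ / a₃| + |-(a₀ / a₃)|)) ^ 3 ≤ 0 := by linarith
      exact h2⟩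
    ⟨_, hbd (a₂ / a₃) (a₁ / a₃) (a₀ / a₃)⟩
  refine ⟨r, ?_⟩
  simp only at hr
  field_simp at hr
  linear_combination hr

/-- The exponents of an exponential scale that solves the Einstein equations. -/
theorem exists_scale (a₀ a₁ a₂ a₃ : ℝ) : ∃ α β : ℝ, ∀ p j₀ j₁ j₂ j₃ : ℝ,
    j₀ = a₀ + a₁ * p + a₂ * p ^ 2 + a₃ * p ^ 3 → j₁ = a₁ + 2 * a₂ * p + 3 * a₃ * p ^ 2 →
    j₂ = 2 * a₂ + 6 * a₃ * p → j₃ = 6 * a₃ →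
    j₁ * j₃ / 9 + j₂ * β / 6 - j₂ ^ 2 / 18 - j₃ * (α + β * p) / 6 + β ^ 2 = 0 ∧
    β * (α + β * p) + j₀ * j₃ / 6 - j₁ * j₂ / 18 + j₁ * β / 3 - j₂ * (α + β * p) / 6 = 0 ∧
    (α + β * p) ^ 2 + j₀ * j₂ / 3 + j₀ * β - j₁ * (α + β * p) / 3 - 2 / 9 * j₁ ^ 2 = 0 := by
  by_cases h3 : a₃ = 0
  -- For $h$ at most quadratic the solution has $\alpha+\beta p=-h'(p)/3$.
  · refine ⟨-a₁ / 3, -2 / 3 * a₂, ?_⟩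
    rintro p _ _ _ _ rfl rfl rfl rfl
    subst h3
    refine ⟨?_, ?_, ?_⟩ <;> ring
  · obtain ⟨r, hr⟩ := exists_root_cubic a₀ a₁ a₂ a₃ h3
    obtain rfl : a₀ = -(a₁ * r + a₂ * r ^ 2 + a₃ * r ^ 3) := by linear_combination hr
    -- Here $\beta=h''(r)/6$ and $\alpha+\beta p=\frac23h'(r)+\frac16h''(r)(p-r)$, where $h(r)=0$.
    refine ⟨2 / 3 * (a₁ + 2 * a₂ * r + 3 * a₃ * r ^ 2) - (a₂ + 3 * a₃ * r) / 3 * r,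
      (a₂ + 3 * a₃ * r) / 3, ?_⟩
    rintro p _ _ _ _ rfl rfl rfl rfl
    refine ⟨?_, ?_, ?_⟩ <;> ring

/-- The covector is $-d\sigma/\sigma$ for $\sigma=e^{\alpha x+\beta y-i\phi/3}$; it is constant,
hence `w` is zero. The three hypotheses are `e11`, `e01`, `e00` of `IsMultiple.false_of_hessian_eq`
for this $\sigma$ and $h''''=0$. -/
theorem confSchouten_eq_zero {i : ℝ} (hi : i ≠ 0) (p : ℝ) (j : ℕ → ℝ) {α β : ℝ} (h4 : j 4 = 0)
    (h11 : j 1 * j 3 / 9 + j 2 * β / 6 - j 2 ^ 2 / 18 - j 3 * (α + β * p) / 6 + β ^ 2 = 0)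
    (h01 : β * (α + β * p) + j 0 * j 3 / 6 - j 1 * j 2 / 18 + j 1 * β / 3
      - j 2 * (α + β * p) / 6 = 0)
    (h00 : (α + β * p) ^ 2 + j 0 * j 2 / 3 + j 0 * β - j 1 * (α + β * p) / 3
      - 2 / 9 * j 1 ^ 2 = 0) (a b : Fin 4) :
    confSchouten i p j (vec4 (-α) (-β) 0 (i / 3)) (fun _ _ => 0) a b = 0 := by
  have hii : i * i⁻¹ = 1 := mul_inv_cancel₀ hi
  have hu : ∑ e, vec4 (-α) (-β) 0 (i / 3) e * fefRaise i p j (vec4 (-α) (-β) 0 (i / 3)) e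
      = β + j 2 / 12 := by
    simp only [fefRaise, Fin.sum_univ_four, fefInverse, vec4_zero, vec4_one, vec4_two, vec4_three]
    field_simp
    ring
  have hc : ∀ t : ℝ, t * i⁻¹ * (i / 3) = t / 3 := fun t => by linear_combination t / 3 * hii
  rw [confSchouten, hu]
  revert a b
  refine forall_fin_four ?_ ?_ ?_ ?_ <;> refine forall_fin_four ?_ ?_ ?_ ?_ <;>
    simp only [fefSchouten, Fin.sum_univ_four, fefChristoffel, fefMatrix, vec4_zero, vec4_one,
      vec4_two, vec4_three, h4]
  · linear_combination h00 - 2 * p * h01 + p ^ 2 * h11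
      + (1 / 3 * j 1 * j 2 * p - 1 / 6 * j 1 * j 3 * p ^ 2 - 1 / 3 * j 1 ^ 2) / 3 * hii
  · linear_combination h01 - p * h11 + (-1 / 6 * j 1 * j 2 + 1 / 6 * j 1 * j 3 * p) / 3 * hii
  · linear_combination (1 / 2 * j 2 - 1 / 4 * j 3 * p) / 3 * hii
  · ring
  · linear_combination h01 - p * h11 + (-1 / 6 * j 1 * j 2 + 1 / 6 * j 1 * j 3 * p) / 3 * hii
  · linear_combination h11 + (-1 / 6 * j 1 * j 3) / 3 * hii
  · linear_combination (1 / 4 * j 3) / 3 * hii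
  · ring
  · linear_combination (1 / 2 * j 2 - 1 / 4 * j 3 * p) / 3 * hii
  · linear_combination (1 / 4 * j 3) / 3 * hii
  · ring
  · ring
  · ring
  · ring
  · ring
  · ring

theorem exists_isEinsteinOn {i : ℝ} (hi : i ≠ 0) {h : ℝ → ℝ} {J : Set ℝ} (hJ : IsOpen J)
    (hne : J.Nonempty) (hh : ContDiffOn ℝ 4 h J) (h4 : ∀ p ∈ J, iteratedDeriv 4 h p = 0) :
    ∃ U : Set (Fin 4 → ℝ), IsOpen U ∧ U.Nonempty ∧ U ⊆ overSet J ∧ ∃ g' : MetricField,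
      IsConformalOn (feffermanMetric i (autonomousRHS h) (fun _ => 1)) g' U ∧
      IsEinsteinOn g' U := by
  obtain ⟨c, hc⟩ := hne
  obtain ⟨r, hr, hrJ⟩ := Metric.isOpen_iff.1 hJ c hc
  obtain ⟨a₀, a₁, a₂, a₃, hcub⟩ := exists_cubic (h := h) hr
    (fun p hp k hk => hasDerivAt_jet (n := 4) hJ (by simpa using hh) (hrJ hp) hk)
    (fun p hp => h4 p (hrJ hp))
  obtain ⟨α, β, hαβ⟩ := exists_scale a₀ a₁ a₂ a₃
  -- $l=-\log\sigma$, so that $e^{2l}g=\sigma^{-2}g$; its Schouten tensor vanishes and the Einstein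
  -- constant is $0$.
  let l : (Fin 4 → ℝ) → ℝ := fun z => -α * z 0 + -β * z 1 + i / 3 * z 3
  have hl : ContDiff ℝ ∞ l := by fun_prop
  have hlg : ∀ z, HasGrad l (vec4 (-α) (-β) 0 (i / 3)) z := fun z => by
    refine ((((IsMultiple.hasGrad_coord 0 z).const_mul (-α)).add
      ((IsMultiple.hasGrad_coord 1 z).const_mul (-β))).add
      ((IsMultiple.hasGrad_coord 3 z).const_mul (i / 3))).congr_grad ?_
    refine forall_fin_four ?_ ?_ ?_ ?_ <;> simp
  have hexp : ContDiff ℝ ∞ (fun z => Real.exp (l z)) := Real.contDiff_exp.comp hl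
  have hU : IsOpen (overSet (Metric.ball c r)) :=
    Metric.isOpen_ball.preimage (continuous_apply 2)
  refine ⟨overSet (Metric.ball c r), hU, ⟨fun _ => c, Metric.mem_ball_self hr⟩,
    fun z hz => hrJ hz, fun z => Real.exp (l z) ^ 2 •
      feffermanMetric i (autonomousRHS h) (fun _ => 1) z,
    ⟨fun z => Real.exp (l z), hexp.contDiffOn, fun z _ => Real.exp_ne_zero _, fun _ _ => rfl⟩,
    0, fun x hx a b => ?_⟩
  have H : IsMultiple 4 i h (fun z => Real.exp (l z) ^ 2)
      (fun z => Real.exp (l z) ^ 2 • feffermanMetric i (autonomousRHS h) (fun _ => 1) z)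
      (overSet (Metric.ball c r)) :=
    isMultiple hi hJ (by simpa using hh) hU (fun z hz => hrJ hz) (hexp.pow 2).contDiffOn
      (fun z _ => pow_ne_zero 2 (Real.exp_ne_zero _)) fun z hz a b => by
        rw [Matrix.smul_apply, feffermanMetric_apply hJ (hh.of_le (by norm_num)) _ _ (hrJ hz)]
        simp
  have hlog : logGrad (fun z => Real.exp (l z) ^ 2) = fun _ => vec4 (-α) (-β) 0 (i / 3) := by
    funext z a
    refine (((hlg z).congr_of_eventuallyEq (Filter.Eventually.of_forall fun z => ?_)).pd_eq a)
    simp only [Real.log_pow, Real.log_exp]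
    push_cast
    ring
  have hhess : logHess (fun z => Real.exp (l z) ^ 2) x = fun _ _ => 0 := by
    funext k a
    rw [logHess, hlog]
    exact (HasGrad.const _).pd_eq k
  obtain ⟨e0, e1, e2, e3⟩ := hcub _ hx
  obtain ⟨h11, h01, h00⟩ := hαβ _ _ _ _ _ e0 e1 e2 e3
  rw [H.ricci_eq le_rfl hx, hlog, hhess]
  simp only [confSchouten_eq_zero hi (x 2) (jet h (x 2)) (h4 _ (hrJ hx)) h11 h01 h00]
  simp

/-! ### The relative invariants -/

/-- On functions of $p$ the operator $D$ is $h\,d/dp$, and all $y$-derivatives vanish, so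
$w_1=h(hh''')'-h'hh'''$. -/
theorem w1_w2_autonomousRHS {h : ℝ → ℝ} {I : Set ℝ} (hI : IsOpen I) (hh : ContDiffOn ℝ 4 h I)
    {z : Fin 3 → ℝ} (hz : z 2 ∈ I) :
    w1 (autonomousRHS h) z = h (z 2) ^ 2 * iteratedDeriv 4 h (z 2) ∧
      w2 (autonomousRHS h) z = iteratedDeriv 4 h (z 2) := by
  have hj : ∀ p ∈ I, ∀ k < 4, HasDerivAt (fun q => jet h q k) (jet h p (k + 1)) p :=
    fun p hp k hk => hasDerivAt_jet (n := 4) hI (by simpa using hh) hp hk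
  have d1 := fun (y : Fin 3 → ℝ) (hy : y 2 ∈ I) k =>
    pd_autonomousRHS hI (hh.of_le (by norm_num)) hy k
  have d2 := fun (y : Fin 3 → ℝ) (hy : y 2 ∈ I) k =>
    pd_pd_autonomousRHS hI (hh.of_le (by norm_num)) hy k
  have d3 : ∀ y : Fin 3 → ℝ, y 2 ∈ I → ∀ k, pd k (pd 2 (pd 2 (autonomousRHS h))) y
      = if k = 2 then jet h (y 2) 3 else 0 := fun y hy k =>
    pd_eq_of_eqOn (φ := fun q => jet h q 2) (φ' := fun q => jet h q 3) hI
      (fun y hy => by simp [d2 y hy]) (fun p hp => hj p hp 2 (by norm_num)) k hy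
  have d4 : ∀ y : Fin 3 → ℝ, y 2 ∈ I → ∀ k, pd k (pd 2 (pd 2 (pd 2 (autonomousRHS h)))) y
      = if k = 2 then jet h (y 2) 4 else 0 := fun y hy k =>
    pd_eq_of_eqOn (φ := fun q => jet h q 3) (φ' := fun q => jet h q 4) hI
      (fun y hy => by simp [d3 y hy]) (fun p hp => hj p hp 3 (by norm_num)) k hy
  have d11 : ∀ k, pd k (pd 1 (autonomousRHS h)) z = 0 := fun k =>
    (pd_eq_of_eqOn (φ := fun _ => 0) (φ' := fun _ => 0) (m := 2) hI
      (fun y hy => by simp [d1 y hy]) (fun p _ => hasDerivAt_const p 0) k hz).trans (by simp)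
  have d12 : ∀ k, pd k (pd 1 (pd 2 (autonomousRHS h))) z = 0 := fun k =>
    (pd_eq_of_eqOn (φ := fun _ => 0) (φ' := fun _ => 0) (m := 2) hI
      (fun y hy => by simp [d2 y hy]) (fun p _ => hasDerivAt_const p 0) k hz).trans (by simp)
  have hQ : ∀ y, autonomousRHS h y = jet h (y 2) 0 := fun y => by simp [autonomousRHS, jet]
  have hD : ∀ y : Fin 3 → ℝ, y 2 ∈ I →
      totalD (autonomousRHS h) (pd 2 (pd 2 (autonomousRHS h))) y
        = jet h (y 2) 0 * jet h (y 2) 3 := fun y hy => by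
    simp [totalD, d3 y hy, hQ]
  have hDD : ∀ k, pd k (totalD (autonomousRHS h) (pd 2 (pd 2 (autonomousRHS h)))) z
      = if k = 2 then jet h (z 2) 1 * jet h (z 2) 3 + jet h (z 2) 0 * jet h (z 2) 4 else 0 :=
    fun k => pd_eq_of_eqOn (φ := fun q => jet h q 0 * jet h q 3)
      (φ' := fun q => jet h q 1 * jet h q 3 + jet h q 0 * jet h q 4) hI hD
      (fun p hp => (hj p hp 0 (by norm_num)).mul (hj p hp 3 (by norm_num))) k hz
  have h0 : h (z 2) = jet h (z 2) 0 := by simp [jet]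
  constructor
  · rw [w1, hD z hz, totalD, totalD, hDD, hDD, hDD, d12, d12, d12, d11, d1 z hz, d1 z hz,
      d2 z hz, d2 z hz, hQ, h0, show iteratedDeriv 4 h (z 2) = jet h (z 2) 4 from rfl]
    simp
    ring
  · rw [w2, d4 z hz]
    simp [jet]

/-! ### The equation `h² h'''' = a p + b` -/

theorem contDiffOn_add_of_iteratedDeriv {I : Set ℝ} (hI : IsOpen I) {m : ℕ} (k : ℕ) {h : ℝ → ℝ}
    (hh : ContDiffOn ℝ k h I) (hm : ContDiffOn ℝ m (iteratedDeriv k h) I) :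
    ContDiffOn ℝ ((m + k : ℕ) : WithTop ℕ∞) h I := by
  induction k generalizing h with
  | zero => simpa using hm
  | succ k ih =>
    have h1 : ((k + 1 : ℕ) : WithTop ℕ∞) = (k : WithTop ℕ∞) + 1 := by simp
    have h2 : ((m + (k + 1) : ℕ) : WithTop ℕ∞) = ((m + k : ℕ) : WithTop ℕ∞) + 1 := by
      push_cast
      rw [add_assoc]
    rw [h1, contDiffOn_succ_iff_deriv_of_isOpen hI] at hh
    rw [h2, contDiffOn_succ_iff_deriv_of_isOpen hI]
    refine ⟨hh.1, by simp, ih hh.2.2 ?_⟩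
    rwa [← iteratedDeriv_succ']

/-- At a zero of $h$ one has $ap+b=0$, and the difference quotient of $aq+b=h\cdot hk$ tends to
$h'(p)\,h(p)\,k(p)=0$. So $a=0$, and then $b=0$. Only continuity of $k$ is used, since $h''''$ need
not be differentiable. -/
theorem ne_zero_of_sq_mul_eq {h k : ℝ → ℝ} {I : Set ℝ} {a b p : ℝ} (hI : IsOpen I) (hp : p ∈ I)
    (hh : DifferentiableAt ℝ h p) (hk : ContinuousAt k p) (hab : (a, b) ≠ (0, 0))
    (heq : ∀ q ∈ I, h q ^ 2 * k q = a * q + b) : h p ≠ 0 := by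
  intro h0
  have hb : a * p + b = 0 := by rw [← heq p hp, h0]; ring
  have t1 : Filter.Tendsto (slope (fun q => a * q + b) p) (nhdsWithin p {p}ᶜ) (nhds a) :=
    hasDerivAt_iff_tendsto_slope.1 (by
      simpa using ((hasDerivAt_id' p).const_mul a).add_const b)
  have t2 : Filter.Tendsto (fun q => slope h p q * (h q * k q)) (nhdsWithin p {p}ᶜ)
      (nhds (deriv h p * (h p * k p))) :=
    (hasDerivAt_iff_tendsto_slope.1 hh.hasDerivAt).mul
      ((hh.continuousAt.mul hk).tendsto.mono_left nhdsWithin_le_nhds)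
  have t3 : a = deriv h p * (h p * k p) := by
    refine tendsto_nhds_unique t1 (t2.congr' ?_)
    filter_upwards [nhdsWithin_le_nhds (hI.mem_nhds hp)] with q hq
    simp only [slope, vsub_eq_sub, smul_eq_mul, h0, hb, ← heq q hq]
    ring
  have ha : a = 0 := by rw [t3, h0]; ring
  exact hab (by rw [ha] at hb ⊢; simpa using hb)

theorem contDiffOn_six_of_sq_mul_eq {h : ℝ → ℝ} {I : Set ℝ} {a b : ℝ} (hI : IsOpen I)
    (hh : ContDiffOn ℝ 4 h I) (hab : (a, b) ≠ (0, 0))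
    (heq : ∀ p ∈ I, h p ^ 2 * iteratedDeriv 4 h p = a * p + b) :
    (∀ p ∈ I, h p ≠ 0) ∧ ContDiffOn ℝ 6 h I := by
  have hne : ∀ p ∈ I, h p ≠ 0 := fun p hp => by
    refine ne_zero_of_sq_mul_eq hI hp ((hh.contDiffAt (hI.mem_nhds hp)).differentiableAt
      (by norm_num)) ?_ hab heq
    have h1 : ContinuousOn (iteratedDerivWithin 4 h I) I :=
      hh.continuousOn_iteratedDerivWithin (by norm_num) hI.uniqueDiffOn
    refine (h1.continuousAt (hI.mem_nhds hp)).congr ?_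
    filter_upwards [hI.mem_nhds hp] with q hq using iteratedDerivWithin_of_isOpen hI hq
  refine ⟨hne, ?_⟩
  -- As $h$ has no zeros, $h''''=(ap+b)/h^2$ is as smooth as $h$; this bootstraps $C^4$ to $C^8$.
  have h4 : ContDiffOn ℝ 4 (iteratedDeriv 4 h) I := by
    refine ContDiffOn.congr (f := fun p => (a * p + b) / h p ^ 2) ?_ fun p hp => ?_
    · exact (by fun_prop : ContDiff ℝ 4 fun p : ℝ => a * p + b).contDiffOn.div (hh.pow 2)
        fun p hp => pow_ne_zero 2 (hne p hp)
    · have := hne p hp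
      rw [← heq p hp]
      field_simp
  exact (contDiffOn_add_of_iteratedDeriv hI (m := 4) 4 (by simpa using hh)
    (by simpa using h4)).of_le (by norm_num)

/-- The second derivative of $h^2h''''=ap+b$; the left side is the coefficient in the Bach tensor.
-/
theorem jet_relation {h : ℝ → ℝ} {I : Set ℝ} {a b p : ℝ} (hI : IsOpen I)
    (hh : ContDiffOn ℝ 6 h I) (heq : ∀ p ∈ I, h p ^ 2 * iteratedDeriv 4 h p = a * p + b)
    (hp : p ∈ I) :
    2 * jet h p 1 ^ 2 * jet h p 4 + 2 * jet h p 0 * jet h p 2 * jet h p 4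
      + 4 * jet h p 0 * jet h p 1 * jet h p 5 + jet h p 0 ^ 2 * jet h p 6 = 0 := by
  have hj : ∀ p ∈ I, ∀ k < 6, HasDerivAt (fun q => jet h q k) (jet h p (k + 1)) p :=
    fun p hp k hk => hasDerivAt_jet (n := 6) hI (by simpa using hh) hp hk
  have e0 : ∀ p ∈ I, jet h p 0 * jet h p 0 * jet h p 4 = a * p + b := fun p hp => by
    rw [← heq p hp]
    simp only [jet, iteratedDeriv_zero]
    ring
  have e1 : ∀ p ∈ I, (jet h p 1 * jet h p 0 + jet h p 0 * jet h p 1) * jet h p 4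
      + jet h p 0 * jet h p 0 * jet h p 5 = a := fun p hp => by
    have d0 := hj p hp 0 (by norm_num)
    refine ((d0.mul d0).mul (hj p hp 4 (by norm_num))).unique ?_
    have : HasDerivAt (fun q => a * q + b) a p := by
      simpa using ((hasDerivAt_id' p).const_mul a).add_const b
    refine this.congr_of_eventuallyEq ?_
    filter_upwards [hI.mem_nhds hp] with q hq using e0 q hq
  have d0 := hj p hp 0 (by norm_num)
  have d1 := hj p hp 1 (by norm_num)
  have d4 := hj p hp 4 (by norm_num)
  have d5 := hj p hp 5 (by norm_num)
  have e2 := ((((d1.mul d0).add (d0.mul d1)).mul d4).add ((d0.mul d0).mul d5)).unique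
    ((hasDerivAt_const p a).congr_of_eventuallyEq (by
      filter_upwards [hI.mem_nhds hp] with q hq using e1 q hq))
  simp only [Pi.add_apply, Pi.mul_apply] at e2
  linear_combination e2

/-- Common to the Fefferman metrics, where $\Omega=\rho^2$, and to the example, where $\Omega$ has
the sign of $i$. The function `τ` is a smooth square root of $\varepsilon/\Omega$. -/
theorem curvature_of_sq_mul_eq {i : ℝ} (hi : i ≠ 0) {h : ℝ → ℝ} {I : Set ℝ} {a b : ℝ}
    (hI : IsOpen I) (hh : ContDiffOn ℝ 6 h I) (h0 : ∀ p ∈ I, h p ≠ 0) (hab : (a, b) ≠ (0, 0))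
    (heq : ∀ p ∈ I, h p ^ 2 * iteratedDeriv 4 h p = a * p + b) {U : Set (Fin 4 → ℝ)}
    (hU : IsOpen U) (hUI : U ⊆ overSet I) {Ω τ : (Fin 4 → ℝ) → ℝ} {ε : ℝ}
    (hΩ : ContDiffOn ℝ ∞ Ω U) (hτ : ContDiffOn ℝ ∞ τ U) (hε : ε ≠ 0)
    (hΩτ : ∀ x ∈ U, Ω x * τ x ^ 2 = ε) {g : MetricField}
    (hg : ∀ x ∈ U, ∀ a b, g x a b = Ω x * fefMatrix i (x 2) (jet h (x 2)) a b) :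
    (∀ x ∈ U, HasSplitSignature (g x)) ∧ IsBachFlatOn g U ∧
      (∀ x ∈ U, a * x 2 + b ≠ 0 → HasTypeNN g x) ∧
      (U.Nonempty → ¬ ∃ g' : MetricField, IsConformalOn g g' U ∧ IsEinsteinOn g' U) := by
  have hne : ∀ x ∈ U, Ω x ≠ 0 := fun x hx h0 => hε (by rw [← hΩτ x hx, h0]; ring)
  have H : IsMultiple 6 i h Ω g U := isMultiple hi hI (by simpa using hh) hU hUI hΩ hne hg
  refine ⟨fun x hx => H.hasSplitSignature hx, fun x hx c d => ?_, fun x hx hx' => ?_, ?_⟩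
  · rw [H.bach_eq le_rfl hx, jet_relation hI hh heq (hUI hx)]
    ring
  · refine H.hasTypeNN (by norm_num) hx (by simpa [jet] using h0 _ (hUI hx)) fun h4 => hx' ?_
    rw [← heq _ (hUI hx), show iteratedDeriv 4 h (x 2) = 0 from h4, mul_zero]
  · rintro ⟨x, hx⟩ ⟨g', ⟨ρ, hρ, hρ0, hρg⟩, hE⟩
    have H' : IsMultiple 6 i h (fun z => ρ z ^ 2 * Ω z) g' U :=
      isMultiple hi hI (by simpa using hh) hU hUI ((hρ.pow 2).mul hΩ)
        (fun z hz => mul_ne_zero (pow_ne_zero 2 (hρ0 z hz)) (hne z hz)) fun z hz c d => by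
          rw [hρg z hz, Matrix.smul_apply, hg z hz, smul_eq_mul, mul_assoc]
    have h4 : ∀ z ∈ U, a * z 2 + b = 0 := fun z hz => by
      rw [← heq _ (hUI hz), show iteratedDeriv 4 h (z 2) = 0 from
        H'.jet_four_eq_zero (σ := fun z => τ z / ρ z) (by norm_num) (hτ.div hρ hρ0) hε
          (fun z hz => by
            have := hρ0 z hz
            rw [← hΩτ z hz]
            field_simp) hE hz, mul_zero]
    have ha : a = 0 := by
      have := (((IsMultiple.hasGrad_coord 2 x).const_mul a).add (HasGrad.const b)).unique
        ((HasGrad.const 0).congr_of_eventuallyEq (by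
          filter_upwards [hU.mem_nhds hx] with z hz using h4 z hz)) 2
      simpa using this
    have hb := h4 x hx
    exact hab (by rw [ha] at hb ⊢; simpa using hb)

theorem isEinsteinOn_conformal_iff {i : ℝ} (hi : i ≠ 0) {h : ℝ → ℝ} {I : Set ℝ} (hI : IsOpen I)
    (hh : ContDiffOn ℝ 6 h I) :
    (∃ U : Set (Fin 4 → ℝ), IsOpen U ∧ U.Nonempty ∧ U ⊆ overSet I ∧
        ∃ g' : MetricField,
          IsConformalOn (feffermanMetric i (autonomousRHS h) (fun _ => 1)) g' U ∧
          IsEinsteinOn g' U) ↔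
      ∃ J : Set ℝ, IsOpen J ∧ J.Nonempty ∧ J ⊆ I ∧ ∀ p ∈ J, iteratedDeriv 4 h p = 0 := by
  constructor
  · rintro ⟨U, hU, hne, hUI, g', ⟨ρ, hρ, hρ0, hρg⟩, hE⟩
    -- The coordinate projection is open, so the values of $p$ on $U$ form the required set $J$.
    refine ⟨(fun x => x 2) '' U, isOpenMap_eval 2 U hU, hne.image _, ?_, ?_⟩
    · rintro _ ⟨x, hx, rfl⟩
      exact hUI hx
    · rintro _ ⟨x, hx, rfl⟩
      have H : IsMultiple 6 i h (fun z => ρ z ^ 2) g' U :=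
        isMultiple hi hI (by simpa using hh) hU hUI (hρ.pow 2)
          (fun z hz => pow_ne_zero 2 (hρ0 z hz)) fun z hz c d => by
            rw [hρg z hz, Matrix.smul_apply,
              feffermanMetric_apply hI (hh.of_le (by norm_num)) _ _ (hUI hz)]
            simp
      exact H.jet_four_eq_zero (σ := fun z => (ρ z)⁻¹) (by norm_num) (hρ.inv hρ0) one_ne_zero
        (fun z hz => by
          have := hρ0 z hz
          field_simp) hE hx
  · rintro ⟨J, hJ, hne, hJI, h4⟩
    obtain ⟨U, hU, hUne, hUJ, hE⟩ :=
      exists_isEinsteinOn hi hJ hne ((hh.of_le (by norm_num)).mono hJI) h4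
    exact ⟨U, hU, hUne, fun z hz => hJI (hUJ hz), hE⟩

/-! ### The symmetries of the CR structure -/

/-- The vector field `∑ c_k z^k ∂_k`. -/
def diagonalField (c : Fin 3 → ℝ) : (Fin 3 → ℝ) → (Fin 3 → ℝ) := fun z k => c k * z k

theorem hasFDerivAt_diagonalField (c z : Fin 3 → ℝ) :
    HasFDerivAt (diagonalField c)
      (ContinuousLinearMap.pi fun k => c k • ContinuousLinearMap.proj (R := ℝ) (φ := fun _ => ℝ) k)
      z :=
  (ContinuousLinearMap.pi fun k =>
    c k • ContinuousLinearMap.proj (R := ℝ) (φ := fun _ => ℝ) k).hasFDerivAt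

theorem pd_diagonalField (c z : Fin 3 → ℝ) (j k : Fin 3) :
    pd j (diagonalField c) z k = if k = j then c k else 0 := by
  rw [pd, (hasFDerivAt_diagonalField c z).fderiv]
  by_cases hk : k = j
  · subst hk; simp
  · simp [hk]

theorem pd_crLambda {f : ℝ → ℝ} {f' : ℝ} {z : Fin 3 → ℝ} (hf : HasDerivAt f f' (z 2))
    (k j : Fin 3) :
    pd k (crLambda f) z j = if k = 2 then f' * coordForm 1 j else 0 := by
  have h1 : HasFDerivAt (fun z : Fin 3 → ℝ => z 2)
      (ContinuousLinearMap.proj (R := ℝ) (φ := fun _ => ℝ) 2) z := hasFDerivAt_apply 2 z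
  have h2 : HasFDerivAt (crLambda f) _ z :=
    ((hf.comp_hasFDerivAt z h1).smul_const (coordForm (n := 3) 1)).const_add (coordForm 0)
  rw [pd, h2.fderiv]
  by_cases hk : k = 2
  · subst hk; simp
  · simp [hk, Ne.symm hk]

theorem hasDerivAt_crProfile {y : ℝ} (hy : y ≠ 0) :
    HasDerivAt crProfile (-3 * y ^ (-4 : ℤ)) y := by
  refine (hasDerivAt_zpow (-3) y (Or.inl hy)).congr_deriv ?_
  norm_num

theorem pd_crMu (k : Fin 3) (z : Fin 3 → ℝ) : pd k crMu z = 0 := by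
  have h : HasFDerivAt crMu (0 : (Fin 3 → ℝ) →L[ℝ] (Fin 3 → ℂ)) z :=
    hasFDerivAt_const (fun j => (coordForm 1 j : ℂ) + Complex.I * (coordForm 2 j : ℂ)) z
  rw [pd, h.fderiv]
  rfl

/-- Translations in $u$ and $x$: the coefficients depend only on $y$. -/
theorem crSymmetry_const {f : ℝ → ℝ} {N : Set (Fin 3 → ℝ)}
    (hf : ∀ z ∈ N, DifferentiableAt ℝ f (z 2)) {v : Fin 3 → ℝ} (hv : v 2 = 0) :
    IsCRSymmetryOn (fun _ => v) (crLambda f) crMu N := by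
  refine ⟨contDiffOn_const, fun z hz => ⟨0, 0, 0, fun j => ⟨?_, ?_⟩⟩⟩
  · simp only [lieForm, Fin.sum_univ_three, pd_crLambda (hf z hz).hasDerivAt, hv]
    simp [pd]
  · simp only [lieForm, pd_crMu]
    simp [pd]

/-- With weights $(-2,1,1)$ for $(u,x,y)$ both $du$ and $y^{-3}dx$ have weight $-2$, and $\mu$ has
weight $1$. -/
theorem crSymmetry_diagonal {N : Set (Fin 3 → ℝ)} (hN : ∀ z ∈ N, z 2 ≠ 0) (c : ℝ) :
    IsCRSymmetryOn (diagonalField ![-2 * c, c, c]) (crLambda crProfile) crMu N := by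
  refine ⟨ContDiff.contDiffOn (contDiff_pi.2 fun k =>
    contDiff_const.mul (contDiff_apply ℝ ℝ k)), fun z hz => ⟨-2 * c, c, 0, fun j => ⟨?_, ?_⟩⟩⟩
  · have h0 := hN z hz
    simp only [lieForm, Fin.sum_univ_three, pd_crLambda (hasDerivAt_crProfile h0),
      pd_diagonalField]
    fin_cases j <;> simp [crLambda, coordForm, diagonalField, crProfile]
    field_simp
    ring
  · simp only [lieForm, Fin.sum_univ_three, pd_diagonalField, pd_crMu]
    fin_cases j <;> simp [crMu, coordForm, mul_comm]

theorem hasBianchiVISymmetry_crProfile :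
    HasBianchiVISymmetry (-(1 / 9)) (crLambda crProfile) crMu {z | z 2 ≠ 0} := by
  -- In type $VI_{-a^2}$, $\operatorname{ad}e_1$ has eigenvalues $-a-1$ on $e_2+e_3$ and $-a+1$ on
  -- $e_2-e_3$. These must be multiples of $\partial_u$ and $\partial_x$ with eigenvalue ratio $-2$,
  -- whence $a=1/3$ and the dilation factor $-2/3$.
  refine ⟨1 / 3, diagonalField ![-2 * (-2 / 3), -2 / 3, -2 / 3], fun _ => ![1, 1, 0],
    fun _ => ![1, -1, 0], by norm_num, by norm_num, crSymmetry_diagonal (fun z hz => hz) _,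
    crSymmetry_const (fun z hz => (hasDerivAt_crProfile hz).differentiableAt) rfl,
    crSymmetry_const (fun z hz => (hasDerivAt_crProfile hz).differentiableAt) rfl,
    fun z hz => ⟨?_, ?_, ?_, ?_⟩⟩
  · rw [Fintype.linearIndependent_iff]
    intro t ht
    have h0 := congrFun ht 0
    have h1 := congrFun ht 1
    have h2 := congrFun ht 2
    simp [Fin.sum_univ_three, diagonalField] at h0 h1 h2
    have t0 : t 0 = 0 := h2.resolve_right hz
    rw [t0] at h0 h1
    intro j
    fin_cases j
    · exact t0
    · show t 1 = 0
      linarith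
    · show t 2 = 0
      linarith
  · rw [VectorField.lieBracket, (hasFDerivAt_diagonalField _ z).fderiv]
    ext j
    fin_cases j <;> simp <;> norm_num
  · rw [VectorField.lieBracket, (hasFDerivAt_diagonalField _ z).fderiv]
    ext j
    fin_cases j <;> simp <;> norm_num
  · simp [VectorField.lieBracket]

/-! ### The example -/

theorem hasDerivAt_abs_rpow (r : ℝ) {p : ℝ} (hp : p ≠ 0) :
    HasDerivAt (fun q : ℝ => |q| ^ r) (r * |p| ^ r / p) p := by
  have hp' : |p| ≠ 0 := abs_ne_zero.2 hp
  refine ((hasDerivAt_abs hp).rpow_const (p := r) (Or.inl hp')).congr_deriv ?_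
  rw [Real.rpow_sub_one hp']
  rcases lt_or_gt_of_ne hp with h | h
  · simp [h, abs_of_neg h]
    field_simp
  · simp [h, abs_of_pos h]
    field_simp

theorem contDiffOn_abs_rpow (r : ℝ) : ContDiffOn ℝ ∞ (fun q : ℝ => |q| ^ r) {p | p ≠ 0} :=
  fun _ hp => ((contDiffAt_abs hp).rpow_const_of_ne (abs_ne_zero.2 hp)).contDiffWithinAt

/-- Writing the power as $|p|^{4/3}/p^n$ treats both signs of $p$ at once. -/
theorem jet_exampleRHS (i : ℝ) (n : ℕ) {p : ℝ} (hp : p ≠ 0) :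
    jet (exampleRHS i) p n
      = -3 / (2 * i) * (∏ m ∈ Finset.range n, (4 / 3 - (m : ℝ))) * |p| ^ (4 / 3 : ℝ) / p ^ n := by
  induction n generalizing p with
  | zero => simp [jet, exampleRHS]
  | succ n ih =>
    rw [jet, iteratedDeriv_succ]
    have h1 : iteratedDeriv n (exampleRHS i) =ᶠ[nhds p] fun q =>
        -3 / (2 * i) * (∏ m ∈ Finset.range n, (4 / 3 - (m : ℝ))) * |q| ^ (4 / 3 : ℝ) / q ^ n := by
      filter_upwards [isOpen_ne.mem_nhds hp] with q hq using ih hq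
    rw [h1.deriv_eq, (((hasDerivAt_abs_rpow (4 / 3) hp).const_mul _).fun_div (hasDerivAt_pow n p)
      (pow_ne_zero n hp)).deriv, Finset.prod_range_succ]
    cases n with
    | zero => simp; field_simp
    | succ n =>
      simp only [Nat.add_sub_cancel]
      field_simp
      push_cast
      ring

/-- With $s=|p|^{1/3}$ every fractional power below becomes an integer power of $s$, and $s^6=p^2$
is the only relation needed. -/
theorem abs_rpow_third (p : ℝ) : (|p| ^ (1 / 3 : ℝ)) ^ 6 = p ^ 2 := by
  rw [← Real.rpow_natCast, ← Real.rpow_mul (abs_nonneg p), ← sq_abs, ← Real.rpow_natCast]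
  norm_num

theorem abs_rpow_two_thirds (p : ℝ) : |p| ^ (2 / 3 : ℝ) = (|p| ^ (1 / 3 : ℝ)) ^ 2 := by
  rw [← Real.rpow_natCast, ← Real.rpow_mul (abs_nonneg p)]
  norm_num

theorem abs_rpow_four_thirds (p : ℝ) : |p| ^ (4 / 3 : ℝ) = (|p| ^ (1 / 3 : ℝ)) ^ 4 := by
  rw [← Real.rpow_natCast, ← Real.rpow_mul (abs_nonneg p)]
  norm_num

theorem exampleRHS_sq_mul (i : ℝ) (hi : i ≠ 0) {p : ℝ} (hp : p ≠ 0) :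
    exampleRHS i p ^ 2 * iteratedDeriv 4 (exampleRHS i) p = -5 / (3 * i ^ 3) := by
  have h1 := jet_exampleRHS i 4 hp
  rw [jet] at h1
  have h2 := abs_rpow_third p
  rw [h1, exampleRHS, abs_rpow_four_thirds]
  generalize |p| ^ (1 / 3 : ℝ) = s at h2
  have h3 : s ^ 12 = p ^ 4 := by linear_combination (s ^ 6 + p ^ 2) * h2
  simp only [Finset.prod_range_succ, Finset.prod_range_zero]
  push_cast
  field_simp
  ring_nf
  rw [h3]

theorem contDiffOn_exampleRHS (i : ℝ) : ContDiffOn ℝ ∞ (exampleRHS i) {p | p ≠ 0} :=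
  contDiffOn_const.mul (contDiffOn_abs_rpow _)

theorem exampleRHS_ne_zero {i : ℝ} (hi : i ≠ 0) {p : ℝ} (hp : p ≠ 0) : exampleRHS i p ≠ 0 := by
  have : 0 < |p| ^ (4 / 3 : ℝ) := Real.rpow_pos_of_pos (abs_pos.2 hp) _
  rw [exampleRHS]
  positivity

theorem abs_neg_crProfile_rpow (y : ℝ) : |-crProfile y| ^ (4 / 3 : ℝ) = y ^ (-4 : ℤ) := by
  have h1 : |-crProfile y| = |y| ^ (-3 : ℝ) := by
    rw [abs_neg, crProfile, abs_zpow, ← Real.rpow_intCast]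
    norm_num
  rw [h1, ← Real.rpow_mul (abs_nonneg y), ← Even.zpow_abs (by decide : Even (-4 : ℤ)) y,
    ← Real.rpow_intCast]
  norm_num

theorem exampleRHS_neg_crProfile (i : ℝ) {y : ℝ} (hy : y ≠ 0) :
    exampleRHS i (-crProfile y) = 1 / (2 * i) * deriv crProfile y := by
  rw [(hasDerivAt_crProfile hy).deriv, exampleRHS, abs_neg_crProfile_rpow]
  ring

/-- The factor $i|P|^{2/3}$ turns $h,h',h''$ into $-\frac32P^2$, $-2P$, $-\frac23$, and the metric
involves no higher derivatives. -/
theorem exampleMetric_apply {i : ℝ} (hi : i ≠ 0) {x : Fin 4 → ℝ} (hx : x 2 ≠ 0) (a b : Fin 4) :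
    exampleMetric i x a b
      = i * |x 2| ^ (2 / 3 : ℝ) * fefMatrix i (x 2) (jet (exampleRHS i) (x 2)) a b := by
  have hs := abs_rpow_third (x 2)
  have h0 : i * |x 2| ^ (2 / 3 : ℝ) * jet (exampleRHS i) (x 2) 0 = -3 / 2 * x 2 ^ 2 := by
    rw [jet_exampleRHS i 0 hx, abs_rpow_two_thirds, abs_rpow_four_thirds, ← hs]
    simp only [Finset.prod_range_zero]
    field_simp
  have h1 : i * |x 2| ^ (2 / 3 : ℝ) * jet (exampleRHS i) (x 2) 1 = -2 * x 2 := by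
    rw [jet_exampleRHS i 1 hx, abs_rpow_two_thirds, abs_rpow_four_thirds]
    simp only [Finset.prod_range_succ, Finset.prod_range_zero]
    push_cast
    field_simp
    linear_combination -4 * hs
  have h2 : i * |x 2| ^ (2 / 3 : ℝ) * jet (exampleRHS i) (x 2) 2 = -2 / 3 := by
    rw [jet_exampleRHS i 2 hx, abs_rpow_two_thirds, abs_rpow_four_thirds]
    simp only [Finset.prod_range_succ, Finset.prod_range_zero]
    push_cast
    field_simp
    linear_combination -4 * hs
  generalize jet (exampleRHS i) (x 2) = j at h0 h1 h2
  simp only [exampleMetric]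
  generalize |x 2| ^ (2 / 3 : ℝ) = s at h0 h1 h2
  revert a b
  refine forall_fin_four ?_ ?_ ?_ ?_ <;> refine forall_fin_four ?_ ?_ ?_ ?_ <;>
    simp [symProd, coordForm, fefMatrix]
  · linear_combination 2 * h0 - 4 / 3 * x 2 * h1 + 1 / 3 * x 2 ^ 2 * h2
  · linear_combination 2 / 3 * h1 - 1 / 3 * x 2 * h2
  · ring
  · linear_combination 2 / 3 * h1 - 1 / 3 * x 2 * h2
  · linear_combination 1 / 3 * h2
  · ring
  · ring
  · ring

/-! ### The equivalence with the CR structure -/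

/-- The inverse of `y ↦ -y⁻³`. -/
def profileInv (p : ℝ) : ℝ := -p * |p| ^ (-4 / 3 : ℝ)

theorem abs_rpow_neg_four_thirds (p : ℝ) :
    |p| ^ (-4 / 3 : ℝ) = ((|p| ^ (1 / 3 : ℝ)) ^ 4)⁻¹ := by
  rw [← abs_rpow_four_thirds, ← Real.rpow_neg (abs_nonneg p)]
  norm_num

theorem contDiffOn_profileInv : ContDiffOn ℝ ∞ profileInv {p | p ≠ 0} :=
  contDiffOn_id.neg.mul (contDiffOn_abs_rpow _)

theorem profileInv_ne_zero {p : ℝ} (hp : p ≠ 0) : profileInv p ≠ 0 :=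
  mul_ne_zero (neg_ne_zero.2 hp) (Real.rpow_pos_of_pos (abs_pos.2 hp) _).ne'

theorem neg_crProfile_profileInv {p : ℝ} (hp : p ≠ 0) : -crProfile (profileInv p) = p := by
  have hs := abs_rpow_third p
  have hs0 : |p| ^ (1 / 3 : ℝ) ≠ 0 := (Real.rpow_pos_of_pos (abs_pos.2 hp) _).ne'
  rw [crProfile, profileInv, abs_rpow_neg_four_thirds]
  generalize |p| ^ (1 / 3 : ℝ) = s at hs hs0
  rw [zpow_neg, show (3 : ℤ) = ((3 : ℕ) : ℤ) from rfl, zpow_natCast]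
  field_simp
  linear_combination (s ^ 6 + p ^ 2) * hs

theorem profileInv_neg_crProfile {y : ℝ} (hy : y ≠ 0) : profileInv (-crProfile y) = y := by
  rw [profileInv, show (-4 / 3 : ℝ) = -(4 / 3) by norm_num, Real.rpow_neg (abs_nonneg _),
    abs_neg_crProfile_rpow, crProfile]
  rw [zpow_neg, zpow_neg, inv_inv, neg_neg, show (4 : ℤ) = 3 + 1 from rfl, zpow_add_one₀ hy,
    inv_mul_cancel_left₀ (zpow_ne_zero 3 hy)]

theorem contDiffOn_crProfile : ContDiffOn ℝ ∞ crProfile {y | y ≠ 0} := by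
  refine ContDiffOn.congr (f := fun y => (y ^ 3)⁻¹)
    (ContDiffOn.inv (by fun_prop) fun y hy => pow_ne_zero 3 hy) fun y _ => ?_
  rw [crProfile, zpow_neg]
  rfl

theorem pd_pi {n : ℕ} {Φ : (Fin n → ℝ) → (Fin n → ℝ)} {z : Fin n → ℝ} {G : Fin n → Fin n → ℝ}
    (h : ∀ k, HasGrad (fun z => Φ z k) (G k) z) (j k : Fin n) : pd j Φ z k = G k j := by
  rw [pd, fderiv_pi (φ := fun k z => Φ z k) fun k => (h k).diff]
  exact (h k).pd_eq j

theorem pointEquivalent_crProfile {i : ℝ} (hi : i ≠ 0) :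
    PointEquivalent (realifiedForms i crProfile) {z | z 2 ≠ 0}
      (odeForms i (autonomousRHS (exampleRHS i))) {z | z 2 ≠ 0} := by
  have hc : ∀ k, ContDiffOn ℝ ∞ (fun z : Fin 3 → ℝ => z k) {z : Fin 3 → ℝ | z 2 ≠ 0} :=
    fun k => (contDiff_apply ℝ ℝ k).contDiffOn
  have hinv : ContDiffOn ℝ ∞ (fun z : Fin 3 → ℝ => (z 2)⁻¹) {z : Fin 3 → ℝ | z 2 ≠ 0} :=
    (hc 2).inv fun z hz => hz
  have hg : ContDiffOn ℝ ∞ (fun z : Fin 3 → ℝ => profileInv (z 2)) {z : Fin 3 → ℝ | z 2 ≠ 0} :=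
    contDiffOn_profileInv.comp (hc 2) fun z hz => hz
  -- $X=x-iy$ gives $dX=\bar\mu$; with $P=-f(y)$, $Y=u-\frac i2y^{-2}$ one gets $dY-P\,dX=\lambda$.
  -- Then $h(-f)=f'/(2i)$ yields $dP-h\,dX=-\frac{f'}{2i}\mu$, the source of the coefficient
  -- $\frac3{2i}y^{-4}$.
  refine ⟨fun z => ![z 1 - i * z 2, z 0 - i / 2 * (z 2)⁻¹ ^ 2, -crProfile (z 2)],
    fun w => ![w 1 + i / 2 * (profileInv (w 2))⁻¹ ^ 2, w 0 + i * profileInv (w 2),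
      profileInv (w 2)], ?_, ?_, ?_, ?_, ⟨?_, ?_⟩,
    fun _ => -i, fun z => 3 / (2 * i) * (z 2)⁻¹ ^ 4, fun _ => 1, fun _ => 0, fun _ => 0,
    contDiffOn_const, contDiffOn_const.mul (hinv.pow 4), contDiffOn_const, contDiffOn_const,
    contDiffOn_const, ?_⟩
  · refine contDiffOn_pi.2 fun k => ?_
    fin_cases k
    · exact (hc 1).sub (contDiffOn_const.mul (hc 2))
    · exact (hc 0).sub (contDiffOn_const.mul (hinv.pow 2))
    · exact (contDiffOn_crProfile.comp (hc 2) fun z hz => hz).neg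
  · refine contDiffOn_pi.2 fun k => ?_
    fin_cases k
    · exact (hc 1).add (contDiffOn_const.mul ((hg.inv fun z hz => profileInv_ne_zero hz).pow 2))
    · exact (hc 0).add (contDiffOn_const.mul hg)
    · exact hg
  · exact fun z hz => neg_ne_zero.2 (zpow_ne_zero _ hz)
  · exact fun w hw => profileInv_ne_zero hw
  · intro z hz
    ext k
    fin_cases k <;> simp [profileInv_neg_crProfile hz]
  · intro w hw
    ext k
    fin_cases k <;> simp [neg_crProfile_profileInv hw]
  · intro z hz
    have hz : z 2 ≠ 0 := hz
    have hgrad : ∀ k, HasGrad (fun z : Fin 3 → ℝ =>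
        (![z 1 - i * z 2, z 0 - i / 2 * (z 2)⁻¹ ^ 2, -crProfile (z 2)] : Fin 3 → ℝ) k)
        ((![![0, 1, -i], ![1, 0, i * (z 2)⁻¹ ^ 3], ![0, 0, 3 * (z 2)⁻¹ ^ 4]] :
          Fin 3 → Fin 3 → ℝ) k) z := by
      intro k
      have hid : ∀ m : Fin 3, HasGrad (fun z : Fin 3 → ℝ => z m) _ z := fun m =>
        HasGrad.comp_coord (φ := fun q => q) (hasDerivAt_id' _)
      have h2 : HasGrad (fun z : Fin 3 → ℝ => (z 2)⁻¹) _ z :=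
        HasGrad.comp_coord (φ := fun q => q⁻¹) (hasDerivAt_inv hz)
      fin_cases k
      · refine ((hid 1).sub ((hid 2).const_mul i)).congr_grad fun j => ?_
        fin_cases j <;> simp
      · refine HasGrad.congr_grad (F := fun j => _) (((hid 0).sub
          ((h2.mul h2).const_mul (i / 2))).congr_of_eventuallyEq
          (Filter.Eventually.of_forall fun y => ?_)) fun j => ?_
        · simp [pow_two]
        · fin_cases j <;> simp
          field_simp
          ring
      · have h3 : HasGrad (fun z : Fin 3 → ℝ => crProfile (z 2)) _ z :=
          HasGrad.comp_coord (hasDerivAt_crProfile hz)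
        refine h3.neg.congr_grad fun j => ?_
        fin_cases j <;> simp
    have h4 : exampleRHS i (-crProfile (z 2)) = -3 / (2 * i) * (z 2)⁻¹ ^ 4 := by
      rw [exampleRHS_neg_crProfile i hz, (hasDerivAt_crProfile hz).deriv, zpow_neg, inv_pow]
      rw [show (4 : ℤ) = ((4 : ℕ) : ℤ) from rfl, zpow_natCast]
      ring
    have h5 : crProfile (z 2) = (z 2)⁻¹ ^ 3 := by
      rw [crProfile, zpow_neg, inv_pow]
      rfl
    refine ⟨neg_ne_zero.2 hi, by positivity, one_ne_zero, ?_, ?_, ?_⟩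
    · ext j
      simp only [pullback, pd_pi hgrad, Fin.sum_univ_three]
      fin_cases j <;> simp [odeForms, realifiedForms, crLambda, coordForm, h5]
      ring
    · ext j
      simp only [pullback, pd_pi hgrad, Fin.sum_univ_three]
      fin_cases j <;> simp [odeForms, realifiedForms, autonomousRHS, coordForm, h4]
      all_goals field_simp
      all_goals ring
    · ext j
      simp only [pullback, pd_pi hgrad, Fin.sum_univ_three]
      fin_cases j <;> simp [odeForms, realifiedForms, coordForm]

theorem exampleMetric_curvature {i : ℝ} (hi : i ≠ 0) {U : Set (Fin 4 → ℝ)} (hU : IsOpen U)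
    (hUI : U ⊆ overSet {p | p ≠ 0}) {g : MetricField} (hg : IsConformalOn (exampleMetric i) g U) :
    (∀ x ∈ U, HasSplitSignature (g x)) ∧ IsBachFlatOn g U ∧ (∀ x ∈ U, HasTypeNN g x) ∧
      (U.Nonempty → ¬ ∃ g' : MetricField, IsConformalOn g g' U ∧ IsEinsteinOn g' U) := by
  obtain ⟨ρ, hρ, hρ0, hρg⟩ := hg
  have hb : -5 / (3 * i ^ 3) ≠ 0 := div_ne_zero (by norm_num) (by positivity)
  have hr : ∀ r : ℝ, ContDiffOn ℝ ∞ (fun x : Fin 4 → ℝ => |x 2| ^ r) U := fun r =>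
    (contDiffOn_abs_rpow r).comp (contDiff_apply ℝ ℝ 2).contDiffOn hUI
  have hr0 : ∀ x ∈ U, |x 2| ^ (1 / 3 : ℝ) ≠ 0 := fun x hx =>
    (Real.rpow_pos_of_pos (abs_pos.2 (hUI hx)) _).ne'
  obtain ⟨h1, h2, h3, h4⟩ := curvature_of_sq_mul_eq hi (h := exampleRHS i) (I := {p | p ≠ 0})
    (a := 0) (b := -5 / (3 * i ^ 3)) (ε := i) isOpen_ne
    (contDiffOn_infty.1 (contDiffOn_exampleRHS i) 6)
    (fun p hp => exampleRHS_ne_zero hi hp) (by simpa using hi)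
    (fun p hp => by rw [exampleRHS_sq_mul i hi hp]; ring) hU hUI
    -- Here $\Omega\tau^2=i$, so that $\varepsilon=i$ absorbs the sign.
    (Ω := fun x => ρ x ^ 2 * (i * |x 2| ^ (2 / 3 : ℝ)))
    (τ := fun x => (ρ x * |x 2| ^ (1 / 3 : ℝ))⁻¹)
    ((hρ.pow 2).mul (contDiffOn_const.mul (hr _)))
    ((hρ.mul (hr _)).inv fun x hx => mul_ne_zero (hρ0 x hx) (hr0 x hx)) hi
    (fun x hx => by
      have t1 := hρ0 x hx
      have t2 := hr0 x hx
      rw [abs_rpow_two_thirds]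
      field_simp)
    (g := g) fun x hx c d => by
      rw [hρg x hx, Matrix.smul_apply, exampleMetric_apply hi (hUI hx), smul_eq_mul]
      ring
  exact ⟨h1, h2, fun x hx => h3 x hx (by simpa using hi), h4⟩

end FeffermanODE

end

/-! ### The main theorem -/

theorem mainTheorem5 :
    -- the equations `y'' = h(y')`
    (∀ (i : ℝ), i ≠ 0 → ∀ (I : Set ℝ) (h : ℝ → ℝ), IsOpen I → ContDiffOn ℝ 4 h I →
      -- the relative invariants
      (∀ z : Fin 3 → ℝ, z 2 ∈ I →
        w1 (autonomousRHS h) z = h (z 2) ^ 2 * iteratedDeriv 4 h (z 2) ∧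
        w2 (autonomousRHS h) z = iteratedDeriv 4 h (z 2)) ∧
      -- criterion for being conformal to an Einstein metric somewhere
      (ContDiffOn ℝ 6 h I →
        ((∃ U : Set (Fin 4 → ℝ), IsOpen U ∧ U.Nonempty ∧ U ⊆ overSet I ∧
            ∃ g' : MetricField,
              IsConformalOn (feffermanMetric i (autonomousRHS h) (fun _ => 1)) g' U ∧
              IsEinsteinOn g' U) ↔
          ∃ J : Set ℝ, IsOpen J ∧ J.Nonempty ∧ J ⊆ I ∧ ∀ p ∈ J, iteratedDeriv 4 h p = 0)) ∧
      -- the solutions of `h² h'''' = a p + b`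
      (∀ a b : ℝ, (a, b) ≠ (0, 0) →
        (∀ p ∈ I, h p ^ 2 * iteratedDeriv 4 h p = a * p + b) →
        ∀ U : Set (Fin 4 → ℝ), IsOpen U → U ⊆ overSet I →
        ∀ ρ : (Fin 4 → ℝ) → ℝ, ContDiffOn ℝ ∞ ρ U → (∀ x ∈ U, ρ x ≠ 0) →
          (∀ x ∈ U, HasSplitSignature (feffermanMetric i (autonomousRHS h) ρ x)) ∧
          IsBachFlatOn (feffermanMetric i (autonomousRHS h) ρ) U ∧
          (∀ x ∈ U, a * x 2 + b ≠ 0 →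
            HasTypeNN (feffermanMetric i (autonomousRHS h) ρ) x) ∧
          (U.Nonempty → ¬ ∃ g' : MetricField,
            IsConformalOn (feffermanMetric i (autonomousRHS h) ρ) g' U ∧ IsEinsteinOn g' U))) ∧
    -- the CR structure with `f(y) = y^{-3}`
    (∃ k : ℝ, k < 0 ∧ HasBianchiVISymmetry k (crLambda crProfile) crMu {z | z 2 ≠ 0}) ∧
    -- the example which it gives
    (∀ (i : ℝ), i ≠ 0 →
      (∀ y : ℝ, y ≠ 0 → exampleRHS i (-crProfile y) = 1 / (2 * i) * deriv crProfile y) ∧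
      PointEquivalent (realifiedForms i crProfile) {z | z 2 ≠ 0}
        (odeForms i (autonomousRHS (exampleRHS i))) {z | z 2 ≠ 0} ∧
      ContDiffOn ℝ ∞ (exampleRHS i) {p | p ≠ 0} ∧
      (∀ p : ℝ, p ≠ 0 →
        exampleRHS i p ^ 2 * iteratedDeriv 4 (exampleRHS i) p = -5 / (3 * i ^ 3)) ∧
      (∀ x : Fin 4 → ℝ, x 2 ≠ 0 →
        exampleMetric i x = (i * |x 2| ^ (2 / 3 : ℝ)) •
          feffermanMetric i (autonomousRHS (exampleRHS i)) (fun _ => 1) x) ∧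
      ∀ U : Set (Fin 4 → ℝ), IsOpen U → U ⊆ overSet {p | p ≠ 0} →
      ∀ g : MetricField, IsConformalOn (exampleMetric i) g U →
        (∀ x ∈ U, HasSplitSignature (g x)) ∧ IsBachFlatOn g U ∧ (∀ x ∈ U, HasTypeNN g x) ∧
        (U.Nonempty → ¬ ∃ g' : MetricField, IsConformalOn g g' U ∧ IsEinsteinOn g' U)) := by
  refine ⟨fun i hi I h hI hh => ⟨fun z hz => w1_w2_autonomousRHS hI hh hz,
    fun h6 => isEinsteinOn_conformal_iff hi hI h6, fun a b hab heq U hU hUI ρ hρ hρ0 => ?_⟩,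
    ⟨-(1 / 9), by norm_num, hasBianchiVISymmetry_crProfile⟩,
    fun i hi => ⟨fun y hy => exampleRHS_neg_crProfile i hy, pointEquivalent_crProfile hi,
      contDiffOn_exampleRHS i, fun p hp => exampleRHS_sq_mul i hi hp, fun x hx => ?_,
      fun U hU hUI g hg => exampleMetric_curvature hi hU hUI hg⟩⟩
  -- Only $C^4$ is assumed; the equation itself provides the sixth derivative that enters the Bach
  -- tensor.
  · obtain ⟨h0, h6⟩ := contDiffOn_six_of_sq_mul_eq hI hh hab heq
    exact curvature_of_sq_mul_eq hi hI h6 h0 hab heq hU hUI (Ω := fun x => ρ x ^ 2)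
      (τ := fun x => (ρ x)⁻¹) (hρ.pow 2) (hρ.inv hρ0) one_ne_zero
      (fun x hx => by
        have := hρ0 x hx
        field_simp)
      fun x hx c d => feffermanMetric_apply hI (hh.of_le (by norm_num)) i ρ (hUI hx) c d
  · ext c d
    rw [exampleMetric_apply hi hx, Matrix.smul_apply, feffermanMetric_apply (I := {p | p ≠ 0})
      isOpen_ne (contDiffOn_infty.1 (contDiffOn_exampleRHS i) 2) _ _ hx]
    simp [mul_assoc]
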